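/- Let $n\ge 1$, $\lambda\in\mathbb{C}$, $K=\mathrm{SO}(n+1)$, $\mathfrak g=\mathrm{o}(n+1,1)$, and let $\mathcal F_\lambda(\mathbb S^n)$ be the space of smooth complex tensor densities of degree $\lambda$ on the sphere $\mathbb S^n\subset\mathbb R^{n+1}$, locally $\varphi(u_1,\dots,u_n)\,|du_1\wedge\dots\wedge du_n|^\lambda$. The Lie algebra $\mathfrak g$ acts on it through the conformal vector fields $X=\sum X^i\,\partial/\partial u_i$ of $\mathbb S^n$ by the Lie derivative of degree $\lambda$, $L^\lambda_X\varphi=\sum_i X^i\,\partial\varphi/\partial u_i+\lambda\big(\sum_i\partial X^i/\partial u_i\big)\varphi$, and $K$ acts as a group of diffeomorphisms of $\mathbb S^n$. (More precisely, $A\in\mathfrak g$ acts by $L^\lambda_X$, where $X$ is the field $x\mapsto \frac{d}{dt}\exp(-tA)\cdot x\,|_{t=0}$ for the conformal action of $\mathrm{SO}_0(n+1,1)$ on $\mathbb S^n$.) Let $\omega$ be the Euclidean volume element of $\mathbb S^n$. To a complex polynomial $P$ in the Cartesian coordinates $x_0,\dots,x_n$ we attach the density $P|_{\mathbb S^n}\,\omega^\lambda\in\mathcal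 F_\lambda(\mathbb S^n)$; on these densities $K$ acts by the left regular representation $(k\cdot P)(x)=P(k^{-1}x)$. Let $\mathcal H^{n+1,m}\subset\mathcal F_\lambda(\mathbb S^n)$ be the subspace given by the polynomials that are homogeneous of degree $m$ and harmonic ($\sum_i\partial^2P/\partial x_i^2=0$). Then: 1. These formulas define a representation of $\mathfrak g$ on $\mathcal F_\lambda(\mathbb S^n)$; the space of $K$-finite vectors of $\mathcal F_\lambda(\mathbb S^n)$ is stable under $\mathfrak g$ and $K$ and is a $(\mathfrak g,K)$-module. 2. This $(\mathfrak g,K)$-module is the space $\mathcal H(K)$ of harmonic polynomials restricted to the sphere (with the structure induced by $\mathcal F_\lambda(\mathbb S^n)$): the map $P\mapsto P|_{\mathbb S^n}\,\omega^\lambda$ is a bijection from the space of all harmonic polynomials onto the space of $K$-finite vectors, and the latter is the direct sum $\mathcal H(K)=\bigoplus_{m\ge0}\mathcal H^{n+1,m}$. 3. If $n\ge2$, each $\mathcal H^{n+1,m}$ is a simple $K$-module isomorphic to $D^{0,\dots,0,m}$. If $n=1$, $\mathcal H^{2,0}\cong D^0$, and for $m\ge1$ one has $\mathcal H^{2,m}=H_m\oplus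 H_{-m}$, where $H_{\pm m}\cong D^{\pm m}$ is the line spanned by $(x_0\pm i x_1)^m\,\omega^\lambda$. Here $D^{m_1,\dots,m_k}$, with $k=\lfloor (n+1)/2\rfloor$, is the simple $\mathrm{SO}(n+1)$-module with highest weight $m_k\varepsilon_1+m_{k-1}\varepsilon_2+\dots+m_1\varepsilon_k$, where $\varepsilon_1,\dots,\varepsilon_k$ is the basis dual to the basis $H_r=i(E_{2r,2r-1}-E_{2r-1,2r})$ of the Cartan subalgebra of $\mathrm{o}(n+1,\mathbb C)$, the positive roots being $\varepsilon_r\pm\varepsilon_s$ ($r<s$) and, if $n+1$ is odd, also the $\varepsilon_r$. -/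

import Mathlib

open scoped ContDiff Matrix

noncomputable section

namespace ConformalSphere

/-! ### Tensor densities on the sphere

The sphere `S^n` is `{x : ℝ^{n+1} | x ⬝ᵥ x = 1}`, with tangent spaces
`T_x S^n = {v | x ⬝ᵥ v = 0}`. -/

/-- `v` is a frame (a basis) of the tangent space of the unit sphere at the point `x`. -/
def IsTangentFrame {n : ℕ} (x : Fin (n + 1) → ℝ) (v : Fin n → Fin (n + 1) → ℝ) : Prop :=
  x ⬝ᵥ x = 1 ∧ (∀ i, x ⬝ᵥ v i = 0) ∧ LinearIndependent ℝ v

/-- A smooth local parametrization `σ : U → S^n` of the sphere, that is, a smooth immersion of an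
open set `U` of `ℝ^n` (the inverse of a system of local coordinates, as `σ` is locally
injective). -/
structure IsLocalParam {n : ℕ} (σ : (Fin n → ℝ) → Fin (n + 1) → ℝ) (U : Set (Fin n → ℝ)) :
    Prop where
  isOpen : IsOpen U
  smooth : ContDiffOn ℝ ∞ σ U
  mem_sphere : ∀ u ∈ U, σ u ⬝ᵥ σ u = 1
  immersion : ∀ u ∈ U, Function.Injective (fderiv ℝ σ u)

/-- The coordinate frame `(∂σ/∂u_1, …, ∂σ/∂u_n)`. -/
def coordFrame {n : ℕ} (σ : (Fin n → ℝ) → Fin (n + 1) → ℝ) (u : Fin n → ℝ) :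
    Fin n → Fin (n + 1) → ℝ :=
  fun i => fderiv ℝ σ u (Pi.single i 1)

/-- The component of `φ` in the coordinates `u`: the function `φ_σ` such that
`φ = φ_σ(u) |du_1 ∧ ⋯ ∧ du_n|^λ`. -/
def component {n : ℕ} (φ : (Fin (n + 1) → ℝ) → (Fin n → Fin (n + 1) → ℝ) → ℂ)
    (σ : (Fin n → ℝ) → Fin (n + 1) → ℝ) (u : Fin n → ℝ) : ℂ :=
  φ (σ u) (coordFrame σ u)

/-- The space `F_λ(S^n)` of smooth tensor densities of degree `λ` on the sphere. A density assigns
to a tangent frame `v` at `x` a complex number `φ x v`, in such a way that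
`φ x (v a) = |det a|^λ φ x v` for an invertible matrix `a`, and its components in local coordinates
are smooth. (The value of `φ x v` is set to `0` if `v` is not a tangent frame at a point `x` of the
sphere.) -/
def TensorDensity (n : ℕ) (lam : ℂ) :
    Submodule ℂ ((Fin (n + 1) → ℝ) → (Fin n → Fin (n + 1) → ℝ) → ℂ) where
  carrier := {φ |
    (∀ x v, ¬ IsTangentFrame x v → φ x v = 0) ∧
    (∀ x v, IsTangentFrame x v → ∀ a : Matrix (Fin n) (Fin n) ℝ, a.det ≠ 0 →
      φ x (fun j => ∑ i, a i j • v i) = ((|a.det| : ℝ) : ℂ) ^ lam * φ x v) ∧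
    (∀ σ U, IsLocalParam σ U → ContDiffOn ℝ ∞ (component φ σ) U)}
  add_mem' := by
    rintro φ ψ ⟨h1, h2, h3⟩ ⟨g1, g2, g3⟩
    refine ⟨fun x v h => by simp [h1 x v h, g1 x v h], fun x v h a ha => ?_, fun σ U h => ?_⟩
    · simp only [Pi.add_apply, h2 x v h a ha, g2 x v h a ha]; ring
    · exact (h3 σ U h).add (g3 σ U h)
  zero_mem' :=
    ⟨fun _ _ _ => rfl, fun _ _ _ _ _ => by simp, fun _ _ _ => contDiffOn_const⟩
  smul_mem' := by
    rintro c φ ⟨h1, h2, h3⟩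
    refine ⟨fun x v h => by simp [h1 x v h], fun x v h a ha => ?_, fun σ U h => ?_⟩
    · simp only [Pi.smul_apply, h2 x v h a ha, smul_eq_mul]; ring
    · exact contDiffOn_const.mul (h3 σ U h)

/-- `ψ = L_V^λ φ`, the Lie derivative of degree `λ` of the density `φ` along the vector field `V`
on the sphere: in every system of local coordinates, where `V = ∑ X^i ∂/∂u_i`,
`ψ_σ = ∑ X^i ∂φ_σ/∂u_i + λ (∑ ∂X^i/∂u_i) φ_σ`. -/
def IsLieDerivative {n : ℕ} (lam : ℂ) (V : (Fin (n + 1) → ℝ) → Fin (n + 1) → ℝ)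
    (φ ψ : (Fin (n + 1) → ℝ) → (Fin n → Fin (n + 1) → ℝ) → ℂ) : Prop :=
  ∀ σ U, IsLocalParam σ U → ∀ X : (Fin n → ℝ) → Fin n → ℝ,
    (∀ u ∈ U, fderiv ℝ σ u (X u) = V (σ u)) →
    ∀ u ∈ U, component ψ σ u =
      ∑ i, (X u i : ℂ) * fderiv ℝ (component φ σ) u (Pi.single i 1) +
        lam * ((∑ i, fderiv ℝ X u (Pi.single i 1) i : ℝ) : ℂ) * component φ σ u

/-! ### The groups and Lie algebras -/

/-- `K = SO(n+1)`. -/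
abbrev SO (n : ℕ) : Type := Matrix.specialOrthogonalGroup (Fin (n + 1)) ℝ

/-- The Lie algebra `𝔨 = o(n+1)` of `K`. -/
abbrev LieK (n : ℕ) : Type := LieAlgebra.Orthogonal.so (Fin (n + 1)) ℝ

/-- The Lie algebra `𝔤 = o(n+1,1)`. -/
abbrev LieG (n : ℕ) : Type := LieAlgebra.Orthogonal.so' (Fin (n + 1)) (Fin 1) ℝ

theorem SO.transpose_mul {n : ℕ} (k : SO n) :
    (k : Matrix (Fin (n + 1)) (Fin (n + 1)) ℝ)ᵀ * (k : Matrix (Fin (n + 1)) (Fin (n + 1)) ℝ) = 1 :=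
  (Matrix.mem_orthogonalGroup_iff' _ _).1 k.2.1

theorem SO.mul_transpose {n : ℕ} (k : SO n) :
    (k : Matrix (Fin (n + 1)) (Fin (n + 1)) ℝ) * (k : Matrix (Fin (n + 1)) (Fin (n + 1)) ℝ)ᵀ = 1 :=
  (Matrix.mem_orthogonalGroup_iff _ _).1 k.2.1

theorem SO.dot {n : ℕ} (k : SO n) (x y : Fin (n + 1) → ℝ) :
    ((k : Matrix (Fin (n + 1)) (Fin (n + 1)) ℝ) *ᵥ x) ⬝ᵥ
      ((k : Matrix (Fin (n + 1)) (Fin (n + 1)) ℝ) *ᵥ y) = x ⬝ᵥ y := by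
  rw [Matrix.dotProduct_mulVec, Matrix.vecMul_mulVec, SO.transpose_mul, Matrix.vecMul_one]

theorem SO.mulVec_injective {n : ℕ} (k : SO n) :
    Function.Injective ((k : Matrix (Fin (n + 1)) (Fin (n + 1)) ℝ) *ᵥ ·) := by
  intro x y h
  have := congrArg ((k : Matrix (Fin (n + 1)) (Fin (n + 1)) ℝ)ᵀ *ᵥ ·) h
  simpa [Matrix.mulVec_mulVec, SO.transpose_mul] using this

/-- The embedding of `K` in `SO(n+1,1)` as block matrices. -/
def blockSO {n : ℕ} (k : SO n) : Matrix (Fin (n + 1) ⊕ Fin 1) (Fin (n + 1) ⊕ Fin 1) ℝ :=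
  Matrix.fromBlocks (k : Matrix (Fin (n + 1)) (Fin (n + 1)) ℝ) 0 0 1

theorem mem_LieG_iff {n : ℕ} (A : Matrix (Fin (n + 1) ⊕ Fin 1) (Fin (n + 1) ⊕ Fin 1) ℝ) :
    A ∈ LieAlgebra.Orthogonal.so' (Fin (n + 1)) (Fin 1) ℝ ↔
      Aᵀ * LieAlgebra.Orthogonal.indefiniteDiagonal (Fin (n + 1)) (Fin 1) ℝ =
        LieAlgebra.Orthogonal.indefiniteDiagonal (Fin (n + 1)) (Fin 1) ℝ * (-A) := by
  rw [LieAlgebra.Orthogonal.so', mem_skewAdjointMatricesLieSubalgebra,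
    mem_skewAdjointMatricesSubmodule]
  rfl

theorem indefiniteDiagonal_eq (n : ℕ) :
    LieAlgebra.Orthogonal.indefiniteDiagonal (Fin (n + 1)) (Fin 1) ℝ =
      Matrix.fromBlocks 1 0 0 (-1) := by
  ext i j
  rcases i with i | i <;> rcases j with j | j <;>
    simp [LieAlgebra.Orthogonal.indefiniteDiagonal, Matrix.diagonal_apply, Matrix.one_apply]
  split_ifs <;> simp

/-- The adjoint action `Ad(k) A = k A k⁻¹` of `K` on `𝔤`. -/
def Ad {n : ℕ} (k : SO n) (A : LieG n) : LieG n :=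
  ⟨blockSO k * A * (blockSO k)ᵀ, by
    obtain ⟨A, hA⟩ := A
    rw [mem_LieG_iff] at hA ⊢
    rw [indefiniteDiagonal_eq] at hA ⊢
    have h1 : (blockSO k)ᵀ * Matrix.fromBlocks 1 0 0 (-1) =
        Matrix.fromBlocks 1 0 0 (-1) * (blockSO k)ᵀ := by
      simp [blockSO, Matrix.fromBlocks_transpose, Matrix.fromBlocks_multiply]
    have h2 : blockSO k * Matrix.fromBlocks 1 0 0 (-1) =
        Matrix.fromBlocks 1 0 0 (-1) * blockSO k := by
      simp [blockSO, Matrix.fromBlocks_multiply]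
    simp only [Matrix.transpose_mul, Matrix.transpose_transpose, Matrix.mul_assoc]
    rw [h1, ← Matrix.mul_assoc Aᵀ, hA]
    simp only [← Matrix.mul_assoc]
    rw [h2]
    simp only [Matrix.mul_assoc, Matrix.mul_neg, Matrix.neg_mul]⟩

/-- The inclusion `𝔨 ⊂ 𝔤` as block matrices. -/
def inclK {n : ℕ} (B : LieK n) : LieG n :=
  ⟨Matrix.fromBlocks (B : Matrix (Fin (n + 1)) (Fin (n + 1)) ℝ) 0 0 0, by
    have hB := (LieAlgebra.Orthogonal.mem_so (Fin (n + 1)) ℝ _).1 B.2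
    rw [mem_LieG_iff, indefiniteDiagonal_eq]
    simp [Matrix.fromBlocks_transpose, Matrix.fromBlocks_multiply, Matrix.fromBlocks_neg, hB]⟩

theorem exp_mem_SO {n : ℕ} (B : LieK n) (t : ℝ) :
    NormedSpace.exp (t • (B : Matrix (Fin (n + 1)) (Fin (n + 1)) ℝ)) ∈
      Matrix.specialOrthogonalGroup (Fin (n + 1)) ℝ := by
  have hB := (LieAlgebra.Orthogonal.mem_so (Fin (n + 1)) ℝ _).1 B.2
  have orth : ∀ s : ℝ, NormedSpace.exp (s • (B : Matrix (Fin (n + 1)) (Fin (n + 1)) ℝ)) *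
      (NormedSpace.exp (s • (B : Matrix (Fin (n + 1)) (Fin (n + 1)) ℝ)))ᵀ = 1 := by
    intro s
    rw [← Matrix.exp_transpose, Matrix.transpose_smul, hB, smul_neg, Matrix.exp_neg]
    exact Matrix.mul_nonsing_inv _ ((Matrix.isUnit_iff_isUnit_det _).1 (Matrix.isUnit_exp _))
  rw [Matrix.mem_specialOrthogonalGroup_iff]
  refine ⟨(Matrix.mem_orthogonalGroup_iff _ _).2 (orth t), ?_⟩
  have h2 : t • (B : Matrix (Fin (n + 1)) (Fin (n + 1)) ℝ) =
      (t / 2) • (B : Matrix (Fin (n + 1)) (Fin (n + 1)) ℝ) +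
        (t / 2) • (B : Matrix (Fin (n + 1)) (Fin (n + 1)) ℝ) := by
    rw [← add_smul]; congr 1; ring
  have h3 := congrArg Matrix.det (orth (t / 2))
  rw [Matrix.det_mul, Matrix.det_transpose, Matrix.det_one] at h3
  rw [h2, Matrix.exp_add_of_commute _ _ (Commute.refl _), Matrix.det_mul, h3]

/-- The one-parameter subgroup `t ↦ exp(tB)` of `K`, for `B ∈ 𝔨`. -/
def expK {n : ℕ} (B : LieK n) (t : ℝ) : SO n :=
  ⟨NormedSpace.exp (t • (B : Matrix (Fin (n + 1)) (Fin (n + 1)) ℝ)), exp_mem_SO B t⟩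

/-- The conformal vector field on the sphere attached to `A ∈ 𝔤`. The group `SO₀(n+1,1)` acts on
`S^n`, seen as the projectivized light cone: `g · x = y / s` if `g (x, 1) = (y, s)`. The field is
`x ↦ d/dt (exp(-tA) · x)` at `t = 0` (with this sign, Lie derivatives along these fields give a
representation of `𝔤`, the differential of the action of `SO₀(n+1,1)` on densities). -/
def confField {n : ℕ} (A : LieG n) (x : Fin (n + 1) → ℝ) : Fin (n + 1) → ℝ :=
  let y := (A : Matrix (Fin (n + 1) ⊕ Fin 1) (Fin (n + 1) ⊕ Fin 1) ℝ) *ᵥ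
    Sum.elim x (fun _ => 1)
  y (Sum.inr 0) • x - fun i => y (Sum.inl i)

/-! ### Representations of `K` and `(𝔤, K)`-modules -/

section Representations

attribute [local instance] LieRing.ofAssociativeRing

variable {n : ℕ} {V : Type*} [AddCommGroup V] [Module ℂ V]

/-- The `K`-finite vectors: those whose `K`-orbit spans a finite-dimensional space. -/
def kFinite (π : Representation ℂ (SO n) V) : Subrepresentation π where
  toSubmodule :=
    { carrier := {v | FiniteDimensional ℂ (Submodule.span ℂ (Set.range fun k => π k v))}
      add_mem' := by
        intro v w hv hw
        simp only [Set.mem_ofPred_eq] at hv hw ⊢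
        refine Submodule.finiteDimensional_of_le (S₂ :=
          Submodule.span ℂ (Set.range fun k => π k v) ⊔
            Submodule.span ℂ (Set.range fun k => π k w)) (Submodule.span_le.2 ?_)
        rintro _ ⟨k, rfl⟩
        simp only [map_add]
        exact Submodule.add_mem_sup (Submodule.subset_span ⟨k, rfl⟩)
          (Submodule.subset_span ⟨k, rfl⟩)
      zero_mem' := by
        have h : Submodule.span ℂ (Set.range fun k => π k (0 : V)) = ⊥ := by
          rw [Submodule.span_eq_bot]
          rintro _ ⟨k, rfl⟩
          exact map_zero _
        rw [Set.mem_ofPred_eq, h]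
        infer_instance
      smul_mem' := by
        intro c v hv
        simp only [Set.mem_ofPred_eq] at hv ⊢
        refine Submodule.finiteDimensional_of_le (S₂ :=
          Submodule.span ℂ (Set.range fun k => π k v)) (Submodule.span_le.2 ?_)
        rintro _ ⟨k, rfl⟩
        simp only [map_smul]
        exact Submodule.smul_mem _ _ (Submodule.subset_span ⟨k, rfl⟩) }
  apply_mem_toSubmodule := by
    intro g v hv
    change FiniteDimensional ℂ (Submodule.span ℂ (Set.range fun k => π k v)) at hv
    change FiniteDimensional ℂ (Submodule.span ℂ (Set.range fun k => π k (π g v)))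
    refine Submodule.finiteDimensional_of_le (S₂ :=
      Submodule.span ℂ (Set.range fun k => π k v)) (Submodule.span_le.2 ?_)
    rintro _ ⟨k, rfl⟩
    exact Submodule.subset_span ⟨k * g, by simp [map_mul]⟩

/-- Continuity of a representation of `K` all of whose vectors are `K`-finite: the coefficients are
continuous, i.e. `K` acts continuously on the finite-dimensional spaces spanned by orbits. -/
def HasContinuousCoefficients (π : Representation ℂ (SO n) V) : Prop :=
  ∀ (v : V) (l : Module.Dual ℂ V), Continuous fun k => l (π k v)

/-- `dπ(B) v = d/dt π(exp tB) v` at `t = 0`, for all `B ∈ 𝔨` and all vectors `v` (the derivative of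
a curve in the finite-dimensional span of the orbit of `v`, expressed by linear forms). -/
def IsDifferential (π : Representation ℂ (SO n) V) (dπ : LieK n → Module.End ℂ V) : Prop :=
  ∀ (B : LieK n) (v : V) (l : Module.Dual ℂ V),
    HasDerivAt (fun t : ℝ => l (π (expK B t) v)) (l (dπ B v)) 0

variable (n V) in
/-- Representations of the real Lie algebra `𝔤 = o(n+1,1)` on the complex vector space `V`. -/
abbrev LieGRep : Type _ := LieG n →ₗ⁅ℝ⁆ Module.End ℂ V

/-- The complex vector space `V`, with a representation `ρ` of `𝔤` and a representation `π` of `K`,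
is a `(𝔤, K)`-module. -/
structure IsGKModule (ρ : LieGRep n V) (π : Representation ℂ (SO n) V) : Prop where
  ad : ∀ (k : SO n) (A : LieG n) (v : V), ρ (Ad k A) v = π k (ρ A (π k⁻¹ v))
  finite : ∀ v : V, v ∈ kFinite π
  continuous : HasContinuousCoefficients π
  differential : IsDifferential π fun B => ρ (inclK B)

/-! ### Highest weights for `SO(n+1)`

The rank is `k = (n+1)/2` (integral part), and the Cartan subalgebra of `o(n+1, ℂ)` is spanned by
`H_r = i (E_{2r,2r-1} - E_{2r-1,2r})`, `r = 1, …, k`. Linear forms on it are written in the basis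
`ε_1, …, ε_k` dual to `H_1, …, H_k`. -/

/-- The real matrix `E_{2r,2r-1} - E_{2r-1,2r}` (the indices `r` and `2r-1`, `2r` are shifted to
start from `0`). -/
def planeGen (r : Fin ((n + 1) / 2)) : LieK n :=
  ⟨Matrix.single (⟨2 * r + 1, by omega⟩ : Fin (n + 1)) (⟨2 * r, by omega⟩ : Fin (n + 1)) (1 : ℝ) -
    Matrix.single (⟨2 * r, by omega⟩ : Fin (n + 1)) (⟨2 * r + 1, by omega⟩ : Fin (n + 1)) (1 : ℝ),
    by
      rw [LieAlgebra.Orthogonal.mem_so]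
      simp [Matrix.transpose_sub, Matrix.transpose_single]⟩

/-- The element `B + iC` of `o(n+1, ℂ)`, for `B, C ∈ o(n+1)`. -/
def complexElt (B C : LieK n) : Matrix (Fin (n + 1)) (Fin (n + 1)) ℂ :=
  (B : Matrix (Fin (n + 1)) (Fin (n + 1)) ℝ).map Complex.ofReal +
    Complex.I • (C : Matrix (Fin (n + 1)) (Fin (n + 1)) ℝ).map Complex.ofReal

/-- The elements `H_r` of the Cartan subalgebra. -/
def cartan (r : Fin ((n + 1) / 2)) : Matrix (Fin (n + 1)) (Fin (n + 1)) ℂ :=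
  complexElt 0 (planeGen r)

variable (n) in
/-- The positive roots of `o(n+1, ℂ)`: `ε_r - ε_s` and `ε_r + ε_s` for `r < s`, and the `ε_r` if
`n + 1` is odd. -/
def IsPositiveRoot (α : Fin ((n + 1) / 2) → ℤ) : Prop :=
  (∃ r s, r < s ∧ (α = Pi.single r 1 - Pi.single s 1 ∨ α = Pi.single r 1 + Pi.single s 1)) ∨
    (Odd (n + 1) ∧ ∃ r, α = Pi.single r 1)

/-- `π` is a simple (finite-dimensional, continuous) `K`-module of highest weight `∑ μ_r ε_r`: it
has a nonzero vector of weight `μ` that is annihilated by the root vectors of all positive roots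
(the differential of `π` is extended `ℂ`-linearly to `o(n+1, ℂ)`). -/
structure HasHighestWeight (π : Representation ℂ (SO n) V) (μ : Fin ((n + 1) / 2) → ℤ) :
    Prop where
  finite : FiniteDimensional ℂ V
  continuous : HasContinuousCoefficients π
  simple : π.IsIrreducible
  primitive : ∃ dπ : LieK n → Module.End ℂ V, IsDifferential π dπ ∧ ∃ v : V, v ≠ 0 ∧
    (∀ r, Complex.I • dπ (planeGen r) v = (μ r : ℂ) • v) ∧
    ∀ α, IsPositiveRoot n α → ∀ B C : LieK n,
      (∀ r, cartan r * complexElt B C - complexElt B C * cartan r =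
        (α r : ℂ) • complexElt B C) →
      dπ B v + Complex.I • dπ C v = 0

/-- `π` is isomorphic to `D^{m_1, …, m_k}`, the simple `K`-module with highest weight
`m_k ε_1 + m_{k-1} ε_2 + ⋯ + m_1 ε_k`. -/
def IsTypeD (π : Representation ℂ (SO n) V) (m : Fin ((n + 1) / 2) → ℤ) : Prop :=
  HasHighestWeight π fun r => m (Fin.rev r)

variable (n) in
/-- The parameter `(0, …, 0, m)`. -/
def lastParam (m : ℤ) : Fin ((n + 1) / 2) → ℤ :=
  fun i => if (i : ℕ) + 1 = (n + 1) / 2 then m else 0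

/-- The subspace `W` is a sub-`K`-module of `π`, isomorphic to `D^{m_1, …, m_k}`. -/
def IsSubmoduleOfTypeD (π : Representation ℂ (SO n) V) (W : Submodule ℂ V)
    (m : Fin ((n + 1) / 2) → ℤ) : Prop :=
  ∃ S : Subrepresentation π, S.toSubmodule = W ∧ IsTypeD S.toRepresentation m

end Representations

/-! ### The action of `K` on densities -/

theorem IsTangentFrame.rotate {n : ℕ} (k : SO n) {x : Fin (n + 1) → ℝ}
    {v : Fin n → Fin (n + 1) → ℝ} (h : IsTangentFrame x v) :
    IsTangentFrame ((k : Matrix (Fin (n + 1)) (Fin (n + 1)) ℝ) *ᵥ x)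
      (fun i => (k : Matrix (Fin (n + 1)) (Fin (n + 1)) ℝ) *ᵥ v i) := by
  refine ⟨by rw [SO.dot]; exact h.1, fun i => by rw [SO.dot]; exact h.2.1 i, ?_⟩
  exact h.2.2.map' (Matrix.mulVecLin (k : Matrix (Fin (n + 1)) (Fin (n + 1)) ℝ))
    (LinearMap.ker_eq_bot.2 (SO.mulVec_injective k))

theorem SO.inv_mulVec_mulVec {n : ℕ} (k : SO n) (x : Fin (n + 1) → ℝ) :
    ((k⁻¹ : SO n) : Matrix (Fin (n + 1)) (Fin (n + 1)) ℝ) *ᵥ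
      ((k : Matrix (Fin (n + 1)) (Fin (n + 1)) ℝ) *ᵥ x) = x := by
  rw [Matrix.mulVec_mulVec, ← Submonoid.coe_mul, inv_mul_cancel, Submonoid.coe_one,
    Matrix.one_mulVec]

theorem SO.mulVec_inv_mulVec {n : ℕ} (k : SO n) (x : Fin (n + 1) → ℝ) :
    (k : Matrix (Fin (n + 1)) (Fin (n + 1)) ℝ) *ᵥ
      (((k⁻¹ : SO n) : Matrix (Fin (n + 1)) (Fin (n + 1)) ℝ) *ᵥ x) = x := by
  rw [Matrix.mulVec_mulVec, ← Submonoid.coe_mul, mul_inv_cancel, Submonoid.coe_one,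
    Matrix.one_mulVec]

theorem IsLocalParam.rotate {n : ℕ} (k : SO n) {σ : (Fin n → ℝ) → Fin (n + 1) → ℝ}
    {U : Set (Fin n → ℝ)} (h : IsLocalParam σ U) :
    IsLocalParam (fun u => (k : Matrix (Fin (n + 1)) (Fin (n + 1)) ℝ) *ᵥ σ u) U ∧
      ∀ u ∈ U, coordFrame (fun u => (k : Matrix (Fin (n + 1)) (Fin (n + 1)) ℝ) *ᵥ σ u) u =
        fun i => (k : Matrix (Fin (n + 1)) (Fin (n + 1)) ℝ) *ᵥ coordFrame σ u i := by
  set L : (Fin (n + 1) → ℝ) →L[ℝ] (Fin (n + 1) → ℝ) := LinearMap.toContinuousLinearMap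
    (Matrix.mulVecLin (k : Matrix (Fin (n + 1)) (Fin (n + 1)) ℝ)) with hL
  have hd : ∀ u ∈ U, fderiv ℝ (fun u => (k : Matrix (Fin (n + 1)) (Fin (n + 1)) ℝ) *ᵥ σ u) u =
      L.comp (fderiv ℝ σ u) := by
    intro u hu
    have h1 : DifferentiableAt ℝ σ u :=
      (h.smooth.contDiffAt (h.isOpen.mem_nhds hu)).differentiableAt (by simp)
    exact (L.hasFDerivAt.comp u h1.hasFDerivAt).fderiv
  refine ⟨⟨h.isOpen, L.contDiff.comp_contDiffOn h.smooth,
    fun u hu => by rw [SO.dot]; exact h.mem_sphere u hu, fun u hu => ?_⟩, fun u hu => ?_⟩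
  · rw [hd u hu]
    exact (SO.mulVec_injective k).comp (h.immersion u hu)
  · funext i
    simp only [coordFrame, hd u hu]
    rfl

/-- The action of `K = SO(n+1)`, as a group of diffeomorphisms of the sphere, on the densities of
degree `λ`: `(k · φ)(x; v_1, …, v_n) = φ(k⁻¹ x; k⁻¹ v_1, …, k⁻¹ v_n)`. -/
def rotationRep (n : ℕ) (lam : ℂ) : Representation ℂ (SO n) (TensorDensity n lam) where
  toFun k :=
    { toFun := fun φ =>
        ⟨fun x v => φ.1 (((k⁻¹ : SO n) : Matrix (Fin (n + 1)) (Fin (n + 1)) ℝ) *ᵥ x)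
          (fun i => ((k⁻¹ : SO n) : Matrix (Fin (n + 1)) (Fin (n + 1)) ℝ) *ᵥ v i), by
          obtain ⟨φ, h1, h2, h3⟩ := φ
          refine ⟨fun x v h => h1 _ _ fun h' => h ?_, fun x v h a ha => ?_, fun σ U h => ?_⟩
          · simpa only [SO.mulVec_inv_mulVec] using h'.rotate k
          · rw [← h2 _ _ (h.rotate k⁻¹) a ha]
            simp [Matrix.mulVec_sum, Matrix.mulVec_smul]
          · refine (h3 _ _ (h.rotate k⁻¹).1).congr fun u hu => ?_
            simp only [component, (h.rotate k⁻¹).2 u hu]⟩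
      map_add' := fun _ _ => rfl
      map_smul' := fun _ _ => rfl }
  map_one' := by
    ext φ : 1
    apply Subtype.ext
    funext x v
    simp [Matrix.one_mulVec]
  map_mul' k l := by
    ext φ : 1
    apply Subtype.ext
    funext x v
    simp [Matrix.mulVec_mulVec]

/-! ### Harmonic polynomials -/

/-- The Laplacian `∂²/∂x_0² + ⋯ + ∂²/∂x_n²` on complex polynomials in `x_0, …, x_n`. -/
def laplacian (n : ℕ) :
    MvPolynomial (Fin (n + 1)) ℂ →ₗ[ℂ] MvPolynomial (Fin (n + 1)) ℂ :=
  ∑ i, (MvPolynomial.pderiv i).toLinearMap ∘ₗ (MvPolynomial.pderiv i).toLinearMap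

/-- The harmonic polynomials. -/
def harmonicPoly (n : ℕ) : Submodule ℂ (MvPolynomial (Fin (n + 1)) ℂ) :=
  LinearMap.ker (laplacian n)

/-- The harmonic polynomials that are homogeneous of degree `m`. -/
def harmonicHomogeneous (n m : ℕ) : Submodule ℂ (MvPolynomial (Fin (n + 1)) ℂ) :=
  harmonicPoly n ⊓ MvPolynomial.homogeneousSubmodule (Fin (n + 1)) ℂ m

/-- The Euclidean volume of the tangent frame `v` at the point `x` of the sphere. -/
def frameVolume {n : ℕ} (x : Fin (n + 1) → ℝ) (v : Fin n → Fin (n + 1) → ℝ) : ℝ :=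
  |(Matrix.of (Fin.cons x v : Fin (n + 1) → Fin (n + 1) → ℝ)).det|

open Classical in
/-- The density `f ω^λ`, where `ω` is the Euclidean volume element of the sphere. If `f` is the
restriction of a function `F` on `ℝ^{n+1} \ {0}` that is homogeneous of degree `-(n+1)λ`, then its
component in the projective coordinates `t_i = x_i / x_0` is `F(1, t_1, …, t_n)`. -/
def volumeMul {n : ℕ} (lam : ℂ) (f : (Fin (n + 1) → ℝ) → ℂ) :
    (Fin (n + 1) → ℝ) → (Fin n → Fin (n + 1) → ℝ) → ℂ :=
  fun x v => if IsTangentFrame x v then f x * (frameVolume x v : ℂ) ^ lam else 0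

theorem frameVolume_pos {n : ℕ} {x : Fin (n + 1) → ℝ} {v : Fin n → Fin (n + 1) → ℝ}
    (h : IsTangentFrame x v) : 0 < frameVolume x v := by
  have hx : x ∉ Submodule.span ℝ (Set.range v) := by
    intro hx
    have : ∀ y ∈ Submodule.span ℝ (Set.range v), x ⬝ᵥ y = 0 := by
      intro y hy
      induction hy using Submodule.span_induction with
      | mem y hy => obtain ⟨i, rfl⟩ := hy; exact h.2.1 i
      | zero => simp
      | add y z _ _ hy hz => rw [dotProduct_add, hy, hz, add_zero]
      | smul a y _ hy => rw [dotProduct_smul, hy, smul_zero]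
    have h0 := this x hx
    rw [h.1] at h0
    exact one_ne_zero h0
  have hli : LinearIndependent ℝ (Fin.cons x v : Fin (n + 1) → Fin (n + 1) → ℝ) :=
    linearIndependent_finCons.2 ⟨h.2.2, hx⟩
  have hu := Matrix.linearIndependent_rows_iff_isUnit (A := Matrix.of
    (Fin.cons x v : Fin (n + 1) → Fin (n + 1) → ℝ)) |>.1 hli
  exact abs_pos.2 ((Matrix.isUnit_iff_isUnit_det _).1 hu).ne_zero

theorem frameVolume_mul {n : ℕ} (x : Fin (n + 1) → ℝ) (v : Fin n → Fin (n + 1) → ℝ)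
    (a : Matrix (Fin n) (Fin n) ℝ) :
    frameVolume x (fun j => ∑ i, a i j • v i) = |a.det| * frameVolume x v := by
  have h : Matrix.of (Fin.cons x (fun j => ∑ i, a i j • v i) : Fin (n + 1) → Fin (n + 1) → ℝ) =
      Matrix.of (Fin.cons (Pi.single 0 1) (fun j => Fin.cons 0 (fun i => a i j)) :
        Fin (n + 1) → Fin (n + 1) → ℝ) *
      Matrix.of (Fin.cons x v : Fin (n + 1) → Fin (n + 1) → ℝ) := by
    ext j l
    refine Fin.cases ?_ (fun j => ?_) j
    · simp [Matrix.mul_apply, Fin.sum_univ_succ]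
    · simp [Matrix.mul_apply, Fin.sum_univ_succ]
  have hdet : (Matrix.of (Fin.cons (Pi.single 0 1) (fun j => Fin.cons 0 (fun i => a i j)) :
        Fin (n + 1) → Fin (n + 1) → ℝ)).det = a.det := by
    rw [Matrix.det_succ_row_zero, Fin.sum_univ_succ]
    simp only [Matrix.of_apply, Fin.cons_zero, Pi.single_eq_same, Fin.val_zero, pow_zero, one_mul]
    rw [Finset.sum_eq_zero (fun i _ => by simp), add_zero, ← Matrix.det_transpose a]
    congr 1
  rw [frameVolume, h, Matrix.det_mul, hdet, abs_mul, frameVolume]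

theorem IsTangentFrame.mul {n : ℕ} {x : Fin (n + 1) → ℝ} {v : Fin n → Fin (n + 1) → ℝ}
    (h : IsTangentFrame x v) {a : Matrix (Fin n) (Fin n) ℝ} (ha : a.det ≠ 0) :
    IsTangentFrame x (fun j => ∑ i, a i j • v i) := by
  refine ⟨h.1, fun j => ?_, ?_⟩
  · rw [dotProduct_sum]
    exact Finset.sum_eq_zero fun i _ => by rw [dotProduct_smul, h.2.1, smul_zero]
  · have hinj := h.2.2.fintypeLinearCombination_injective
    have hcol : LinearIndependent ℝ (fun j i => a i j) :=
      Matrix.linearIndependent_cols_iff_isUnit.2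
        ((Matrix.isUnit_iff_isUnit_det a).2 (isUnit_iff_ne_zero.2 ha))
    exact hcol.map' (Fintype.linearCombination ℝ v) (LinearMap.ker_eq_bot.2 hinj)

theorem IsLocalParam.isTangentFrame {n : ℕ} {σ : (Fin n → ℝ) → Fin (n + 1) → ℝ}
    {U : Set (Fin n → ℝ)} (h : IsLocalParam σ U) {u : Fin n → ℝ} (hu : u ∈ U) :
    IsTangentFrame (σ u) (coordFrame σ u) := by
  have hd : DifferentiableAt ℝ σ u :=
    (h.smooth.contDiffAt (h.isOpen.mem_nhds hu)).differentiableAt (by simp)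
  refine ⟨h.mem_sphere u hu, fun i => ?_, ?_⟩
  · have h1 : HasFDerivAt (fun u => ∑ j, σ u j * σ u j)
        (∑ j, (σ u j • (ContinuousLinearMap.proj j).comp (fderiv ℝ σ u) +
          σ u j • (ContinuousLinearMap.proj j).comp (fderiv ℝ σ u))) u := by
      refine HasFDerivAt.fun_sum fun j _ => ?_
      have hj := hasFDerivAt_pi'.1 hd.hasFDerivAt j
      exact hj.mul hj
    have h2 : HasFDerivAt (fun u => ∑ j, σ u j * σ u j) (0 : (Fin n → ℝ) →L[ℝ] ℝ) u := by
      refine (hasFDerivAt_const (1 : ℝ) u).congr_of_eventuallyEq ?_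
      filter_upwards [h.isOpen.mem_nhds hu] with w hw
      exact h.mem_sphere w hw
    have h3 := congrArg (fun L : (Fin n → ℝ) →L[ℝ] ℝ => L (Pi.single i 1)) (h1.unique h2)
    simp only [_root_.sum_apply, _root_.add_apply,
      _root_.smul_apply, ContinuousLinearMap.comp_apply,
      ContinuousLinearMap.proj_apply, _root_.zero_apply, smul_eq_mul,
      Finset.sum_add_distrib] at h3
    simp only [dotProduct, coordFrame]
    linarith
  · have hb := (Pi.basisFun ℝ (Fin n)).linearIndependent
    have := hb.map' (fderiv ℝ σ u : (Fin n → ℝ) →ₗ[ℝ] (Fin (n + 1) → ℝ))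
      (LinearMap.ker_eq_bot.2 (h.immersion u hu))
    have he : coordFrame σ u = (fderiv ℝ σ u : (Fin n → ℝ) →ₗ[ℝ] (Fin (n + 1) → ℝ)) ∘
        Pi.basisFun ℝ (Fin n) := by
      funext i
      simp [coordFrame, Pi.basisFun_apply]
    rw [he]
    exact this

theorem volumeMul_mem {n : ℕ} (lam : ℂ) {f : (Fin (n + 1) → ℝ) → ℂ} (hf : ContDiff ℝ ∞ f) :
    volumeMul lam f ∈ TensorDensity n lam := by
  refine ⟨fun x v h => by simp [volumeMul, h], fun x v h a ha => ?_, fun σ U h => ?_⟩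
  · rw [volumeMul, volumeMul, if_pos h, if_pos (h.mul ha), frameVolume_mul, Complex.ofReal_mul,
      Complex.mul_cpow_ofReal_nonneg (abs_nonneg _) (frameVolume_pos h).le]
    ring
  · have hdet : ContDiffOn ℝ ∞ (fun u => (Matrix.of (Fin.cons (σ u) (coordFrame σ u) :
        Fin (n + 1) → Fin (n + 1) → ℝ)).det) U := by
      simp only [Matrix.det_apply]
      refine ContDiffOn.sum fun τ _ => ContDiffOn.const_smul _ ?_
      refine contDiffOn_prod fun i _ => ?_
      simp only [Matrix.of_apply]
      generalize τ i = j
      refine Fin.cases ?_ (fun j => ?_) j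
      · simpa using contDiffOn_pi.1 h.smooth i
      · have hs : ContDiffOn ℝ ∞ (fun u => fderiv ℝ σ u (Pi.single j 1)) U :=
          (h.smooth.fderiv_of_isOpen h.isOpen (by simp)).clm_apply contDiffOn_const
        simpa [coordFrame] using contDiffOn_pi.1 hs i
    intro u hu
    have hpos := frameVolume_pos (h.isTangentFrame hu)
    have hne : (Matrix.of (Fin.cons (σ u) (coordFrame σ u) :
        Fin (n + 1) → Fin (n + 1) → ℝ)).det ≠ 0 := abs_pos.1 hpos
    have hvol : ContDiffAt ℝ ∞ (fun u => frameVolume (σ u) (coordFrame σ u)) u :=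
      (hdet.contDiffAt (h.isOpen.mem_nhds hu)).abs hne
    have hσ := h.smooth.contDiffAt (h.isOpen.mem_nhds hu)
    have hmain : ContDiffAt ℝ ∞ (fun u => f (σ u) *
        Complex.exp (((Real.log (frameVolume (σ u) (coordFrame σ u)) : ℝ) : ℂ) * lam)) u :=
      (hf.contDiffAt.comp u hσ).mul (Complex.contDiff_exp.contDiffAt.comp u
        (((Complex.ofRealCLM.contDiff.contDiffAt.comp u (hvol.log hpos.ne')).mul
          contDiffAt_const)))
    refine (hmain.congr_of_eventuallyEq ?_).contDiffWithinAt
    filter_upwards [h.isOpen.mem_nhds hu] with w hw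
    have hw' := h.isTangentFrame hw
    have hposw := frameVolume_pos hw'
    rw [component, volumeMul, if_pos hw', Complex.cpow_def_of_ne_zero
      (Complex.ofReal_ne_zero.2 hposw.ne'), Complex.ofReal_log hposw.le]

/-- The function `x ↦ P(x)` on `ℝ^{n+1}`. -/
def polyFun {n : ℕ} (P : MvPolynomial (Fin (n + 1)) ℂ) (x : Fin (n + 1) → ℝ) : ℂ :=
  MvPolynomial.eval (fun i => (x i : ℂ)) P

theorem contDiff_polyFun {n : ℕ} (P : MvPolynomial (Fin (n + 1)) ℂ) :
    ContDiff ℝ ∞ (polyFun P) := by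
  induction P using MvPolynomial.induction_on with
  | C a =>
    have h : polyFun (n := n) (MvPolynomial.C a) = fun _ => a := by
      funext x; simp [polyFun]
    rw [h]; exact contDiff_const
  | add p q hp hq =>
    have h : polyFun (p + q) = fun x => polyFun p x + polyFun q x := by
      funext x; simp [polyFun]
    rw [h]; exact hp.add hq
  | mul_X p i hp =>
    have hi : ContDiff ℝ ∞ (fun x : Fin (n + 1) → ℝ => (x i : ℂ)) :=
      Complex.ofRealCLM.contDiff.comp (contDiff_apply ℝ ℝ i)
    have h : polyFun (p * MvPolynomial.X i) = fun x => polyFun p x * (x i : ℂ) := by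
      funext x; simp [polyFun]
    rw [h]; exact hp.mul hi

/-- The polynomial `P`, restricted to the sphere and seen as an element of `F_λ(S^n)`: the density
`P ω^λ`. For `P` homogeneous of degree `m`, this is the density that corresponds to the function
`P(x) (x_0² + ⋯ + x_n²)^{-m/2 - λ(n+1)/2}`, homogeneous of degree `-(n+1)λ`. -/
def polyDensity (n : ℕ) (lam : ℂ) :
    MvPolynomial (Fin (n + 1)) ℂ →ₗ[ℂ] TensorDensity n lam where
  toFun P := ⟨volumeMul lam (polyFun P), volumeMul_mem lam (contDiff_polyFun P)⟩
  map_add' P Q := by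
    apply Subtype.ext
    funext x v
    by_cases h : IsTangentFrame x v <;> simp [volumeMul, h, polyFun, add_mul]
  map_smul' c P := by
    apply Subtype.ext
    funext x v
    by_cases h : IsTangentFrame x v <;> simp [volumeMul, h, polyFun, mul_assoc]

/-- The subspace `H^{n+1,m}` of `F_λ(S^n)`: the homogeneous harmonic polynomials of degree `m`,
restricted to the sphere. -/
def HSpace (n : ℕ) (lam : ℂ) (m : ℕ) : Submodule ℂ (TensorDensity n lam) :=
  (harmonicHomogeneous n m).map (polyDensity n lam)

/-- For `n = 1` and a sign `s = ±1`, the line `H_{sm}` of `F_λ(S^1)` spanned by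
`(x_0 + s i x_1)^m`. -/
def HLine (n : ℕ) (lam : ℂ) (s : ℤ) (m : ℕ) : Submodule ℂ (TensorDensity n lam) :=
  Submodule.span ℂ {polyDensity n lam ((MvPolynomial.X 0 +
    MvPolynomial.C (s * Complex.I) * MvPolynomial.X (Fin.last n)) ^ m)}

end ConformalSphere

end

/-!
# The `(𝔤, K)`-module of tensor densities on the sphere

Multiplication with `ω^λ` identifies the densities of degree `λ` with the smooth functions on the
sphere. To differentiate such a function it is extended to `ℝ^{n+1}`, constantly along rays and cut
off near the origin (`radialExt`, `contDiff_radialExt`, `eq_volumeMul_radialExt`).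

*The representation of `𝔤`.* For `A = (B, b; bᵀ, 0)` the conformal field is
`V(x) = (b · x) x - B x - b`, and its divergence on the sphere is `n (b · x)`, so that
`L_V^λ (f ω^λ) = (V f + λ n (b · x) f) ω^λ` (`isLieDerivative_volumeMul`). The bracket relation is
then a computation with functions (`lieFun_lie`). The conformal fields are permuted by rotations
(`confField_Ad`), hence the orbit of `A φ` lies in `𝔤 W` if `W` is spanned by the orbit of `φ`, and
the `K`-finite densities are stable under `𝔤`. Linear forms on a finite-dimensional space of
densities are combinations of evaluations (`exists_dual_eq_sum_eval`); thus the continuity of the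
coefficients and the compatibility of `K` with `𝔨` need only be checked pointwise.

*The space of `K`-finite vectors.* Every polynomial is a combination of products `|x|^{2j} h` with
`h` harmonic and homogeneous (`mem_fischerSpan`), and `|x|² = 1` on the sphere, so polynomial
densities are sums of elements of the `H^{n+1,m}`. These spaces are independent because the Casimir
operator of `o(n+1)` has the eigenvalue `-2m(m+n-1)` on `H^{n+1,m}` (`iSupIndep_HSpace`).
Conversely, a `K`-finite density is polynomial (`exists_polyDensity_eq_of_mem_kFinite`): its
convolutions with the kernels `(1 + x · y)^j` are polynomial, converge to it after normalization,
and stay in a finite-dimensional space of coefficients, where the polynomial functions form a closed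
subspace.

*The `K`-types for `n ≥ 2`.* A harmonic homogeneous polynomial is determined by its values on the
isotropic cone (`eq_zero_of_eval_isotropic`), which consists of the real multiples of the orbit of
`e_0 - i e_1`. Of all weight vectors of degree `m` for the rotations of the `(x_0, x_1)`-plane, only
the multiples of `(x_0 + i x_1)^m` do not vanish at `e_0 - i e_1`. A nonzero invariant subspace of
`H^{n+1,m}` therefore contains this vector (`linForm_pow_mem_of_invariant`), and by symmetry
`(x_0 - i x_1)^m`. Since these two are not orthogonal for the invariant bilinear form `∫ P Q`, a
proper nonzero invariant subspace, which would have a nonzero orthogonal complement, cannot exist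
(`eq_harmonicHomogeneous_of_invariant`). The vector `(x_0 + i x_1)^m` has weight `m ε_1`, and a root
vector for a positive root `α` annihilates it because `ε_1 + α` is not a weight of the standard
representation (`complexElt_mulVec_isoVec_eq_zero`).

*The circle.* For `n = 1` the isotropic cone is the union of two lines, and evaluation at them
splits `H^{2,m}`, `m ≥ 1`, into the lines spanned by `(x_0 ± i x_1)^m` (`HLine_sup_HLine`,
`disjoint_HLine`), each stable under the commutative group `SO(2)`.
-/

open scoped ContDiff Matrix

noncomputable section

namespace ConformalSphere

section

/-! ### Rotations and tangent frames -/

/-- An orthonormal family of vectors of `ℝ^{n+1}` that omits at least one index is the image of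
part of the standard basis under a rotation; the omitted index leaves room to correct the sign of
the determinant. -/
theorem SO.exists_mulVec_single {n : ℕ} (w : Fin (n + 1) → Fin (n + 1) → ℝ)
    (s : Set (Fin (n + 1))) (i₀ : Fin (n + 1)) (hi₀ : i₀ ∉ s)
    (hw : ∀ i ∈ s, ∀ j ∈ s, w i ⬝ᵥ w j = if i = j then 1 else 0) :
    ∃ k : SO n, ∀ i ∈ s, k.1 *ᵥ Pi.single i 1 = w i := by
  classical
  have hv : Orthonormal ℝ (s.domRestrict fun i => WithLp.toLp 2 (w i) :
      s → EuclideanSpace ℝ (Fin (n + 1))) := by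
    rw [orthonormal_iff_ite]
    rintro ⟨i, hi⟩ ⟨j, hj⟩
    have := hw j hj i hi
    change inner ℝ (WithLp.toLp 2 (w i)) (WithLp.toLp 2 (w j)) = _
    rw [EuclideanSpace.inner_toLp_toLp, star_trivial, this]
    simp [eq_comm]
  obtain ⟨b, hb⟩ := hv.exists_orthonormalBasis_extension_of_card_eq (by simp)
  let M : Matrix (Fin (n + 1)) (Fin (n + 1)) ℝ := Matrix.of fun j i => b i j
  have hM : Mᵀ * M = 1 := by
    ext i j
    have h := orthonormal_iff_ite.1 b.orthonormal j i
    rw [PiLp.inner_apply] at h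
    simp only [RCLike.inner_apply, conj_trivial] at h
    simp only [Matrix.mul_apply, Matrix.transpose_apply, M, Matrix.of_apply, Matrix.one_apply]
    rw [h]
    simp [eq_comm]
  have hdet : M.det * M.det = 1 := by
    have := congrArg Matrix.det hM
    rwa [Matrix.det_mul, Matrix.det_transpose, Matrix.det_one] at this
  let d : Fin (n + 1) → ℝ := Function.update 1 i₀ M.det
  have hdd : ∀ i, d i * d i = 1 := fun i => by
    by_cases h : i = i₀
    · subst h; simp [d, hdet]
    · simp [d, h]
  have hprod : ∏ i, d i = M.det := by
    simp [d, Finset.prod_update_of_mem]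
  have hMd : (M * Matrix.diagonal d)ᵀ * (M * Matrix.diagonal d) = 1 := by
    rw [Matrix.transpose_mul, Matrix.mul_assoc, ← Matrix.mul_assoc Mᵀ, hM, Matrix.one_mul,
      Matrix.diagonal_transpose, Matrix.diagonal_mul_diagonal]
    simp [hdd]
  refine ⟨⟨M * Matrix.diagonal d, Matrix.mem_specialOrthogonalGroup_iff.2
    ⟨(Matrix.mem_orthogonalGroup_iff' _ _).2 hMd, ?_⟩⟩, fun i hi => ?_⟩
  · rw [Matrix.det_mul, Matrix.det_diagonal, hprod, hdet]
  · have hne : i ≠ i₀ := fun h => hi₀ (h ▸ hi)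
    have h2 := hb i hi
    funext j
    simp [Matrix.mulVec_single, M, d, hne, h2, Matrix.col]

/-- `SO(n+1)` acts transitively on the sphere `S^n`, `n ≥ 1`. -/
theorem SO.exists_mulVec_e0 {n : ℕ} (hn : 1 ≤ n) {x : Fin (n + 1) → ℝ} (hx : x ⬝ᵥ x = 1) :
    ∃ k : SO n, k.1 *ᵥ Pi.single 0 1 = x := by
  obtain ⟨k, hk⟩ := SO.exists_mulVec_single (fun _ => x) {0} ⟨1, by omega⟩
    (by simp [Fin.ext_iff]) (by rintro i rfl j rfl; simp [hx])
  exact ⟨k, hk 0 rfl⟩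

theorem SO.inv_coe {n : ℕ} (k : SO n) : (k⁻¹ : SO n).1 = k.1ᵀ := rfl

theorem SO.inv_mulVec_eq {n : ℕ} {k : SO n} {x y : Fin (n + 1) → ℝ} (h : k.1 *ᵥ x = y) :
    (k⁻¹ : SO n).1 *ᵥ y = x := by
  rw [← h, SO.inv_mulVec_mulVec]

/-- Two tangent frames at the same point differ by an invertible matrix. -/
theorem IsTangentFrame.exists_matrix {n : ℕ} {x : Fin (n + 1) → ℝ}
    {v w : Fin n → Fin (n + 1) → ℝ} (hv : IsTangentFrame x v) (hw : IsTangentFrame x w) :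
    ∃ a : Matrix (Fin n) (Fin n) ℝ, a.det ≠ 0 ∧ w = fun j => ∑ i, a i j • v i := by
  have hli : LinearIndependent ℝ (Fin.cons x v : Fin (n + 1) → Fin (n + 1) → ℝ) := by
    have := abs_pos.1 (frameVolume_pos hv)
    have h2 := Matrix.linearIndependent_rows_iff_isUnit (A := Matrix.of
      (Fin.cons x v : Fin (n + 1) → Fin (n + 1) → ℝ)) |>.2
      ((Matrix.isUnit_iff_isUnit_det _).2 (isUnit_iff_ne_zero.2 this))
    exact h2
  have hspan := hli.span_eq_top_of_card_eq_finrank' (by simp)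
  have h1 : ∀ j, ∃ c : Fin n → ℝ, w j = ∑ i, c i • v i := by
    intro j
    have hmem : w j ∈ Submodule.span ℝ
        (Set.range (Fin.cons x v : Fin (n + 1) → Fin (n + 1) → ℝ)) := hspan ▸ Submodule.mem_top
    obtain ⟨c, hc⟩ := (Submodule.mem_span_range_iff_exists_fun ℝ).1 hmem
    rw [Fin.sum_univ_succ] at hc
    simp only [Fin.cons_zero, Fin.cons_succ] at hc
    have h0 : c 0 = 0 := by
      have := congrArg (x ⬝ᵥ ·) hc
      simp only [dotProduct_add, dotProduct_smul, dotProduct_sum, hv.1, hv.2.1, hw.2.1] at this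
      simpa using this
    exact ⟨fun i => c i.succ, by rw [← hc, h0]; simp⟩
  choose c hc using h1
  refine ⟨Matrix.of fun i j => c j i, fun h0 => ?_, ?_⟩
  · obtain ⟨b, hb, hb0⟩ := Matrix.exists_mulVec_eq_zero_iff.2 h0
    refine hb (funext fun j => Fintype.linearIndependent_iff.1 hw.2.2 b ?_ j)
    have hb1 : ∀ i, ∑ j, b j * c j i = 0 := fun i => by
      have := congrFun hb0 i
      simpa [Matrix.mulVec, dotProduct, mul_comm] using this
    calc ∑ j, b j • w j = ∑ j, ∑ i, (b j * c j i) • v i := by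
          simp_rw [hc, Finset.smul_sum, smul_smul]
      _ = ∑ i, (∑ j, b j * c j i) • v i := by
          rw [Finset.sum_comm]; simp_rw [Finset.sum_smul]
      _ = 0 := by simp [hb1]
  · funext j
    simpa using hc j

/-- The tangent frame `(e_1, …, e_n)` at `e_0`. -/
theorem isTangentFrame_e0 (n : ℕ) :
    IsTangentFrame (Pi.single 0 1 : Fin (n + 1) → ℝ) (fun i => Pi.single i.succ 1) := by
  refine ⟨by simp, fun i => by simp [Fin.succ_ne_zero], ?_⟩
  have h := (Pi.basisFun ℝ (Fin (n + 1))).linearIndependent.comp Fin.succ (Fin.succ_injective n)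
  have he : (fun i : Fin n => (Pi.single i.succ 1 : Fin (n + 1) → ℝ)) =
      ⇑(Pi.basisFun ℝ (Fin (n + 1))) ∘ Fin.succ := by
    funext i; simp
  rw [he]; exact h

theorem exists_isTangentFrame {n : ℕ} (hn : 1 ≤ n) {x : Fin (n + 1) → ℝ} (hx : x ⬝ᵥ x = 1) :
    ∃ v, IsTangentFrame x v := by
  obtain ⟨k, rfl⟩ := SO.exists_mulVec_e0 hn hx
  exact ⟨_, (isTangentFrame_e0 n).rotate k⟩

theorem frameVolume_rotate {n : ℕ} (k : SO n) (x : Fin (n + 1) → ℝ)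
    (v : Fin n → Fin (n + 1) → ℝ) :
    frameVolume (k.1 *ᵥ x) (fun i => k.1 *ᵥ v i) = frameVolume x v := by
  have h : Matrix.of (Fin.cons (k.1 *ᵥ x) (fun i => k.1 *ᵥ v i) :
      Fin (n + 1) → Fin (n + 1) → ℝ) =
      Matrix.of (Fin.cons x v : Fin (n + 1) → Fin (n + 1) → ℝ) * k.1ᵀ := by
    ext i j
    refine Fin.cases ?_ (fun i => ?_) i <;>
      simp [Matrix.mul_apply, Matrix.mulVec, dotProduct, mul_comm]
  rw [frameVolume, h, Matrix.det_mul, Matrix.det_transpose,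
    (Matrix.mem_specialOrthogonalGroup_iff.1 k.2).2, mul_one, frameVolume]

end

section

/-! ### Densities as functions on the sphere -/

/-- The gnomonic chart `u ↦ (1, u) / |(1, u)|` of the open hemisphere `x_0 > 0`. -/
def gnomonic (n : ℕ) (u : Fin n → ℝ) : Fin (n + 1) → ℝ :=
  (√(1 + u ⬝ᵥ u))⁻¹ • Fin.cons 1 u

theorem contDiff_dotProduct_self (n : ℕ) : ContDiff ℝ ∞ fun u : Fin n → ℝ => u ⬝ᵥ u := by
  unfold dotProduct
  fun_prop

theorem dotProduct_self_nonneg_real {n : ℕ} (u : Fin n → ℝ) : 0 ≤ u ⬝ᵥ u :=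
  Finset.sum_nonneg fun i _ => mul_self_nonneg (u i)

theorem cons_dotProduct_cons {n : ℕ} (a b : ℝ) (u v : Fin n → ℝ) :
    (Fin.cons a u : Fin (n + 1) → ℝ) ⬝ᵥ Fin.cons b v = a * b + u ⬝ᵥ v := by
  simp [dotProduct, Fin.sum_univ_succ]

theorem isLocalParam_gnomonic (n : ℕ) : IsLocalParam (gnomonic n) Set.univ := by
  have hpos : ∀ u : Fin n → ℝ, 0 < 1 + u ⬝ᵥ u := fun u => by
    linarith [dotProduct_self_nonneg_real u]
  have hsm : ContDiff ℝ ∞ (gnomonic n) := by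
    have h1 : ContDiff ℝ ∞ fun u : Fin n → ℝ => (√(1 + u ⬝ᵥ u))⁻¹ :=
      ((contDiff_const.add (contDiff_dotProduct_self n)).sqrt fun u => (hpos u).ne').inv
        fun u => (Real.sqrt_pos.2 (hpos u)).ne'
    refine h1.smul (contDiff_pi.2 fun i => ?_)
    refine Fin.cases ?_ (fun i => ?_) i
    · simpa using contDiff_const
    · simpa using contDiff_apply ℝ ℝ i
  refine ⟨isOpen_univ, hsm.contDiffOn, fun u _ => ?_, fun u _ => ?_⟩
  · have := Real.mul_self_sqrt (hpos u).le
    have h0 := (Real.sqrt_pos.2 (hpos u)).ne'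
    rw [gnomonic, smul_dotProduct, dotProduct_smul, cons_dotProduct_cons, smul_eq_mul, smul_eq_mul]
    field_simp
    rw [sq, this]
  · -- `y ↦ (y_i / y_0)` is a smooth left inverse of the chart
    have h0 : gnomonic n u 0 ≠ 0 := by
      simpa [gnomonic] using (Real.sqrt_pos.2 (hpos u)).ne'
    have hr : DifferentiableAt ℝ (fun y : Fin (n + 1) → ℝ => fun i : Fin n => y i.succ / y 0)
        (gnomonic n u) := by
      refine differentiableAt_pi.2 fun i => ?_
      have h1 : ∀ j, DifferentiableAt ℝ (fun y : Fin (n + 1) → ℝ => y j) (gnomonic n u) :=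
        fun j => differentiableAt_apply j _
      simp only [div_eq_mul_inv]
      exact (h1 _).mul ((h1 0).inv h0)
    have hcomp : (fun y : Fin (n + 1) → ℝ => fun i : Fin n => y i.succ / y 0) ∘ gnomonic n =
        id := by
      funext w i
      have := (Real.sqrt_pos.2 (hpos w)).ne'
      simp only [gnomonic, Function.comp, Pi.smul_apply, Fin.cons_succ, Fin.cons_zero, smul_eq_mul,
        id]
      field_simp
    have hd := fderiv_comp u hr (hsm.differentiable (by simp) u)
    rw [hcomp, fderiv_id] at hd
    intro a b hab
    have := congrArg (fderiv ℝ (fun y : Fin (n + 1) → ℝ => fun i : Fin n => y i.succ / y 0)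
      (gnomonic n u)) hab
    rw [← ContinuousLinearMap.comp_apply, ← ContinuousLinearMap.comp_apply, ← hd] at this
    simpa using this

theorem gnomonic_div {n : ℕ} {y : Fin (n + 1) → ℝ} (hy : 0 < y 0) :
    gnomonic n (fun i => y i.succ / y 0) = (√(y ⬝ᵥ y))⁻¹ • y := by
  have h1 : 1 + (fun i : Fin n => y i.succ / y 0) ⬝ᵥ (fun i : Fin n => y i.succ / y 0) =
      (y ⬝ᵥ y) / (y 0) ^ 2 := by
    have h2 : y ⬝ᵥ y = y 0 * y 0 + ∑ i : Fin n, y i.succ * y i.succ := by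
      simp [dotProduct, Fin.sum_univ_succ]
    rw [h2, dotProduct]
    have h3 : ∀ i : Fin n, y i.succ / y 0 * (y i.succ / y 0) =
        (y i.succ * y i.succ) / (y 0) ^ 2 := fun i => by field_simp
    simp_rw [h3, ← Finset.sum_div]
    field_simp
  have hpos : 0 < y ⬝ᵥ y := by
    have : y 0 * y 0 ≤ y ⬝ᵥ y := Finset.single_le_sum (f := fun i => y i * y i)
      (fun i _ => mul_self_nonneg _) (Finset.mem_univ 0)
    nlinarith
  rw [gnomonic, h1, Real.sqrt_div hpos.le, Real.sqrt_sq hy.le]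
  funext i
  have := (Real.sqrt_pos.2 hpos).ne'
  refine Fin.cases ?_ (fun i => ?_) i <;> simp only [Pi.smul_apply, Fin.cons_zero, Fin.cons_succ,
    smul_eq_mul] <;> field_simp

variable {n : ℕ} {lam : ℂ}

open Classical in
/-- The function `f` on the sphere such that `φ = f ω^λ` (and `0` off the sphere). -/
def sphereVal (φ : TensorDensity n lam) (x : Fin (n + 1) → ℝ) : ℂ :=
  if h : ∃ v, IsTangentFrame x v then φ.1 x h.choose / (frameVolume x h.choose : ℂ) ^ lam else 0

theorem frameVolume_cpow_ne_zero {x : Fin (n + 1) → ℝ} {v : Fin n → Fin (n + 1) → ℝ}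
    (h : IsTangentFrame x v) : (frameVolume x v : ℂ) ^ lam ≠ 0 := by
  rw [Complex.cpow_ne_zero_iff]
  exact Or.inl (Complex.ofReal_ne_zero.2 (frameVolume_pos h).ne')

/-- The value of `sphereVal` does not depend on the chosen frame. -/
theorem sphereVal_eq_div (φ : TensorDensity n lam) {x : Fin (n + 1) → ℝ}
    {v : Fin n → Fin (n + 1) → ℝ} (h : IsTangentFrame x v) :
    sphereVal φ x = φ.1 x v / (frameVolume x v : ℂ) ^ lam := by
  have hex : ∃ v, IsTangentFrame x v := ⟨v, h⟩
  rw [sphereVal, dif_pos hex]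
  obtain ⟨a, ha, hw⟩ := h.exists_matrix hex.choose_spec
  rw [hw, φ.2.2.1 x v h a ha, frameVolume_mul, Complex.ofReal_mul,
    Complex.mul_cpow_ofReal_nonneg (abs_nonneg _) (frameVolume_pos h).le]
  have : ((|a.det| : ℝ) : ℂ) ^ lam ≠ 0 := by
    rw [Complex.cpow_ne_zero_iff]
    exact Or.inl (Complex.ofReal_ne_zero.2 (abs_pos.2 ha).ne')
  rw [mul_div_mul_left _ _ this]

theorem apply_eq_sphereVal_mul (φ : TensorDensity n lam) {x : Fin (n + 1) → ℝ}
    {v : Fin n → Fin (n + 1) → ℝ} (h : IsTangentFrame x v) :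
    φ.1 x v = sphereVal φ x * (frameVolume x v : ℂ) ^ lam := by
  rw [sphereVal_eq_div φ h, div_mul_cancel₀ _ (frameVolume_cpow_ne_zero h)]

theorem sphereVal_rotationRep (k : SO n) (φ : TensorDensity n lam) (x : Fin (n + 1) → ℝ) :
    sphereVal (rotationRep n lam k φ) x = sphereVal φ ((k⁻¹ : SO n).1 *ᵥ x) := by
  by_cases h : ∃ v, IsTangentFrame x v
  · obtain ⟨v, hv⟩ := h
    rw [sphereVal_eq_div _ hv, sphereVal_eq_div _ (hv.rotate k⁻¹), frameVolume_rotate]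
    rfl
  · have h' : ¬ ∃ v, IsTangentFrame ((k⁻¹ : SO n).1 *ᵥ x) v := fun ⟨v, hv⟩ => h
      ⟨_, by simpa only [SO.mulVec_inv_mulVec] using hv.rotate k⟩
    rw [sphereVal, sphereVal, dif_neg h, dif_neg h']

/-- A smooth function on `ℝ^{n+1}` whose restriction `f` to the sphere satisfies `φ = f ω^λ`: the
extension of `f` that is constant on rays, cut off near the origin. It depends linearly and
equivariantly on `φ`. -/
def radialExt : TensorDensity n lam →ₗ[ℂ] (Fin (n + 1) → ℝ) → ℂ where
  toFun φ y := (Real.smoothTransition (2 * (y ⬝ᵥ y) - 1) : ℂ) * sphereVal φ ((√(y ⬝ᵥ y))⁻¹ • y)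
  map_add' φ ψ := by
    funext y
    simp only [sphereVal, Pi.add_apply]
    split_ifs with h
    · simp; ring
    · simp
  map_smul' c φ := by
    funext y
    simp only [sphereVal, Pi.smul_apply, RingHom.id_apply, smul_eq_mul]
    split_ifs with h
    · simp; ring
    · simp

theorem radialExt_of_mem_sphere (φ : TensorDensity n lam) {x : Fin (n + 1) → ℝ}
    (hx : x ⬝ᵥ x = 1) : radialExt φ x = sphereVal φ x := by
  change (Real.smoothTransition (2 * (x ⬝ᵥ x) - 1) : ℂ) * sphereVal φ ((√(x ⬝ᵥ x))⁻¹ • x) = _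
  rw [hx]
  norm_num [Real.smoothTransition.one]

theorem radialExt_rotationRep (k : SO n) (φ : TensorDensity n lam) (y : Fin (n + 1) → ℝ) :
    radialExt (rotationRep n lam k φ) y = radialExt φ ((k⁻¹ : SO n).1 *ᵥ y) := by
  change (Real.smoothTransition (2 * (y ⬝ᵥ y) - 1) : ℂ) *
    sphereVal (rotationRep n lam k φ) ((√(y ⬝ᵥ y))⁻¹ • y) = (Real.smoothTransition
      (2 * ((k⁻¹ : SO n).1 *ᵥ y ⬝ᵥ (k⁻¹ : SO n).1 *ᵥ y) - 1) : ℂ) *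
    sphereVal φ ((√((k⁻¹ : SO n).1 *ᵥ y ⬝ᵥ (k⁻¹ : SO n).1 *ᵥ y))⁻¹ • (k⁻¹ : SO n).1 *ᵥ y)
  rw [SO.dot, sphereVal_rotationRep, Matrix.mulVec_smul]

theorem eq_volumeMul_radialExt (φ : TensorDensity n lam) :
    φ.1 = volumeMul lam (radialExt φ) := by
  funext x v
  by_cases h : IsTangentFrame x v
  · rw [volumeMul, if_pos h, radialExt_of_mem_sphere φ h.1, apply_eq_sphereVal_mul φ h]
  · rw [volumeMul, if_neg h, φ.2.1 x v h]

theorem contDiff_normSq_cutoff : ContDiff ℝ ∞ fun y : Fin (n + 1) → ℝ =>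
    (Real.smoothTransition (2 * (y ⬝ᵥ y) - 1) : ℂ) :=
  Complex.ofRealCLM.contDiff.comp (Real.smoothTransition.contDiff.comp
    ((contDiff_const.mul (contDiff_dotProduct_self _)).sub contDiff_const))

/-- In the gnomonic chart `f` is the quotient of the components of the smooth densities `φ` and
`ω^λ`. -/
theorem contDiffAt_radialExt_of_pos (φ : TensorDensity n lam) {y : Fin (n + 1) → ℝ}
    (hy : 0 < y 0) : ContDiffAt ℝ ∞ (radialExt φ) y := by
  have hone : volumeMul lam (fun _ => 1) ∈ TensorDensity n lam := volumeMul_mem lam contDiff_const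
  set w : TensorDensity n lam := ⟨_, hone⟩
  have hr : ContDiffAt ℝ ∞ (fun y : Fin (n + 1) → ℝ => fun i : Fin n => y i.succ / y 0) y := by
    refine contDiffAt_pi.2 fun i => ?_
    exact (contDiff_apply ℝ ℝ _).contDiffAt.div (contDiff_apply ℝ ℝ _).contDiffAt hy.ne'
  have hG := isLocalParam_gnomonic n
  have hc : ∀ ψ : TensorDensity n lam, ContDiff ℝ ∞ (component ψ.1 (gnomonic n)) := fun ψ =>
    contDiffOn_univ.1 (ψ.2.2.2 _ _ hG)
  have hw : ∀ u, component w.1 (gnomonic n) u =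
      (frameVolume (gnomonic n u) (coordFrame (gnomonic n) u) : ℂ) ^ lam := fun u => by
    change volumeMul lam (fun _ => 1) (gnomonic n u) (coordFrame (gnomonic n) u) = _
    rw [volumeMul, if_pos (hG.isTangentFrame (Set.mem_univ u)), one_mul]
  have hne : ∀ u, component w.1 (gnomonic n) u ≠ 0 := fun u => by
    rw [hw]
    exact frameVolume_cpow_ne_zero (hG.isTangentFrame (Set.mem_univ u))
  have hq : ContDiffAt ℝ ∞ (fun y : Fin (n + 1) → ℝ =>
      (Real.smoothTransition (2 * (y ⬝ᵥ y) - 1) : ℂ) *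
      ((component φ.1 (gnomonic n) fun i => y i.succ / y 0) /
        component w.1 (gnomonic n) fun i => y i.succ / y 0)) y :=
    contDiff_normSq_cutoff.contDiffAt.mul
      (((hc φ).contDiffAt.comp y hr).mul (((hc w).contDiffAt.comp y hr).inv (hne _)))
  refine hq.congr_of_eventuallyEq ?_
  have hopen : IsOpen {z : Fin (n + 1) → ℝ | 0 < z 0} :=
    isOpen_lt continuous_const (continuous_apply 0)
  filter_upwards [hopen.mem_nhds hy] with z hz
  change _ * sphereVal φ ((√(z ⬝ᵥ z))⁻¹ • z) = _
  rw [← gnomonic_div hz, sphereVal_eq_div φ (hG.isTangentFrame (Set.mem_univ _)), hw]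
  rfl

/-- Near the origin the extension is zero; elsewhere a rotation moves the point into the hemisphere
`y_0 > 0`. -/
theorem contDiff_radialExt (hn : 1 ≤ n) (φ : TensorDensity n lam) :
    ContDiff ℝ ∞ (radialExt φ) := by
  refine contDiff_iff_contDiffAt.2 fun y => ?_
  by_cases hy : y ⬝ᵥ y < 1 / 2
  · refine (contDiff_const (c := (0 : ℂ))).contDiffAt.congr_of_eventuallyEq ?_
    filter_upwards [(isOpen_lt (contDiff_dotProduct_self (n + 1)).continuous
      continuous_const).mem_nhds hy] with z hz
    change (Real.smoothTransition (2 * (z ⬝ᵥ z) - 1) : ℂ) * _ = _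
    rw [Real.smoothTransition.zero_of_nonpos (by
      have : z ⬝ᵥ z < 1 / 2 := hz
      linarith), Complex.ofReal_zero, zero_mul]
  · have hpos : 0 < y ⬝ᵥ y := by linarith
    have hs := Real.sqrt_pos.2 hpos
    obtain ⟨k, hk⟩ := SO.exists_mulVec_e0 hn (x := (√(y ⬝ᵥ y))⁻¹ • y) (by
      rw [smul_dotProduct, dotProduct_smul, smul_eq_mul, smul_eq_mul]
      field_simp
      exact (Real.sq_sqrt hpos.le).symm)
    have h1 := SO.inv_mulVec_eq hk
    have h2 : 0 < ((k⁻¹ : SO n).1 *ᵥ y) 0 := by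
      have : (k⁻¹ : SO n).1 *ᵥ y = √(y ⬝ᵥ y) • Pi.single 0 1 := by
        rw [← h1, Matrix.mulVec_smul, smul_smul, mul_inv_cancel₀ hs.ne', one_smul]
      rw [this]; simpa using hpos
    have h3 : radialExt φ = radialExt (rotationRep n lam k⁻¹ φ) ∘
        (LinearMap.toContinuousLinearMap (Matrix.mulVecLin (k⁻¹ : SO n).1)) := by
      funext z
      change _ = radialExt (rotationRep n lam k⁻¹ φ) ((k⁻¹ : SO n).1 *ᵥ z)
      rw [radialExt_rotationRep, inv_inv, SO.mulVec_inv_mulVec]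
    rw [h3]
    exact ContDiffAt.comp y (contDiffAt_radialExt_of_pos (rotationRep n lam k⁻¹ φ) h2)
      (ContinuousLinearMap.contDiff (LinearMap.toContinuousLinearMap
        (Matrix.mulVecLin (k⁻¹ : SO n).1))).contDiffAt

/-- The densities `f ω^λ` and `g ω^λ` agree if and only if `f` and `g` agree on the sphere. -/
theorem volumeMul_eq_iff (hn : 1 ≤ n) (f g : (Fin (n + 1) → ℝ) → ℂ) :
    volumeMul lam f = volumeMul lam g ↔ ∀ x, x ⬝ᵥ x = 1 → f x = g x := by
  refine ⟨fun h x hx => ?_, fun h => ?_⟩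
  · obtain ⟨v, hv⟩ := exists_isTangentFrame hn hx
    have := congrFun (congrFun h x) v
    rw [volumeMul, volumeMul, if_pos hv, if_pos hv] at this
    exact mul_right_cancel₀ (frameVolume_cpow_ne_zero hv) this
  · funext x v
    by_cases hv : IsTangentFrame x v
    · rw [volumeMul, volumeMul, if_pos hv, if_pos hv, h x hv.1]
    · rw [volumeMul, volumeMul, if_neg hv, if_neg hv]

end

section

/-! ### Derivatives of determinants -/

/-- `∑_i det(R_1, …, L R_i, …, R_N) = tr L · det(R_1, …, R_N)`. -/
theorem sum_det_updateRow_mulVec {N : ℕ} (R : Matrix (Fin N) (Fin N) ℝ)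
    (L : Matrix (Fin N) (Fin N) ℝ) :
    ∑ i, (R.updateRow i (L *ᵥ R i)).det = L.trace * R.det := by
  have h : ∀ i, (R.updateRow i (L *ᵥ R i)).det = (Rᵀ.adjugate * (L * Rᵀ)) i i := by
    intro i
    rw [← Matrix.cramer_transpose_apply, Matrix.cramer_eq_adjugate_mulVec]
    simp only [Matrix.mulVec, dotProduct, Matrix.mul_apply, Matrix.transpose_apply]
  simp_rw [h]
  change (Rᵀ.adjugate * (L * Rᵀ)).trace = _
  rw [Matrix.trace_mul_comm, Matrix.mul_assoc, Matrix.mul_adjugate, Matrix.det_transpose,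
    Matrix.mul_smul, Matrix.mul_one, Matrix.trace_smul, smul_eq_mul, mul_comm]

/-- The determinant as a continuous multilinear function of the rows. -/
def detMultilinear (N : ℕ) :
    ContinuousMultilinearMap ℝ (fun _ : Fin N => Fin N → ℝ) ℝ where
  toMultilinearMap := (Matrix.detRowAlternating (n := Fin N) (R := ℝ)).toMultilinearMap
  cont := Continuous.matrix_det (A := fun R : Fin N → Fin N → ℝ => Matrix.of R) continuous_id

theorem detMultilinear_apply {N : ℕ} (R : Fin N → Fin N → ℝ) :
    detMultilinear N R = (Matrix.of R).det := rfl

theorem hasFDerivAt_det {n N : ℕ} {R : (Fin n → ℝ) → Fin N → Fin N → ℝ} {u : Fin n → ℝ}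
    (hR : DifferentiableAt ℝ R u) :
    HasFDerivAt (fun w => (Matrix.of (R w)).det)
      (((detMultilinear N).linearDeriv (R u)).comp (fderiv ℝ R u)) u :=
  ((detMultilinear N).hasFDerivAt (R u)).comp u hR.hasFDerivAt

/-! ### The conformal vector fields -/

variable {n : ℕ} {lam : ℂ}

/-- The block `B` of `A = (B, b; bᵀ, 0) ∈ o(n+1,1)`. -/
def rotPart (A : LieG n) : Matrix (Fin (n + 1)) (Fin (n + 1)) ℝ :=
  Matrix.of fun i j => A.1 (Sum.inl i) (Sum.inl j)

/-- The block `b` of `A = (B, b; bᵀ, 0) ∈ o(n+1,1)`. -/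
def boostPart (A : LieG n) : Fin (n + 1) → ℝ :=
  fun i => A.1 (Sum.inl i) (Sum.inr 0)

theorem LieG_eq_fromBlocks (A : LieG n) :
    A.1 = Matrix.fromBlocks (rotPart A) (Matrix.of fun i _ => boostPart A i)
      (Matrix.of fun _ i => boostPart A i) 0 ∧ (rotPart A)ᵀ = -rotPart A := by
  have h := (mem_LieG_iff A.1).1 A.2
  rw [indefiniteDiagonal_eq] at h
  have h0 : A.1 = Matrix.fromBlocks A.1.toBlocks₁₁ A.1.toBlocks₁₂ A.1.toBlocks₂₁ A.1.toBlocks₂₂ :=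
    (Matrix.fromBlocks_toBlocks _).symm
  rw [h0, Matrix.fromBlocks_transpose, Matrix.fromBlocks_neg, Matrix.fromBlocks_multiply,
    Matrix.fromBlocks_multiply, Matrix.fromBlocks_inj] at h
  obtain ⟨h1, h2, h3, h4⟩ := h
  simp only [Matrix.mul_one, Matrix.mul_zero, add_zero, Matrix.one_mul, Matrix.zero_mul,
    Matrix.mul_neg, neg_zero, zero_add, Matrix.neg_mul, neg_neg] at h1 h2 h3 h4
  refine ⟨?_, h1⟩
  ext i j
  rcases i with i | i <;> rcases j with j | j
  · rfl
  · fin_cases j; rfl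
  · fin_cases i
    exact congrFun (congrFun h3.symm 0) j
  · fin_cases i; fin_cases j
    have := congrFun (congrFun h4 0) 0
    simp only [Matrix.neg_apply, Matrix.transpose_apply, Matrix.toBlocks₂₂, Matrix.of_apply] at this
    simp only [Matrix.fromBlocks_apply₂₂, Matrix.zero_apply]
    change A.1 (Sum.inr 0) (Sum.inr 0) = 0
    linarith

theorem confField_eq (A : LieG n) (x : Fin (n + 1) → ℝ) :
    confField A x = (boostPart A ⬝ᵥ x) • x - (rotPart A *ᵥ x + boostPart A) := by
  have h := (LieG_eq_fromBlocks A).1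
  have h1 : A.1 *ᵥ Sum.elim x (fun _ => 1) =
      Sum.elim (rotPart A *ᵥ x + boostPart A) (fun _ => boostPart A ⬝ᵥ x) := by
    rw [h, Matrix.fromBlocks_mulVec]
    congr 1
    · congr 1
      funext i
      simp [Matrix.mulVec, dotProduct]
    · funext i
      simp [Matrix.mulVec, dotProduct]
  rw [confField]
  simp only [h1]
  rfl

theorem dotProduct_rotPart_mulVec_self (A : LieG n) (x : Fin (n + 1) → ℝ) :
    x ⬝ᵥ rotPart A *ᵥ x = 0 := by
  have h : x ⬝ᵥ rotPart A *ᵥ x = -(x ⬝ᵥ rotPart A *ᵥ x) := by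
    conv_lhs => rw [Matrix.dotProduct_mulVec, ← Matrix.mulVec_transpose,
      (LieG_eq_fromBlocks A).2, Matrix.neg_mulVec, neg_dotProduct, dotProduct_comm]
  linarith

theorem dotProduct_confField (A : LieG n) {x : Fin (n + 1) → ℝ} (hx : x ⬝ᵥ x = 1) :
    x ⬝ᵥ confField A x = 0 := by
  rw [confField_eq, dotProduct_sub, dotProduct_add, dotProduct_smul, hx,
    dotProduct_rotPart_mulVec_self, dotProduct_comm x (boostPart A)]
  simp

/-- The matrix of the derivative at `x` of the vector field `confField A` on `ℝ^{n+1}`. -/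
def confFieldJac (A : LieG n) (x : Fin (n + 1) → ℝ) : Matrix (Fin (n + 1)) (Fin (n + 1)) ℝ :=
  Matrix.vecMulVec x (boostPart A) + (boostPart A ⬝ᵥ x) • 1 - rotPart A

theorem confFieldJac_mulVec (A : LieG n) (x h : Fin (n + 1) → ℝ) :
    confFieldJac A x *ᵥ h =
      (boostPart A ⬝ᵥ h) • x + (boostPart A ⬝ᵥ x) • h - rotPart A *ᵥ h := by
  rw [confFieldJac, Matrix.sub_mulVec, Matrix.add_mulVec, Matrix.smul_mulVec, Matrix.one_mulVec]
  congr 2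
  funext i
  simp [Matrix.mulVec, Matrix.vecMulVec, dotProduct, Finset.sum_mul]
  exact Finset.sum_congr rfl fun j _ => by ring

theorem trace_confFieldJac (A : LieG n) (x : Fin (n + 1) → ℝ) :
    (confFieldJac A x).trace = (n + 2) * (boostPart A ⬝ᵥ x) := by
  have h : (rotPart A).trace = 0 := by
    have := congrArg Matrix.trace (LieG_eq_fromBlocks A).2
    rw [Matrix.trace_transpose, Matrix.trace_neg] at this
    linarith
  rw [confFieldJac, Matrix.trace_sub, Matrix.trace_add, Matrix.trace_vecMulVec, Matrix.trace_smul,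
    Matrix.trace_one, h, dotProduct_comm x]
  simp
  ring

theorem hasFDerivAt_confField (A : LieG n) (x : Fin (n + 1) → ℝ) :
    HasFDerivAt (confField A)
      (LinearMap.toContinuousLinearMap (Matrix.mulVecLin (confFieldJac A x))) x := by
  have hb : HasFDerivAt (fun y : Fin (n + 1) → ℝ => boostPart A ⬝ᵥ y)
      (LinearMap.toContinuousLinearMap (dotProductBilin ℝ ℝ (boostPart A))) x :=
    (LinearMap.toContinuousLinearMap (dotProductBilin ℝ ℝ (boostPart A))).hasFDerivAt
  have hB : HasFDerivAt (fun y : Fin (n + 1) → ℝ => rotPart A *ᵥ y)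
      (LinearMap.toContinuousLinearMap (Matrix.mulVecLin (rotPart A))) x :=
    (LinearMap.toContinuousLinearMap (Matrix.mulVecLin (rotPart A))).hasFDerivAt
  have h := (hb.smul (hasFDerivAt_id x)).sub (hB.add_const (boostPart A))
  have he : confField A = fun y => (boostPart A ⬝ᵥ y) • id y - (rotPart A *ᵥ y + boostPart A) :=
    funext fun y => confField_eq A y
  rw [he]
  refine h.congr_fderiv ?_
  ext1 v
  change (boostPart A ⬝ᵥ x) • v + (boostPart A ⬝ᵥ v) • x - rotPart A *ᵥ v =
    confFieldJac A x *ᵥ v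
  rw [confFieldJac_mulVec, add_comm ((boostPart A ⬝ᵥ x) • v)]

theorem contDiff_confField (A : LieG n) : ContDiff ℝ ∞ (confField A) := by
  have he : confField A = fun y => (boostPart A ⬝ᵥ y) • id y - (rotPart A *ᵥ y + boostPart A) :=
    funext fun y => confField_eq A y
  have hb : ContDiff ℝ ∞ (fun y : Fin (n + 1) → ℝ => boostPart A ⬝ᵥ y) :=
    (LinearMap.toContinuousLinearMap (dotProductBilin ℝ ℝ (boostPart A))).contDiff
  have hB : ContDiff ℝ ∞ (fun y : Fin (n + 1) → ℝ => rotPart A *ᵥ y) :=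
    (LinearMap.toContinuousLinearMap (Matrix.mulVecLin (rotPart A))).contDiff
  rw [he]
  exact (hb.smul contDiff_id).sub (hB.add contDiff_const)

end

section

/-! ### The action of `o(n+1,1)` by Lie derivatives -/

variable {n : ℕ} {lam : ℂ}

/-- The function `g` with `L_V^λ (f ω^λ) = g ω^λ`, for the conformal field `V` attached to
`A = (B, b; bᵀ, 0)`; the divergence of `V` with respect to `ω` is `x ↦ n (b · x)`. -/
def lieFun (lam : ℂ) (A : LieG n) (f : (Fin (n + 1) → ℝ) → ℂ) (x : Fin (n + 1) → ℝ) : ℂ :=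
  fderiv ℝ f x (confField A x) + lam * ((n * (boostPart A ⬝ᵥ x) : ℝ) : ℂ) * f x

theorem contDiff_boostPart (A : LieG n) :
    ContDiff ℝ ∞ fun x : Fin (n + 1) → ℝ => boostPart A ⬝ᵥ x :=
  (LinearMap.toContinuousLinearMap (dotProductBilin ℝ ℝ (boostPart A))).contDiff

theorem contDiff_lieFun (A : LieG n) {f : (Fin (n + 1) → ℝ) → ℂ} (hf : ContDiff ℝ ∞ f) :
    ContDiff ℝ ∞ (lieFun lam A f) := by
  have h1 : ContDiff ℝ ∞ fun x => fderiv ℝ f x (confField A x) :=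
    (hf.fderiv_right (m := ∞) (by simp)).clm_apply (contDiff_confField A)
  exact h1.add ((contDiff_const.mul (Complex.ofRealCLM.contDiff.comp
    (contDiff_const.mul (contDiff_boostPart A)))).mul hf)

/-- The derivative of a function in directions tangent to the sphere is determined by its
restriction to the sphere. -/
theorem fderiv_eq_of_eq_on_sphere {f g : (Fin (n + 1) → ℝ) → ℂ} {x v : Fin (n + 1) → ℝ}
    (hf : DifferentiableAt ℝ f x) (hg : DifferentiableAt ℝ g x)
    (h : ∀ y, y ⬝ᵥ y = 1 → f y = g y) (hx : x ⬝ᵥ x = 1) (hv : x ⬝ᵥ v = 0) :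
    fderiv ℝ f x v = fderiv ℝ g x v := by
  -- the curve `t ↦ (x + t v) / |x + t v|` lies in the sphere and has velocity `v` at `t = 0`
  have hpos : ∀ t : ℝ, 0 < 1 + t ^ 2 * (v ⬝ᵥ v) := fun t => by
    have := mul_nonneg (sq_nonneg t) (dotProduct_self_nonneg_real v)
    linarith
  let γ : ℝ → Fin (n + 1) → ℝ := fun t => (√(1 + t ^ 2 * (v ⬝ᵥ v)))⁻¹ • (x + t • v)
  have hγS : ∀ t, γ t ⬝ᵥ γ t = 1 := fun t => by
    have h1 : (x + t • v) ⬝ᵥ (x + t • v) = 1 + t ^ 2 * (v ⬝ᵥ v) := by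
      simp only [add_dotProduct, dotProduct_add, smul_dotProduct, dotProduct_smul, hx, hv,
        dotProduct_comm v x, smul_eq_mul]
      ring
    have h0 := (Real.sqrt_pos.2 (hpos t)).ne'
    simp only [γ]
    rw [smul_dotProduct, dotProduct_smul, h1, smul_eq_mul, smul_eq_mul]
    field_simp
    exact (Real.sq_sqrt (hpos t).le).symm
  have hγ0 : γ 0 = x := by simp [γ]
  have hγ : HasDerivAt γ v 0 := by
    have h1 : HasDerivAt (fun t : ℝ => 1 + t ^ 2 * (v ⬝ᵥ v)) 0 0 := by
      have := ((hasDerivAt_pow 2 (0 : ℝ)).mul_const (v ⬝ᵥ v)).const_add 1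
      simpa using this
    have h2 := (h1.sqrt (hpos 0).ne').inv (Real.sqrt_pos.2 (hpos 0)).ne'
    have h3 : HasDerivAt (fun t : ℝ => x + t • v) v 0 := by
      simpa using ((hasDerivAt_id (0 : ℝ)).smul_const v).const_add x
    exact (h2.smul h3).congr_deriv (by simp)
  have e1 : HasDerivAt (fun t => f (γ t)) (fderiv ℝ f x v) 0 := by
    have : HasFDerivAt f (fderiv ℝ f x) (γ 0) := hγ0.symm ▸ hf.hasFDerivAt
    exact this.comp_hasDerivAt 0 hγ
  have e2 : HasDerivAt (fun t => g (γ t)) (fderiv ℝ g x v) 0 := by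
    have : HasFDerivAt g (fderiv ℝ g x) (γ 0) := hγ0.symm ▸ hg.hasFDerivAt
    exact this.comp_hasDerivAt 0 hγ
  have e3 : (fun t => f (γ t)) = fun t => g (γ t) := funext fun t => h _ (hγS t)
  rw [e3] at e1
  exact e1.unique e2

theorem lieFun_congr (A : LieG n) {f g : (Fin (n + 1) → ℝ) → ℂ} {x : Fin (n + 1) → ℝ}
    (hf : DifferentiableAt ℝ f x) (hg : DifferentiableAt ℝ g x)
    (h : ∀ y, y ⬝ᵥ y = 1 → f y = g y) (hx : x ⬝ᵥ x = 1) :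
    lieFun lam A f x = lieFun lam A g x := by
  rw [lieFun, lieFun, h x hx, fderiv_eq_of_eq_on_sphere hf hg h hx (dotProduct_confField A hx)]

theorem det_eq_zero_of_forall_dotProduct {N : ℕ} {R : Fin N → Fin N → ℝ} {x : Fin N → ℝ}
    (hx : x ≠ 0) (h : ∀ i, R i ⬝ᵥ x = 0) : (Matrix.of R).det = 0 :=
  Matrix.exists_mulVec_eq_zero_iff.1 ⟨x, hx, funext h⟩

/-- The conformal field attached to `A` has divergence `n (b · x)` on the sphere: the trace of its
Jacobian matrix on the tangent space at `x`. -/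
theorem sum_det_update_confFieldJac (A : LieG n) {x : Fin (n + 1) → ℝ}
    {v : Fin n → Fin (n + 1) → ℝ} (hv : IsTangentFrame x v) :
    ∑ j : Fin n, (Matrix.of (Function.update (Fin.cons x v : Fin (n + 1) → Fin (n + 1) → ℝ) j.succ
      (confFieldJac A x *ᵥ v j))).det =
      n * (boostPart A ⬝ᵥ x) * (Matrix.of (Fin.cons x v : Fin (n + 1) → Fin (n + 1) → ℝ)).det := by
  set R : Fin (n + 1) → Fin (n + 1) → ℝ := Fin.cons x v with hR
  have hx0 : x ≠ 0 := fun h => by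
    have := hv.1
    rw [h, zero_dotProduct] at this
    exact zero_ne_one this
  have h := sum_det_updateRow_mulVec (Matrix.of R) (confFieldJac A x)
  rw [Fin.sum_univ_succ, trace_confFieldJac] at h
  have h0 : ((Matrix.of R).updateRow 0 (confFieldJac A x *ᵥ (Matrix.of R) 0)).det =
      2 * (boostPart A ⬝ᵥ x) * (Matrix.of R).det := by
    have e1 : confFieldJac A x *ᵥ (Matrix.of R) 0 =
        (2 * (boostPart A ⬝ᵥ x)) • (Matrix.of R) 0 + (-(rotPart A *ᵥ x)) := by
      have : (Matrix.of R) 0 = x := rfl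
      rw [this, confFieldJac_mulVec, ← sub_eq_add_neg, two_mul, add_smul]
    rw [e1, Matrix.det_updateRow_add, Matrix.det_updateRow_smul, Matrix.updateRow_eq_self]
    have e2 : ((Matrix.of R).updateRow 0 (-(rotPart A *ᵥ x))).det = 0 := by
      refine det_eq_zero_of_forall_dotProduct hx0 fun i => ?_
      refine Fin.cases ?_ (fun i => ?_) i
      · change (Matrix.of R).updateRow 0 (-(rotPart A *ᵥ x)) 0 ⬝ᵥ x = 0
        rw [Matrix.updateRow_self, neg_dotProduct, dotProduct_comm,
          dotProduct_rotPart_mulVec_self, neg_zero]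
      · change (Matrix.of R).updateRow 0 (-(rotPart A *ᵥ x)) i.succ ⬝ᵥ x = 0
        rw [Matrix.updateRow_ne (Fin.succ_ne_zero i), dotProduct_comm]
        exact hv.2.1 i
    rw [e2, add_zero]
  rw [h0] at h
  have h1 : ∀ j : Fin n, (Matrix.of (Function.update R j.succ (confFieldJac A x *ᵥ v j))).det =
      ((Matrix.of R).updateRow j.succ (confFieldJac A x *ᵥ (Matrix.of R) j.succ)).det :=
    fun j => rfl
  simp_rw [h1]
  linarith

/-- Cramer's rule for the coordinates of a tangent vector in a tangent frame. -/
theorem det_update_sum_smul {x : Fin (n + 1) → ℝ} {v : Fin n → Fin (n + 1) → ℝ} (c : Fin n → ℝ)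
    (j : Fin n) :
    (Matrix.of (Function.update (Fin.cons x v : Fin (n + 1) → Fin (n + 1) → ℝ) j.succ
      (∑ i, c i • v i))).det =
      c j * (Matrix.of (Fin.cons x v : Fin (n + 1) → Fin (n + 1) → ℝ)).det := by
  have h := Matrix.det_updateRow_sum (Matrix.of (Fin.cons x v : Fin (n + 1) → Fin (n + 1) → ℝ))
    j.succ (Fin.cons 0 c : Fin (n + 1) → ℝ)
  rw [Fin.sum_univ_succ] at h
  simp only [Fin.cons_zero, Fin.cons_succ, zero_smul, zero_add, smul_eq_mul] at h
  exact h

/-- The Lie derivative of `f ω^λ` along a conformal field, in an arbitrary local parametrization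
`σ`. The component of `ω^λ` is `D^λ` with `D = |det(σ, ∂_1 σ, …, ∂_n σ)|`, so that the claim amounts
to `X(D) + (div X) D = n (b · σ) D` for the field `X` in the coordinates. -/
theorem isLieDerivative_volumeMul (A : LieG n) {f : (Fin (n + 1) → ℝ) → ℂ}
    (hf : ContDiff ℝ ∞ f) :
    IsLieDerivative lam (confField A) (volumeMul lam f) (volumeMul lam (lieFun lam A f)) := by
  intro σ U h X hX u hu
  have hU := h.isOpen.mem_nhds hu
  have hσ : ∀ w ∈ U, ContDiffAt ℝ ∞ σ w := fun w hw => h.smooth.contDiffAt (h.isOpen.mem_nhds hw)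
  have hσd : HasFDerivAt σ (fderiv ℝ σ u) u := ((hσ u hu).differentiableAt (by simp)).hasFDerivAt
  have hdσ : DifferentiableAt ℝ (fderiv ℝ σ) u :=
    ((hσ u hu).fderiv_right (m := ∞) (by simp)).differentiableAt (by simp)
  set R : (Fin n → ℝ) → Fin (n + 1) → Fin (n + 1) → ℝ :=
    fun w => Fin.cons (σ w) (coordFrame σ w) with hR
  have hcf : ∀ j, HasFDerivAt (fun w => coordFrame σ w j)
      ((ContinuousLinearMap.apply ℝ (Fin (n + 1) → ℝ) (Pi.single j (1 : ℝ))).comp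
        (fderiv ℝ (fderiv ℝ σ) u)) u := fun j =>
    HasFDerivAt.comp (g := ContinuousLinearMap.apply ℝ (Fin (n + 1) → ℝ)
      (Pi.single j (1 : ℝ) : Fin n → ℝ)) u (ContinuousLinearMap.hasFDerivAt _) hdσ.hasFDerivAt
  have hRd : DifferentiableAt ℝ R u := by
    refine differentiableAt_pi.2 fun i => ?_
    refine Fin.cases ?_ (fun j => ?_) i
    · exact hσd.differentiableAt
    · exact (hcf j).differentiableAt
  have hfr := h.isTangentFrame hu
  have hDne : ∀ w ∈ U, (Matrix.of (R w)).det ≠ 0 := fun w hw =>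
    abs_pos.1 (frameVolume_pos (h.isTangentFrame hw))
  have hXsum : ∀ w, fderiv ℝ σ w (X w) = ∑ i, X w i • coordFrame σ w i := fun w => by
    conv_lhs => rw [pi_eq_sum_univ' (X w)]
    simp only [map_sum, map_smul, coordFrame]
  have hV : DifferentiableAt ℝ (fun w => confField A (σ w)) u :=
    ((hasFDerivAt_confField A (σ u)).comp u hσd).differentiableAt
  -- Cramer's rule shows that the components of the field are differentiable
  have hXd : DifferentiableAt ℝ X u := by
    refine differentiableAt_pi.2 fun i => ?_
    have hup : DifferentiableAt ℝ
        (fun w => Function.update (R w) i.succ (confField A (σ w))) u := by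
      refine differentiableAt_pi.2 fun k => ?_
      by_cases hk : k = i.succ
      · subst hk; simpa using hV
      · simpa [Function.update_of_ne hk] using differentiableAt_pi.1 hRd k
    have hq := (hasFDerivAt_det hup).differentiableAt.mul
      ((hasFDerivAt_det hRd).differentiableAt.inv (hDne u hu))
    refine hq.congr_of_eventuallyEq ?_
    filter_upwards [hU] with w hw
    simp only [Pi.mul_apply, Pi.inv_apply]
    rw [← hX w hw, hXsum w, hR, det_update_sum_smul]
    have := hDne w hw
    simp only [hR] at this
    field_simp
  -- differentiating `dσ(X) = V ∘ σ` in the direction of `u_j`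
  have hdiff : ∀ j : Fin n, fderiv ℝ (fderiv ℝ σ) u (Pi.single j 1) (X u) =
      confFieldJac A (σ u) *ᵥ coordFrame σ u j -
        ∑ i, fderiv ℝ X u (Pi.single j 1) i • coordFrame σ u i := by
    intro j
    have e1 := hdσ.hasFDerivAt.clm_apply hXd.hasFDerivAt
    have e2 := ((hasFDerivAt_confField A (σ u)).comp u hσd).congr_of_eventuallyEq
      (f₁ := fun w => fderiv ℝ σ w (X w)) (by
        filter_upwards [hU] with w hw
        exact hX w hw)
    have e3 := congrArg (fun L : (Fin n → ℝ) →L[ℝ] (Fin (n + 1) → ℝ) => L (Pi.single j 1))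
      (e1.unique e2)
    have e4 : fderiv ℝ σ u (fderiv ℝ X u (Pi.single j 1)) +
        fderiv ℝ (fderiv ℝ σ) u (Pi.single j 1) (X u) =
        confFieldJac A (σ u) *ᵥ coordFrame σ u j := e3
    have e5 : fderiv ℝ σ u (fderiv ℝ X u (Pi.single j 1)) =
        ∑ i, fderiv ℝ X u (Pi.single j 1) i • coordFrame σ u i := by
      conv_lhs => rw [pi_eq_sum_univ' (fderiv ℝ X u (Pi.single j 1))]
      simp only [map_sum, map_smul, coordFrame]
    rw [← e4, e5, add_sub_cancel_left]
  have hsymm : IsSymmSndFDerivAt ℝ σ u := (hσ u hu).isSymmSndFDerivAt (by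
    rw [minSmoothness_of_isRCLikeNormedField]
    exact WithTop.coe_le_coe.2 (le_top : (2 : ℕ∞) ≤ ⊤))
  have hdetX : ((detMultilinear (n + 1)).linearDeriv (R u)).comp (fderiv ℝ R u) (X u) +
      (∑ j, fderiv ℝ X u (Pi.single j 1) j) * (Matrix.of (R u)).det =
      n * (boostPart A ⬝ᵥ σ u) * (Matrix.of (R u)).det := by
    have r0 : fderiv ℝ R u (X u) 0 = confField A (σ u) := by
      have := (hasFDerivAt_pi'.1 hRd.hasFDerivAt 0).unique (f' := _) (f₁' := fderiv ℝ σ u) hσd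
      rw [← hX u hu, ← this]; rfl
    have r1 : ∀ j : Fin n, fderiv ℝ R u (X u) j.succ =
        fderiv ℝ (fderiv ℝ σ) u (Pi.single j 1) (X u) := fun j => by
      have := (hasFDerivAt_pi'.1 hRd.hasFDerivAt j.succ).unique (hcf j)
      have h2 := congrArg (fun L : (Fin n → ℝ) →L[ℝ] (Fin (n + 1) → ℝ) => L (X u)) this
      rw [hsymm]
      exact h2
    rw [ContinuousLinearMap.comp_apply, ContinuousMultilinearMap.linearDeriv_apply,
      Fin.sum_univ_succ, r0]
    simp_rw [r1, hdiff, ContinuousMultilinearMap.map_update_sub]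
    have z0 : detMultilinear (n + 1) (Function.update (R u) 0 (confField A (σ u))) = 0 := by
      refine det_eq_zero_of_forall_dotProduct (x := σ u) (fun h0 => ?_) fun i => ?_
      · have := hfr.1
        rw [h0, zero_dotProduct] at this
        exact zero_ne_one this
      · refine Fin.cases ?_ (fun i => ?_) i
        · change Function.update (R u) 0 (confField A (σ u)) 0 ⬝ᵥ σ u = 0
          rw [Function.update_self, dotProduct_comm]
          exact dotProduct_confField A hfr.1
        · change Function.update (R u) 0 (confField A (σ u)) i.succ ⬝ᵥ σ u = 0
          rw [Function.update_of_ne (Fin.succ_ne_zero i), dotProduct_comm]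
          exact hfr.2.1 i
    rw [z0, zero_add, Finset.sum_sub_distrib]
    simp only [detMultilinear_apply, hR, det_update_sum_smul]
    rw [sum_det_update_confFieldJac A hfr, ← Finset.sum_mul]
    ring
  -- `component (f ω^λ) = (f ∘ σ) exp(λ log |det|)` near `u`
  have hcomp : component (volumeMul lam f) σ =ᶠ[nhds u] fun w =>
      f (σ w) * Complex.exp (((Real.log (Matrix.of (R w)).det : ℝ) : ℂ) * lam) := by
    filter_upwards [hU] with w hw
    have hw' := h.isTangentFrame hw
    have hposw := frameVolume_pos hw'
    rw [component, volumeMul, if_pos hw', Complex.cpow_def_of_ne_zero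
      (Complex.ofReal_ne_zero.2 hposw.ne'), ← Complex.ofReal_log hposw.le, frameVolume,
      Real.log_abs]
  set W : ℂ := Complex.exp (((Real.log (Matrix.of (R u)).det : ℝ) : ℂ) * lam) with hW
  have hfd : HasFDerivAt f (fderiv ℝ f (σ u)) (σ u) :=
    (hf.differentiable (by simp) _).hasFDerivAt
  have hmain := (hfd.comp u hσd).mul
    (((Complex.ofRealCLM.hasFDerivAt.comp u ((hasFDerivAt_det hRd).log (hDne u hu))).mul_const
      lam).cexp)
  have hF := (hmain.congr_of_eventuallyEq hcomp).fderiv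
  have hlin : ∑ i, (X u i : ℂ) * fderiv ℝ (component (volumeMul lam f) σ) u (Pi.single i 1) =
      fderiv ℝ (component (volumeMul lam f) σ) u (X u) := by
    conv_rhs => rw [pi_eq_sum_univ' (X u)]
    simp only [map_sum, map_smul, Complex.real_smul]
  have hψ : component (volumeMul lam (lieFun lam A f)) σ u = lieFun lam A f (σ u) * W := by
    have hposw := frameVolume_pos hfr
    rw [component, volumeMul, if_pos hfr, Complex.cpow_def_of_ne_zero
      (Complex.ofReal_ne_zero.2 hposw.ne'), ← Complex.ofReal_log hposw.le, frameVolume,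
      Real.log_abs]
  have hval : fderiv ℝ (component (volumeMul lam f) σ) u (X u) =
      f (σ u) * (W * ((((Matrix.of (R u)).det⁻¹ *
        ((detMultilinear (n + 1)).linearDeriv (R u)).comp (fderiv ℝ R u) (X u) : ℝ) : ℂ) * lam)) +
      W * fderiv ℝ f (σ u) (confField A (σ u)) := by
    rw [hF, ← hX u hu]
    simp [hW, mul_comm lam]
  rw [hψ, hlin, hval, hcomp.eq_of_nhds, lieFun]
  have hD := hDne u hu
  have hdetX' : (Matrix.of (R u)).det⁻¹ *
      ((detMultilinear (n + 1)).linearDeriv (R u)).comp (fderiv ℝ R u) (X u) =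
      n * (boostPart A ⬝ᵥ σ u) - ∑ j, fderiv ℝ X u (Pi.single j 1) j := by
    rw [eq_sub_of_add_eq hdetX]
    field_simp
  rw [hdetX']
  push_cast
  ring

end

section

/-! ### The representation of `o(n+1,1)` on densities -/

variable {n : ℕ} {lam : ℂ}

/-- The density `f ω^λ`, for a smooth function `f` on `ℝ^{n+1}`. -/
def mkDensity (lam : ℂ) (f : (Fin (n + 1) → ℝ) → ℂ) (hf : ContDiff ℝ ∞ f) : TensorDensity n lam :=
  ⟨volumeMul lam f, volumeMul_mem lam hf⟩

theorem mkDensity_congr (hn : 1 ≤ n) {f g : (Fin (n + 1) → ℝ) → ℂ} (hf : ContDiff ℝ ∞ f)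
    (hg : ContDiff ℝ ∞ g) (h : ∀ x, x ⬝ᵥ x = 1 → f x = g x) :
    mkDensity lam f hf = mkDensity lam g hg :=
  Subtype.ext ((volumeMul_eq_iff hn f g).2 h)

theorem mkDensity_radialExt (hn : 1 ≤ n) (φ : TensorDensity n lam) :
    mkDensity lam (radialExt φ) (contDiff_radialExt hn φ) = φ :=
  Subtype.ext (eq_volumeMul_radialExt φ).symm

theorem radialExt_mkDensity (hn : 1 ≤ n) {f : (Fin (n + 1) → ℝ) → ℂ} (hf : ContDiff ℝ ∞ f)
    {x : Fin (n + 1) → ℝ} (hx : x ⬝ᵥ x = 1) : radialExt (mkDensity lam f hf) x = f x :=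
  (volumeMul_eq_iff (lam := lam) hn _ _).1 (eq_volumeMul_radialExt (mkDensity lam f hf)).symm x hx

/-- The Lie derivative of densities along the conformal field of `A`. -/
def lieAct (hn : 1 ≤ n) (lam : ℂ) (A : LieG n) : Module.End ℂ (TensorDensity n lam) where
  toFun φ :=
    mkDensity lam (lieFun lam A (radialExt φ)) (contDiff_lieFun A (contDiff_radialExt hn φ))
  map_add' φ ψ := by
    apply Subtype.ext
    funext x v
    have h1 := (contDiff_radialExt hn φ).differentiable (by simp) x
    have h2 := (contDiff_radialExt hn ψ).differentiable (by simp) x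
    by_cases h : IsTangentFrame x v
    · simp only [mkDensity, volumeMul, if_pos h, lieFun, map_add, fderiv_add h1 h2,
        Submodule.coe_add, Pi.add_apply, _root_.add_apply]
      ring
    · simp [mkDensity, volumeMul, h]
  map_smul' c φ := by
    apply Subtype.ext
    funext x v
    have h1 := (contDiff_radialExt hn φ).differentiable (by simp) x
    by_cases h : IsTangentFrame x v
    · simp only [mkDensity, volumeMul, if_pos h, lieFun, map_smul, fderiv_const_smul h1,
        Submodule.coe_smul, Pi.smul_apply, _root_.smul_apply, smul_eq_mul, RingHom.id_apply]
      ring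
    · simp [mkDensity, volumeMul, h]

theorem lieAct_mkDensity (hn : 1 ≤ n) (A : LieG n) {f : (Fin (n + 1) → ℝ) → ℂ}
    (hf : ContDiff ℝ ∞ f) :
    lieAct hn lam A (mkDensity lam f hf) =
      mkDensity lam (lieFun lam A f) (contDiff_lieFun A hf) :=
  mkDensity_congr hn (contDiff_lieFun A (contDiff_radialExt hn _)) _ fun x hx => lieFun_congr A
    ((contDiff_radialExt hn _).differentiable (by simp) x) (hf.differentiable (by simp) x)
    (fun _ hy => radialExt_mkDensity hn hf hy) hx

theorem isLieDerivative_lieAct (hn : 1 ≤ n) (A : LieG n) (φ : TensorDensity n lam) :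
    IsLieDerivative lam (confField A) φ.1 (lieAct hn lam A φ).1 := by
  have h := isLieDerivative_volumeMul (lam := lam) A (contDiff_radialExt hn φ)
  rw [← eq_volumeMul_radialExt] at h
  exact h

theorem boostPart_lie (A B : LieG n) :
    boostPart ⁅A, B⁆ = rotPart A *ᵥ boostPart B - rotPart B *ᵥ boostPart A := by
  have h : (⁅A, B⁆ : LieG n).1 = A.1 * B.1 - B.1 * A.1 := rfl
  funext i
  simp only [boostPart, h]
  rw [(LieG_eq_fromBlocks A).1, (LieG_eq_fromBlocks B).1]
  simp [Matrix.mul_apply, Matrix.mulVec, dotProduct, boostPart, rotPart, Matrix.fromBlocks]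

theorem rotPart_lie (A B : LieG n) :
    rotPart ⁅A, B⁆ = rotPart A * rotPart B - rotPart B * rotPart A +
      Matrix.vecMulVec (boostPart A) (boostPart B) -
      Matrix.vecMulVec (boostPart B) (boostPart A) := by
  have h : (⁅A, B⁆ : LieG n).1 = A.1 * B.1 - B.1 * A.1 := rfl
  ext i j
  have h2 : rotPart ⁅A, B⁆ i j = (A.1 * B.1 - B.1 * A.1) (Sum.inl i) (Sum.inl j) := rfl
  rw [h2, (LieG_eq_fromBlocks A).1, (LieG_eq_fromBlocks B).1, Matrix.fromBlocks_multiply,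
    Matrix.fromBlocks_multiply]
  simp [Matrix.mul_apply, Matrix.vecMulVec]
  ring

theorem dotProduct_rotPart_mulVec (A : LieG n) (x y : Fin (n + 1) → ℝ) :
    x ⬝ᵥ rotPart A *ᵥ y = -((rotPart A *ᵥ x) ⬝ᵥ y) := by
  rw [Matrix.dotProduct_mulVec, ← Matrix.mulVec_transpose, (LieG_eq_fromBlocks A).2,
    Matrix.neg_mulVec, neg_dotProduct]

/-- The divergences `n (b · x)` of the conformal fields satisfy
`div [V, W] = V (div W) - W (div V)`. -/
theorem boostPart_lie_dotProduct (A B : LieG n) (x : Fin (n + 1) → ℝ) :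
    boostPart ⁅A, B⁆ ⬝ᵥ x =
      boostPart B ⬝ᵥ confField A x - boostPart A ⬝ᵥ confField B x := by
  rw [boostPart_lie, confField_eq, confField_eq]
  simp only [sub_dotProduct, dotProduct_sub, dotProduct_add, dotProduct_smul,
    dotProduct_rotPart_mulVec, smul_eq_mul, dotProduct_comm (boostPart A) (boostPart B)]
  ring

/-- The map `A ↦ confField A` is a homomorphism from `o(n+1,1)` to the vector fields on `ℝ^{n+1}`
(not only on the sphere). -/
theorem confField_lie (A B : LieG n) (x : Fin (n + 1) → ℝ) :
    confField ⁅A, B⁆ x =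
      confFieldJac B x *ᵥ confField A x - confFieldJac A x *ᵥ confField B x := by
  have hv : ∀ a b : Fin (n + 1) → ℝ, Matrix.vecMulVec a b *ᵥ x = (b ⬝ᵥ x) • a := fun a b => by
    funext i
    simp only [Matrix.mulVec, Matrix.vecMulVec, dotProduct, Matrix.of_apply, Pi.smul_apply,
      smul_eq_mul, Finset.sum_mul]
    exact Finset.sum_congr rfl fun j _ => by ring
  rw [confField_eq, boostPart_lie_dotProduct, boostPart_lie, rotPart_lie, confFieldJac_mulVec,
    confFieldJac_mulVec]
  simp only [Matrix.add_mulVec, Matrix.sub_mulVec, hv, ← Matrix.mulVec_mulVec]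
  rw [confField_eq A x, confField_eq B x]
  simp only [Matrix.mulVec_sub, Matrix.mulVec_add, Matrix.mulVec_smul, sub_smul, dotProduct_sub,
    dotProduct_add, dotProduct_smul, smul_sub, smul_add, smul_smul, smul_eq_mul]
  rw [dotProduct_comm (boostPart A) (boostPart B)]
  funext i
  simp only [Pi.sub_apply, Pi.add_apply, Pi.smul_apply, smul_eq_mul]
  ring

theorem hasFDerivAt_boostPart (A : LieG n) (x : Fin (n + 1) → ℝ) :
    HasFDerivAt (fun y : Fin (n + 1) → ℝ => boostPart A ⬝ᵥ y)
      (LinearMap.toContinuousLinearMap (dotProductBilin ℝ ℝ (boostPart A))) x :=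
  (LinearMap.toContinuousLinearMap (dotProductBilin ℝ ℝ (boostPart A))).hasFDerivAt

theorem lieFun_lieFun (A B : LieG n) {f : (Fin (n + 1) → ℝ) → ℂ} (hf : ContDiff ℝ ∞ f)
    (x : Fin (n + 1) → ℝ) :
    lieFun lam A (lieFun lam B f) x =
      fderiv ℝ (fun y => fderiv ℝ f y (confField B y)) x (confField A x) +
      lam * ((n * (boostPart B ⬝ᵥ confField A x) : ℝ) : ℂ) * f x +
      lam * ((n * (boostPart B ⬝ᵥ x) : ℝ) : ℂ) * fderiv ℝ f x (confField A x) +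
      lam * ((n * (boostPart A ⬝ᵥ x) : ℝ) : ℂ) * fderiv ℝ f x (confField B x) +
      lam * ((n * (boostPart A ⬝ᵥ x) : ℝ) : ℂ) * (lam * ((n * (boostPart B ⬝ᵥ x) : ℝ) : ℂ)) *
        f x := by
  have h1 : DifferentiableAt ℝ (fun y => fderiv ℝ f y (confField B y)) x :=
    ((hf.fderiv_right (m := ∞) (by simp)).clm_apply (contDiff_confField B)).differentiable
      (by simp) x
  have h2 := ((Complex.ofRealCLM.hasFDerivAt.comp x
    ((hasFDerivAt_boostPart B x).const_mul (n : ℝ))).const_mul lam).mul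
    (hf.differentiable (by simp) x).hasFDerivAt
  have h3 : fderiv ℝ (lieFun lam B f) x = _ := (h1.hasFDerivAt.add h2).fderiv
  rw [lieFun, h3]
  simp only [_root_.add_apply, _root_.smul_apply, ContinuousLinearMap.comp_apply,
    LinearMap.coe_toContinuousLinearMap', smul_eq_mul, lieFun]
  simp only [Function.comp, Complex.ofRealCLM_apply, dotProductBilin_apply_apply]
  ring

/-- The symmetry of the second derivative of `f` gives the bracket relation for the derivations, the
cocycle property of the divergence gives it for the terms of order zero. -/
theorem lieFun_lie (A B : LieG n) {f : (Fin (n + 1) → ℝ) → ℂ} (hf : ContDiff ℝ ∞ f)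
    (x : Fin (n + 1) → ℝ) :
    lieFun lam ⁅A, B⁆ f x =
      lieFun lam A (lieFun lam B f) x - lieFun lam B (lieFun lam A f) x := by
  have hsymm : IsSymmSndFDerivAt ℝ f x := hf.contDiffAt.isSymmSndFDerivAt (by
    rw [minSmoothness_of_isRCLikeNormedField]
    exact WithTop.coe_le_coe.2 (le_top : (2 : ℕ∞) ≤ ⊤))
  have hbr := VectorField.fderiv_apply_lieBracket_of_isSymmSndFDerivAt
    (hf.contDiffAt.of_le (WithTop.coe_le_coe.2 (le_top : (2 : ℕ∞) ≤ ⊤))) hsymm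
    (hasFDerivAt_confField B x).differentiableAt (hasFDerivAt_confField A x).differentiableAt
  have hb2 : VectorField.lieBracket ℝ (confField A) (confField B) x = confField ⁅A, B⁆ x := by
    rw [VectorField.lieBracket, (hasFDerivAt_confField A x).fderiv,
      (hasFDerivAt_confField B x).fderiv, confField_lie]
    rfl
  rw [hb2] at hbr
  rw [lieFun_lieFun A B hf, lieFun_lieFun B A hf, lieFun, hbr, boostPart_lie_dotProduct]
  push_cast
  ring

theorem confField_add (A B : LieG n) (x : Fin (n + 1) → ℝ) :
    confField (A + B) x = confField A x + confField B x := by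
  have h : (A + B : LieG n).1 = A.1 + B.1 := rfl
  simp only [confField, h, Matrix.add_mulVec]
  funext i
  simp
  ring

theorem confField_smul (r : ℝ) (A : LieG n) (x : Fin (n + 1) → ℝ) :
    confField (r • A) x = r • confField A x := by
  have h : (r • A : LieG n).1 = r • A.1 := rfl
  simp only [confField, h, Matrix.smul_mulVec]
  funext i
  simp
  ring

theorem boostPart_add (A B : LieG n) : boostPart (A + B) = boostPart A + boostPart B := rfl

theorem boostPart_smul (r : ℝ) (A : LieG n) : boostPart (r • A) = r • boostPart A := rfl

attribute [local instance] LieRing.ofAssociativeRing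

/-- The representation of `o(n+1,1)` on the densities of degree `λ`. -/
def lieRep (hn : 1 ≤ n) (lam : ℂ) : LieGRep n (TensorDensity n lam) where
  toFun := lieAct hn lam
  map_add' A B := by
    ext φ : 1
    apply Subtype.ext
    funext x v
    change volumeMul _ _ _ _ = volumeMul _ _ _ _ + volumeMul _ _ _ _
    by_cases h : IsTangentFrame x v
    · simp only [volumeMul, if_pos h, lieFun, confField_add, boostPart_add, map_add,
        add_dotProduct]
      push_cast
      ring
    · simp [volumeMul, h]
  map_smul' r A := by
    ext φ : 1
    apply Subtype.ext
    funext x v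
    change volumeMul _ _ _ _ = (r : ℂ) * volumeMul _ _ _ _
    by_cases h : IsTangentFrame x v
    · simp only [volumeMul, if_pos h, lieFun, confField_smul, boostPart_smul, map_smul,
        smul_dotProduct, smul_eq_mul, Complex.real_smul]
      push_cast
      ring
    · simp [volumeMul, h]
  map_lie' {A B} := by
    ext φ : 1
    rw [← mkDensity_radialExt hn φ]
    set f := radialExt φ
    have hf : ContDiff ℝ ∞ f := contDiff_radialExt hn φ
    change lieAct hn lam ⁅A, B⁆ (mkDensity lam f hf) =
      lieAct hn lam A (lieAct hn lam B (mkDensity lam f hf)) -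
      lieAct hn lam B (lieAct hn lam A (mkDensity lam f hf))
    simp only [lieAct_mkDensity]
    apply Subtype.ext
    funext x v
    change volumeMul _ _ _ _ = volumeMul _ _ _ _ - volumeMul _ _ _ _
    by_cases h : IsTangentFrame x v
    · simp only [volumeMul, if_pos h, lieFun_lie A B hf]
      ring
    · simp [volumeMul, h]

end

section

/-! ### Rotations of densities and of conformal fields -/

variable {n : ℕ} {lam : ℂ}

theorem volumeMul_rotate (k : SO n) (f : (Fin (n + 1) → ℝ) → ℂ) (x : Fin (n + 1) → ℝ)
    (v : Fin n → Fin (n + 1) → ℝ) :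
    volumeMul lam f (k.1 *ᵥ x) (fun i => k.1 *ᵥ v i) =
      volumeMul lam (fun y => f (k.1 *ᵥ y)) x v := by
  by_cases h : IsTangentFrame x v
  · rw [volumeMul, volumeMul, if_pos h, if_pos (h.rotate k), frameVolume_rotate]
  · have h' : ¬ IsTangentFrame (k.1 *ᵥ x) (fun i => k.1 *ᵥ v i) := fun h' => h (by
      simpa only [SO.inv_mulVec_mulVec] using h'.rotate k⁻¹)
    rw [volumeMul, volumeMul, if_neg h, if_neg h']

theorem contDiff_comp_mulVec {f : (Fin (n + 1) → ℝ) → ℂ} (hf : ContDiff ℝ ∞ f)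
    (M : Matrix (Fin (n + 1)) (Fin (n + 1)) ℝ) : ContDiff ℝ ∞ fun y => f (M *ᵥ y) :=
  hf.comp (LinearMap.toContinuousLinearMap (Matrix.mulVecLin M)).contDiff

theorem rotationRep_mkDensity (k : SO n) {f : (Fin (n + 1) → ℝ) → ℂ} (hf : ContDiff ℝ ∞ f) :
    rotationRep n lam k (mkDensity lam f hf) =
      mkDensity lam (fun y => f ((k⁻¹ : SO n).1 *ᵥ y)) (contDiff_comp_mulVec hf _) := by
  apply Subtype.ext
  funext x v
  exact volumeMul_rotate k⁻¹ f x v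

theorem boostPart_Ad (k : SO n) (A : LieG n) : boostPart (Ad k A) = k.1 *ᵥ boostPart A := by
  funext i
  have h : boostPart (Ad k A) i = (blockSO k * A.1 * (blockSO k)ᵀ) (Sum.inl i) (Sum.inr 0) := rfl
  rw [h, (LieG_eq_fromBlocks A).1, blockSO, Matrix.fromBlocks_transpose,
    Matrix.fromBlocks_multiply, Matrix.fromBlocks_multiply]
  simp [Matrix.mul_apply, Matrix.mulVec, dotProduct]

theorem rotPart_Ad (k : SO n) (A : LieG n) : rotPart (Ad k A) = k.1 * rotPart A * k.1ᵀ := by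
  ext i j
  have h : rotPart (Ad k A) i j = (blockSO k * A.1 * (blockSO k)ᵀ) (Sum.inl i) (Sum.inl j) := rfl
  rw [h, (LieG_eq_fromBlocks A).1, blockSO, Matrix.fromBlocks_transpose,
    Matrix.fromBlocks_multiply, Matrix.fromBlocks_multiply]
  simp

theorem confField_Ad (k : SO n) (A : LieG n) (x : Fin (n + 1) → ℝ) :
    confField (Ad k A) (k.1 *ᵥ x) = k.1 *ᵥ confField A x := by
  rw [confField_eq, confField_eq, boostPart_Ad, SO.dot, rotPart_Ad, Matrix.mulVec_mulVec,
    Matrix.mul_assoc, SO.transpose_mul, Matrix.mul_one, ← Matrix.mulVec_mulVec, Matrix.mulVec_sub,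
    Matrix.mulVec_add, Matrix.mulVec_smul]

theorem lieFun_Ad (k : SO n) (A : LieG n) {f : (Fin (n + 1) → ℝ) → ℂ} (hf : ContDiff ℝ ∞ f)
    (x : Fin (n + 1) → ℝ) :
    lieFun lam (Ad k A) f (k.1 *ᵥ x) = lieFun lam A (fun y => f (k.1 *ᵥ y)) x := by
  have h : HasFDerivAt (fun y => f (k.1 *ᵥ y)) ((fderiv ℝ f (k.1 *ᵥ x)).comp
      (LinearMap.toContinuousLinearMap (Matrix.mulVecLin k.1))) x :=
    HasFDerivAt.comp (g := f) x (hf.differentiable (by simp) _).hasFDerivAt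
      (LinearMap.toContinuousLinearMap (Matrix.mulVecLin k.1)).hasFDerivAt
  rw [lieFun, lieFun, h.fderiv, confField_Ad, boostPart_Ad, SO.dot]
  rfl

theorem lieAct_Ad (hn : 1 ≤ n) (k : SO n) (A : LieG n) (φ : TensorDensity n lam) :
    lieAct hn lam (Ad k A) φ = rotationRep n lam k (lieAct hn lam A (rotationRep n lam k⁻¹ φ)) := by
  rw [← mkDensity_radialExt hn φ]
  rw [rotationRep_mkDensity, lieAct_mkDensity, lieAct_mkDensity, rotationRep_mkDensity]
  refine mkDensity_congr hn _ _ fun x _ => ?_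
  simp only [inv_inv]
  rw [← lieFun_Ad k A (contDiff_radialExt hn φ), SO.mulVec_inv_mulVec]

section Exponential

attribute [local instance] Matrix.linftyOpNormedRing Matrix.linftyOpNormedAlgebra

theorem hasDerivAt_exp_smul_mulVec (B : Matrix (Fin (n + 1)) (Fin (n + 1)) ℝ)
    (x : Fin (n + 1) → ℝ) :
    HasDerivAt (fun t : ℝ => NormedSpace.exp (t • B) *ᵥ x) (B *ᵥ x) 0 := by
  have h := hasDerivAt_exp_smul_const (𝕂 := ℝ) B (0 : ℝ)
  rw [zero_smul, NormedSpace.exp_zero, one_mul] at h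
  let L : Matrix (Fin (n + 1)) (Fin (n + 1)) ℝ →L[ℝ] (Fin (n + 1) → ℝ) :=
    LinearMap.toContinuousLinearMap ((Matrix.mulVecBilin ℝ ℝ).flip x)
  exact L.hasFDerivAt.comp_hasDerivAt 0 h

end Exponential

theorem expK_inv_mulVec (B : LieK n) (t : ℝ) (x : Fin (n + 1) → ℝ) :
    ((expK B t)⁻¹ : SO n).1 *ᵥ x = NormedSpace.exp (t • (-B.1)) *ᵥ x := by
  have hB := (LieAlgebra.Orthogonal.mem_so (Fin (n + 1)) ℝ _).1 B.2
  rw [SO.inv_coe, expK, ← Matrix.exp_transpose, Matrix.transpose_smul, hB]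

theorem confField_inclK (B : LieK n) (x : Fin (n + 1) → ℝ) :
    confField (inclK B) x = -(B.1 *ᵥ x) := by
  have h1 : boostPart (inclK B) = 0 := by funext i; simp [boostPart, inclK]
  have h2 : rotPart (inclK B) = B.1 := by ext i j; simp [rotPart, inclK]
  rw [confField_eq, h1, h2]
  simp

theorem lieFun_inclK (B : LieK n) (f : (Fin (n + 1) → ℝ) → ℂ) (x : Fin (n + 1) → ℝ) :
    lieFun lam (inclK B) f x = fderiv ℝ f x (-(B.1 *ᵥ x)) := by
  have h1 : boostPart (inclK B) = 0 := by funext i; simp [boostPart, inclK]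
  rw [lieFun, h1, confField_inclK]
  simp

/-- The values `(π(exp tB) φ)(x; v)` of the rotated densities have derivative `(L_B φ)(x; v)` at
`t = 0`. -/
theorem hasDerivAt_rotationRep_expK (hn : 1 ≤ n) (B : LieK n) (φ : TensorDensity n lam)
    (x : Fin (n + 1) → ℝ) (v : Fin n → Fin (n + 1) → ℝ) :
    HasDerivAt (fun t : ℝ => (rotationRep n lam (expK B t) φ).1 x v)
      ((lieAct hn lam (inclK B) φ).1 x v) 0 := by
  rw [← mkDensity_radialExt hn φ]
  set f := radialExt φ
  have hf : ContDiff ℝ ∞ f := contDiff_radialExt hn φ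
  simp only [rotationRep_mkDensity, lieAct_mkDensity]
  by_cases h : IsTangentFrame x v
  · simp only [mkDensity, volumeMul, if_pos h]
    refine HasDerivAt.mul_const ?_ _
    simp only [expK_inv_mulVec, lieFun_inclK]
    have h1 := hasDerivAt_exp_smul_mulVec (-B.1) x
    have h2 : HasFDerivAt f (fderiv ℝ f x) (NormedSpace.exp ((0 : ℝ) • (-B.1)) *ᵥ x) := by
      rw [zero_smul, NormedSpace.exp_zero, Matrix.one_mulVec]
      exact (hf.differentiable (by simp) x).hasFDerivAt
    rw [← Matrix.neg_mulVec]
    exact h2.comp_hasDerivAt 0 h1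
  · simp only [mkDensity, volumeMul, if_neg h]
    exact hasDerivAt_const _ _

theorem continuous_rotationRep_apply (hn : 1 ≤ n) (φ : TensorDensity n lam)
    (x : Fin (n + 1) → ℝ) (v : Fin n → Fin (n + 1) → ℝ) :
    Continuous fun k : SO n => (rotationRep n lam k φ).1 x v := by
  rw [← mkDensity_radialExt hn φ]
  set f := radialExt φ
  have hf : ContDiff ℝ ∞ f := contDiff_radialExt hn φ
  simp only [rotationRep_mkDensity]
  by_cases h : IsTangentFrame x v
  · simp only [mkDensity, volumeMul, if_pos h, SO.inv_coe]
    refine Continuous.mul (hf.continuous.comp ?_) continuous_const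
    exact Continuous.matrix_mulVec (Continuous.matrix_transpose continuous_subtype_val)
      continuous_const
  · simp only [mkDensity, volumeMul, if_neg h]
    exact continuous_const

end

section

/-! ### The `(𝔤, K)`-module of `K`-finite densities -/

variable {n : ℕ} {lam : ℂ}

/-- On a finite-dimensional space of densities every linear form is a combination of evaluations
at frames. This reduces continuity and differentiability of the coefficients of a representation to
pointwise statements. -/
theorem exists_dual_eq_sum_eval (W : Submodule ℂ (TensorDensity n lam)) [FiniteDimensional ℂ W]
    (l : Module.Dual ℂ (TensorDensity n lam)) :
    ∃ c : ((Fin (n + 1) → ℝ) × (Fin n → Fin (n + 1) → ℝ)) →₀ ℂ,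
      ∀ w ∈ W, l w = c.sum fun p a => a * w.1 p.1 p.2 := by
  let L : (Fin (n + 1) → ℝ) × (Fin n → Fin (n + 1) → ℝ) → W →ₗ[ℂ] ℂ := fun p =>
    { toFun := fun w => w.1.1 p.1 p.2
      map_add' := fun _ _ => rfl
      map_smul' := fun _ _ => rfl }
  have h : l.comp W.subtype ∈ Submodule.span ℂ (Set.range L) := by
    refine FiniteDimensional.mem_span_of_iInf_ker_le_ker (𝕜 := ℂ) (E := W) fun w hw => ?_
    have h0 : w = 0 := by
      apply Subtype.ext; apply Subtype.ext
      funext x v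
      exact (Submodule.mem_iInf _).1 hw (x, v)
    rw [h0]
    exact Submodule.zero_mem _
  obtain ⟨c, hc⟩ := (Finsupp.mem_span_range_iff_exists_finsupp).1 h
  refine ⟨c, fun w hw => ?_⟩
  have := congrArg (fun f : W →ₗ[ℂ] ℂ => f ⟨w, hw⟩) hc
  rw [Finsupp.sum] at this
  simp only [LinearMap.sum_apply, LinearMap.smul_apply, smul_eq_mul] at this
  exact this.symm

theorem finiteDimensional_orbit {φ : TensorDensity n lam}
    (hφ : φ ∈ (kFinite (rotationRep n lam)).toSubmodule) :
    FiniteDimensional ℂ (Submodule.span ℂ (Set.range fun k => rotationRep n lam k φ)) := hφ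

theorem continuous_dual_rotationRep (hn : 1 ≤ n) {φ : TensorDensity n lam}
    (hφ : φ ∈ (kFinite (rotationRep n lam)).toSubmodule)
    (l : Module.Dual ℂ (TensorDensity n lam)) :
    Continuous fun k : SO n => l (rotationRep n lam k φ) := by
  have := finiteDimensional_orbit hφ
  obtain ⟨c, hc⟩ := exists_dual_eq_sum_eval
    (Submodule.span ℂ (Set.range fun k => rotationRep n lam k φ)) l
  have h : (fun k : SO n => l (rotationRep n lam k φ)) = fun k =>
      c.sum fun p a => a * (rotationRep n lam k φ).1 p.1 p.2 :=
    funext fun k => hc _ (Submodule.subset_span ⟨k, rfl⟩)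
  rw [h]
  exact continuous_finsetSum _ fun p _ =>
    continuous_const.mul (continuous_rotationRep_apply hn φ p.1 p.2)

theorem hasDerivAt_dual_rotationRep (hn : 1 ≤ n) {φ : TensorDensity n lam}
    (hφ : φ ∈ (kFinite (rotationRep n lam)).toSubmodule) (B : LieK n)
    (l : Module.Dual ℂ (TensorDensity n lam)) :
    HasDerivAt (fun t : ℝ => l (rotationRep n lam (expK B t) φ))
      (l (lieAct hn lam (inclK B) φ)) 0 := by
  have := finiteDimensional_orbit hφ
  obtain ⟨c, hc⟩ := exists_dual_eq_sum_eval
    (Submodule.span ℂ (Set.range fun k => rotationRep n lam k φ) ⊔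
      Submodule.span ℂ {lieAct hn lam (inclK B) φ}) l
  have h : (fun t : ℝ => l (rotationRep n lam (expK B t) φ)) = fun t =>
      c.sum fun p a => a * (rotationRep n lam (expK B t) φ).1 p.1 p.2 :=
    funext fun t => hc _ (Submodule.mem_sup_left (Submodule.subset_span ⟨_, rfl⟩))
  rw [h, hc _ (Submodule.mem_sup_right (Submodule.mem_span_singleton_self _))]
  exact HasDerivAt.fun_sum fun p _ =>
    (hasDerivAt_rotationRep_expK hn B φ p.1 p.2).const_mul _

/-- The derivative of a curve in a finite-dimensional space stays in that space: the `K`-submodules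
of the space of `K`-finite densities are stable under `𝔨`. -/
theorem lieAct_inclK_mem (hn : 1 ≤ n) (S : Subrepresentation (rotationRep n lam))
    (hS : S.toSubmodule ≤ (kFinite (rotationRep n lam)).toSubmodule) (B : LieK n)
    {φ : TensorDensity n lam} (hφ : φ ∈ S.toSubmodule) :
    lieAct hn lam (inclK B) φ ∈ S.toSubmodule := by
  by_contra hD
  obtain ⟨l, hl, hlS⟩ := Submodule.exists_le_ker_of_notMem hD
  refine hl ?_
  have h1 := hasDerivAt_dual_rotationRep hn (hS hφ) B l
  have h2 : (fun t : ℝ => l (rotationRep n lam (expK B t) φ)) = fun _ => 0 :=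
    funext fun t => hlS (S.apply_mem_toSubmodule _ hφ)
  rw [h2] at h1
  exact h1.unique (hasDerivAt_const _ _)

theorem hasContinuousCoefficients_of_le (hn : 1 ≤ n) (S : Subrepresentation (rotationRep n lam))
    (hS : S.toSubmodule ≤ (kFinite (rotationRep n lam)).toSubmodule) :
    HasContinuousCoefficients (V := S.toSubmodule) S.toRepresentation := by
  intro v l
  obtain ⟨l', hl'⟩ := LinearMap.exists_extend l
  have h : (fun k : SO n => l (S.toRepresentation k v)) = fun k =>
      l' (rotationRep n lam k v.1) := funext fun k => by rw [← hl']; rfl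
  rw [h]
  exact continuous_dual_rotationRep hn (hS v.2) l'

/-- The infinitesimal action of `𝔨` on a `K`-submodule of the space of `K`-finite densities. -/
def lieKAct (hn : 1 ≤ n) (S : Subrepresentation (rotationRep n lam))
    (hS : S.toSubmodule ≤ (kFinite (rotationRep n lam)).toSubmodule) (B : LieK n) :
    Module.End ℂ S.toSubmodule :=
  (lieAct hn lam (inclK B)).restrict fun _ hφ => lieAct_inclK_mem hn S hS B hφ

theorem isDifferential_lieKAct (hn : 1 ≤ n) (S : Subrepresentation (rotationRep n lam))
    (hS : S.toSubmodule ≤ (kFinite (rotationRep n lam)).toSubmodule) :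
    IsDifferential (V := S.toSubmodule) S.toRepresentation (lieKAct hn S hS) := by
  intro B v l
  obtain ⟨l', hl'⟩ := LinearMap.exists_extend l
  have h : (fun t : ℝ => l (S.toRepresentation (expK B t) v)) = fun t =>
      l' (rotationRep n lam (expK B t) v.1) := funext fun k => by rw [← hl']; rfl
  have h2 : l (lieKAct hn S hS B v) = l' (lieAct hn lam (inclK B) v.1) := by rw [← hl']; rfl
  rw [h, h2]
  exact hasDerivAt_dual_rotationRep hn (hS v.2) B l'

theorem rotationRep_lieAct (hn : 1 ≤ n) (k : SO n) (A : LieG n) (φ : TensorDensity n lam) :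
    rotationRep n lam k (lieAct hn lam A φ) =
      lieAct hn lam (Ad k A) (rotationRep n lam k φ) := by
  rw [lieAct_Ad, ← Module.End.mul_apply (rotationRep n lam k⁻¹), ← map_mul, inv_mul_cancel, map_one,
    Module.End.one_apply]

attribute [local instance] LieRing.ofAssociativeRing

/-- The orbit of `A φ` lies in the finite-dimensional space `𝔤 W`, where `W` is spanned by the
orbit of `φ`. -/
theorem lieAct_mem_kFinite (hn : 1 ≤ n) (A : LieG n) {φ : TensorDensity n lam}
    (hφ : φ ∈ (kFinite (rotationRep n lam)).toSubmodule) :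
    lieAct hn lam A φ ∈ (kFinite (rotationRep n lam)).toSubmodule := by
  have := finiteDimensional_orbit hφ
  set W := Submodule.span ℂ (Set.range fun k => rotationRep n lam k φ)
  let b := Module.finBasis ℝ (LieG n)
  change FiniteDimensional ℂ (Submodule.span ℂ
    (Set.range fun k => rotationRep n lam k (lieAct hn lam A φ)))
  refine Submodule.finiteDimensional_of_le (S₂ := ⨆ i, W.map (lieAct hn lam (b i)))
    (Submodule.span_le.2 ?_)
  rintro _ ⟨k, rfl⟩
  have h1 : lieAct hn lam (Ad k A) = ∑ i, b.repr (Ad k A) i • lieAct hn lam (b i) := by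
    have h2 := congrArg (lieRep hn lam) (b.sum_repr (Ad k A)).symm
    rw [map_sum] at h2
    simp only [map_smul] at h2
    exact h2
  simp only [rotationRep_lieAct, h1, LinearMap.sum_apply]
  refine Submodule.sum_mem _ fun i _ => Submodule.mem_iSup_of_mem i ?_
  refine ⟨((b.repr (Ad k A) i : ℝ) : ℂ) • rotationRep n lam k φ,
    Submodule.smul_mem _ _ (Submodule.subset_span ⟨k, rfl⟩), ?_⟩
  rw [map_smul]
  rfl

/-- The restriction of a representation of `𝔤` to a stable subspace. -/
def restrictLieGRep {V : Type*} [AddCommGroup V] [Module ℂ V] (ρ : LieGRep n V)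
    (S : Submodule ℂ V) (h : ∀ A, ∀ v ∈ S, ρ A v ∈ S) : LieGRep n S where
  toFun A := (ρ A).restrict (h A)
  map_add' A B := by
    ext v : 2
    exact congrArg (fun f : Module.End ℂ V => f v.1) (ρ.map_add A B)
  map_smul' r A := by
    ext v : 2
    exact congrArg (fun f : Module.End ℂ V => f v.1) (ρ.map_smul r A)
  map_lie' {A B} := by
    ext v : 2
    exact congrArg (fun f : Module.End ℂ V => f v.1) (ρ.map_lie A B)

theorem mem_kFinite_toRepresentation {V : Type*} [AddCommGroup V] [Module ℂ V]
    (π : Representation ℂ (SO n) V) (v : (kFinite π).toSubmodule) :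
    v ∈ kFinite (kFinite π).toRepresentation := by
  have hv : FiniteDimensional ℂ (Submodule.span ℂ (Set.range fun k => π k v.1)) := v.2
  change FiniteDimensional ℂ (Submodule.span ℂ
    (Set.range fun k => (kFinite π).toRepresentation k v))
  set W := Submodule.span ℂ (Set.range fun k => (kFinite π).toRepresentation k v)
  have h : FiniteDimensional ℂ (W.map (kFinite π).toSubmodule.subtype) := by
    refine Submodule.finiteDimensional_of_le (S₂ :=
      Submodule.span ℂ (Set.range fun k => π k v.1)) ?_
    rw [Submodule.map_span_le]
    rintro _ ⟨k, rfl⟩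
    exact Submodule.subset_span ⟨k, rfl⟩
  exact (W.equivMapOfInjective _ (kFinite π).toSubmodule.subtype_injective).symm.finiteDimensional

/-- The representation of `𝔤` on the `K`-finite densities. -/
def lieRepKFinite (hn : 1 ≤ n) (lam : ℂ) :
    LieGRep n (kFinite (rotationRep n lam)).toSubmodule :=
  restrictLieGRep (lieRep hn lam) _ fun A _ hφ => lieAct_mem_kFinite hn A hφ

theorem isGKModule_lieRepKFinite (hn : 1 ≤ n) (lam : ℂ) :
    IsGKModule (lieRepKFinite hn lam) (kFinite (rotationRep n lam)).toRepresentation where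
  ad k A v := Subtype.ext (lieAct_Ad hn k A v.1)
  finite v := mem_kFinite_toRepresentation _ v
  continuous := hasContinuousCoefficients_of_le hn _ le_rfl
  differential := isDifferential_lieKAct hn _ le_rfl

end

section

/-! ### The Laplacian and the decomposition of polynomials -/

open MvPolynomial in
theorem laplacian_apply (n : ℕ) (P : MvPolynomial (Fin (n + 1)) ℂ) :
    laplacian n P = ∑ i, pderiv i (pderiv i P) := by
  simp [laplacian]

/-- The polynomial `x_0² + ⋯ + x_n²`. -/
def normSqPoly (n : ℕ) : MvPolynomial (Fin (n + 1)) ℂ :=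
  ∑ i, MvPolynomial.X i ^ 2

variable {n : ℕ} {lam : ℂ}

open MvPolynomial

theorem isHomogeneous_normSqPoly : (normSqPoly n).IsHomogeneous 2 :=
  IsHomogeneous.sum _ _ _ fun i _ => isHomogeneous_X_pow i 2

theorem pderiv_normSqPoly (i : Fin (n + 1)) : pderiv i (normSqPoly n) = 2 * X i := by
  simp only [normSqPoly, map_sum, pderiv_pow, pderiv_X]
  rw [Finset.sum_eq_single i (fun j _ hj => by simp [hj.symm]) (by simp)]
  simp

theorem laplacian_normSqPoly_mul (P : MvPolynomial (Fin (n + 1)) ℂ) :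
    laplacian n (normSqPoly n * P) =
      normSqPoly n * laplacian n P + 4 * ∑ i, X i * pderiv i P + 2 * (n + 1 : ℕ) * P := by
  have h : ∀ i, pderiv i (pderiv i (normSqPoly n * P)) =
      normSqPoly n * pderiv i (pderiv i P) + 4 * (X i * pderiv i P) + 2 * P := fun i => by
    have h2 : pderiv i (2 : MvPolynomial (Fin (n + 1)) ℂ) = 0 := pderiv_C (a := 2)
    simp only [pderiv_mul, pderiv_normSqPoly, map_add, pderiv_X_self, h2]
    ring
  simp only [laplacian_apply, h, Finset.sum_add_distrib, ← Finset.mul_sum]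
  simp
  ring

theorem laplacian_normSqPoly_pow_mul {k : ℕ} {h : MvPolynomial (Fin (n + 1)) ℂ}
    (hh : h ∈ harmonicHomogeneous n k) (s : ℕ) :
    laplacian n (normSqPoly n ^ (s + 1) * h) =
      ((2 * (s + 1) * (2 * s + 2 * k + n + 1) : ℕ) : ℂ) • (normSqPoly n ^ s * h) := by
  have hΔ : laplacian n h = 0 := hh.1
  have hE : ∀ s : ℕ, ∑ i, X i * pderiv i (normSqPoly n ^ s * h) =
      (2 * s + k) • (normSqPoly n ^ s * h) := fun s =>
    ((isHomogeneous_normSqPoly.pow s).mul hh.2).sum_X_mul_pderiv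
  induction s with
  | zero =>
    have h0 := hE 0
    rw [pow_zero, one_mul] at h0
    rw [zero_add, pow_one, laplacian_normSqPoly_mul, hΔ, h0, pow_zero, one_mul,
      ← Nat.cast_smul_eq_nsmul ℂ,
      smul_eq_C_mul, smul_eq_C_mul]
    push_cast
    simp only [map_add, map_mul, map_natCast, map_ofNat, map_one, map_zero]
    ring
  | succ s ih =>
    rw [pow_succ', mul_assoc, laplacian_normSqPoly_mul, ih, hE, ← Nat.cast_smul_eq_nsmul ℂ]
    simp only [smul_eq_C_mul]
    push_cast
    simp only [map_add, map_mul, map_natCast, map_ofNat, map_one]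
    ring

theorem isHomogeneous_laplacian {P : MvPolynomial (Fin (n + 1)) ℂ} {m : ℕ}
    (hP : P.IsHomogeneous (m + 2)) : (laplacian n P).IsHomogeneous m := by
  rw [laplacian_apply]
  exact IsHomogeneous.sum _ _ _ fun i _ => hP.pderiv.pderiv

theorem laplacian_eq_zero_of_lt_two {P : MvPolynomial (Fin (n + 1)) ℂ} {m : ℕ}
    (hP : P.IsHomogeneous m) (hm : m < 2) : laplacian n P = 0 := by
  rw [laplacian_apply]
  refine Finset.sum_eq_zero fun i _ => ?_
  have h : (pderiv i P).IsHomogeneous 0 := by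
    have := hP.pderiv (i := i)
    rwa [show m - 1 = 0 by omega] at this
  rw [← totalDegree_zero_iff_isHomogeneous, totalDegree_eq_zero_iff_eq_C] at h
  rw [h, pderiv_C]

/-- The span of the products `|x|^{2j} h`, with `h` harmonic homogeneous, of degree `m`. -/
def fischerSpan (n m : ℕ) : Submodule ℂ (MvPolynomial (Fin (n + 1)) ℂ) :=
  Submodule.span ℂ {P | ∃ j k, 2 * j + k = m ∧ ∃ h ∈ harmonicHomogeneous n k,
    P = normSqPoly n ^ j * h}

theorem fischerSpan_le (n m : ℕ) : fischerSpan n m ≤ homogeneousSubmodule (Fin (n + 1)) ℂ m := by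
  rw [fischerSpan, Submodule.span_le]
  rintro _ ⟨j, k, rfl, h, hh, rfl⟩
  exact (isHomogeneous_normSqPoly.pow j).mul hh.2

/-- The Laplacian maps `|x|^{2j+2} h` to a positive multiple of `|x|^{2j} h`, for `h` harmonic and
homogeneous. -/
theorem exists_laplacian_eq {m : ℕ} {Q : MvPolynomial (Fin (n + 1)) ℂ}
    (hQ : Q ∈ fischerSpan n m) :
    ∃ R ∈ fischerSpan n (m + 2), laplacian n R = Q := by
  have h : fischerSpan n m ≤ (fischerSpan n (m + 2)).map (laplacian n) := by
    conv_lhs => rw [fischerSpan]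
    rw [Submodule.span_le]
    rintro _ ⟨j, k, rfl, h, hh, rfl⟩
    have hc : ((2 * (j + 1) * (2 * j + 2 * k + n + 1) : ℕ) : ℂ) ≠ 0 :=
      Nat.cast_ne_zero.2 (by positivity)
    refine ⟨((2 * (j + 1) * (2 * j + 2 * k + n + 1) : ℕ) : ℂ)⁻¹ • (normSqPoly n ^ (j + 1) * h),
      Submodule.smul_mem _ _ (Submodule.subset_span ⟨j + 1, k, by ring, h, hh, rfl⟩), ?_⟩
    rw [map_smul, laplacian_normSqPoly_pow_mul hh, smul_smul, inv_mul_cancel₀ hc, one_smul]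
  exact h hQ

/-- Every homogeneous polynomial is a combination of products of powers of `|x|²` with harmonic
homogeneous polynomials: a preimage under the Laplacian is corrected degree by degree. -/
theorem mem_fischerSpan {m : ℕ} {P : MvPolynomial (Fin (n + 1)) ℂ} (hP : P.IsHomogeneous m) :
    P ∈ fischerSpan n m := by
  induction m using Nat.strong_induction_on generalizing P with
  | _ m ih =>
    have harm : ∀ P : MvPolynomial (Fin (n + 1)) ℂ, P.IsHomogeneous m → laplacian n P = 0 →
        P ∈ fischerSpan n m := fun P hP h0 =>
      Submodule.subset_span ⟨0, m, by ring, P, ⟨h0, hP⟩, by simp⟩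
    by_cases hm : m < 2
    · exact harm P hP (laplacian_eq_zero_of_lt_two hP hm)
    · obtain ⟨m, rfl⟩ := Nat.exists_eq_add_of_le' (not_lt.1 hm)
      obtain ⟨R, hR, hRP⟩ := exists_laplacian_eq (ih m (by omega) (isHomogeneous_laplacian hP))
      have h := harm (P - R) (hP.sub (fischerSpan_le n _ hR)) (by rw [map_sub, hRP, sub_self])
      have := Submodule.add_mem _ h hR
      rwa [sub_add_cancel] at this

/-! ### Polynomial densities -/

theorem polyDensity_eq_mkDensity (P : MvPolynomial (Fin (n + 1)) ℂ) :
    polyDensity n lam P = mkDensity lam (polyFun P) (contDiff_polyFun P) := rfl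

theorem polyDensity_eq_iff (hn : 1 ≤ n) (P Q : MvPolynomial (Fin (n + 1)) ℂ) :
    polyDensity n lam P = polyDensity n lam Q ↔ ∀ x, x ⬝ᵥ x = 1 → polyFun P x = polyFun Q x := by
  rw [← volumeMul_eq_iff (lam := lam) hn, Subtype.ext_iff]
  rfl

theorem polyFun_mul (P Q : MvPolynomial (Fin (n + 1)) ℂ) (x : Fin (n + 1) → ℝ) :
    polyFun (P * Q) x = polyFun P x * polyFun Q x := by simp [polyFun]

theorem polyFun_normSqPoly (x : Fin (n + 1) → ℝ) :
    polyFun (normSqPoly n) x = ((x ⬝ᵥ x : ℝ) : ℂ) := by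
  simp [polyFun, normSqPoly, dotProduct, sq]

theorem polyDensity_normSqPoly_mul (hn : 1 ≤ n) (P : MvPolynomial (Fin (n + 1)) ℂ) :
    polyDensity n lam (normSqPoly n * P) = polyDensity n lam P :=
  (polyDensity_eq_iff hn _ _).2 fun x hx => by rw [polyFun_mul, polyFun_normSqPoly, hx]; simp

theorem polyDensity_normSqPoly_pow_mul (hn : 1 ≤ n) (j : ℕ) (P : MvPolynomial (Fin (n + 1)) ℂ) :
    polyDensity n lam (normSqPoly n ^ j * P) = polyDensity n lam P := by
  induction j with
  | zero => simp
  | succ j ih => rw [pow_succ', mul_assoc, polyDensity_normSqPoly_mul hn, ih]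

theorem polyDensity_mem_iSup_of_isHomogeneous (hn : 1 ≤ n) {m : ℕ}
    {P : MvPolynomial (Fin (n + 1)) ℂ} (hP : P.IsHomogeneous m) :
    polyDensity n lam P ∈ ⨆ k : Fin (m + 1), HSpace n lam k := by
  have h : fischerSpan n m ≤ (⨆ k : Fin (m + 1), HSpace n lam k).comap (polyDensity n lam) := by
    rw [fischerSpan, Submodule.span_le]
    rintro _ ⟨j, k, rfl, h, hh, rfl⟩
    change polyDensity n lam (normSqPoly n ^ j * h) ∈ ⨆ i : Fin (2 * j + k + 1), HSpace n lam i
    rw [polyDensity_normSqPoly_pow_mul hn]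
    exact Submodule.mem_iSup_of_mem (⟨k, by omega⟩ : Fin (2 * j + k + 1)) ⟨h, hh, rfl⟩
  exact h (mem_fischerSpan hP)

/-- As `|x|² = 1` on the sphere, the harmonic polynomials yield all polynomial densities. -/
theorem polyDensity_mem_iSup (hn : 1 ≤ n) (P : MvPolynomial (Fin (n + 1)) ℂ) :
    polyDensity n lam P ∈ ⨆ m, HSpace n lam m := by
  rw [← sum_homogeneousComponent P, map_sum]
  refine Submodule.sum_mem _ fun m _ => ?_
  have h := polyDensity_mem_iSup_of_isHomogeneous (lam := lam) hn
    (homogeneousComponent_isHomogeneous m P)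
  exact (iSup_le fun k : Fin (m + 1) => le_iSup (HSpace n lam) (k : ℕ)) h

theorem eq_zero_of_polyFun_eq_zero {P : MvPolynomial (Fin (n + 1)) ℂ}
    (h : ∀ x : Fin (n + 1) → ℝ, polyFun P x = 0) : P = 0 := by
  refine MvPolynomial.funext_set (fun _ => Set.range ((↑) : ℝ → ℂ))
    (fun _ => Set.infinite_range_of_injective Complex.ofReal_injective) fun x hx => ?_
  choose y hy using fun i => hx i (Set.mem_univ i)
  have : x = fun i => (y i : ℂ) := funext fun i => (hy i).symm
  rw [this, map_zero]
  exact h y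

theorem eval_smul_of_isHomogeneous {m : ℕ} {P : MvPolynomial (Fin (n + 1)) ℂ}
    (hP : P.IsHomogeneous m) (c : ℂ) (z : Fin (n + 1) → ℂ) :
    eval (c • z) P = c ^ m * eval z P := by
  rw [eval_eq', eval_eq', Finset.mul_sum]
  refine Finset.sum_congr rfl fun d hd => ?_
  have h : ∑ i, d i = m := by
    rw [← Finsupp.degree_eq_sum]
    by_contra hne
    exact mem_support_iff.1 hd (hP.coeff_eq_zero hne)
  simp only [Pi.smul_apply, smul_eq_mul, mul_pow, Finset.prod_mul_distrib,
    Finset.prod_pow_eq_pow_sum, h]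
  ring

theorem polyFun_smul {m : ℕ} {P : MvPolynomial (Fin (n + 1)) ℂ} (hP : P.IsHomogeneous m)
    (r : ℝ) (x : Fin (n + 1) → ℝ) : polyFun P (r • x) = (r : ℂ) ^ m * polyFun P x := by
  rw [polyFun, polyFun, ← eval_smul_of_isHomogeneous hP]
  exact congrArg (fun z => eval z P) (funext fun i => by simp)

/-- A homogeneous polynomial that vanishes on the sphere is zero. -/
theorem eq_zero_of_polyDensity_eq_zero (hn : 1 ≤ n) {m : ℕ} {P : MvPolynomial (Fin (n + 1)) ℂ}
    (hP : P.IsHomogeneous m) (h : polyDensity n lam P = 0) : P = 0 := by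
  rw [← map_zero (polyDensity n lam), polyDensity_eq_iff hn] at h
  have hS : ∀ x : Fin (n + 1) → ℝ, x ⬝ᵥ x = 1 → polyFun P x = 0 := fun x hx => by
    rw [h x hx]; simp [polyFun]
  -- on a ray, a homogeneous polynomial is determined by its value on the sphere
  have hne : ∀ x : Fin (n + 1) → ℝ, x ≠ 0 → polyFun P x = 0 := fun x hx => by
    have hpos : 0 < x ⬝ᵥ x :=
      lt_of_le_of_ne (dotProduct_self_nonneg_real x) fun h0 =>
        hx (dotProduct_self_eq_zero.1 h0.symm)
    have hs := Real.sqrt_pos.2 hpos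
    have hx' : x = √(x ⬝ᵥ x) • ((√(x ⬝ᵥ x))⁻¹ • x) := by
      rw [smul_smul, mul_inv_cancel₀ hs.ne', one_smul]
    rw [hx', polyFun_smul hP, hS _ ?_, mul_zero]
    rw [smul_dotProduct, dotProduct_smul, smul_eq_mul, smul_eq_mul]
    field_simp
    exact (Real.sq_sqrt hpos.le).symm
  refine eq_zero_of_polyFun_eq_zero fun x => ?_
  by_cases hx : x = 0
  · have hc : Continuous (polyFun P) := (contDiff_polyFun P).continuous
    have hcl : IsClosed {x : Fin (n + 1) → ℝ | polyFun P x = 0} :=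
      isClosed_eq hc continuous_const
    have hd : Dense ({(0 : Fin (n + 1) → ℝ)}ᶜ : Set (Fin (n + 1) → ℝ)) := dense_compl_singleton 0
    have hsub : closure {(0 : Fin (n + 1) → ℝ)}ᶜ ⊆ {x | polyFun P x = 0} :=
      hcl.closure_subset_iff.2 fun y hy => hne y hy
    exact hsub (hd x)
  · exact hne x hx

/-! ### Linear substitutions -/

/-- The polynomial `x ↦ P(M x)`. -/
def linSubst (M : Matrix (Fin (n + 1)) (Fin (n + 1)) ℝ) :
    MvPolynomial (Fin (n + 1)) ℂ →ₐ[ℂ] MvPolynomial (Fin (n + 1)) ℂ :=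
  aeval fun i => ∑ j, C (M i j : ℂ) * X j

theorem eval_linSubst (M : Matrix (Fin (n + 1)) (Fin (n + 1)) ℝ) (P : MvPolynomial (Fin (n + 1)) ℂ)
    (z : Fin (n + 1) → ℂ) : eval z (linSubst M P) = eval (M.map ((↑) : ℝ → ℂ) *ᵥ z) P := by
  induction P using MvPolynomial.induction_on with
  | C a => simp [linSubst]
  | add p q hp hq => simp [hp, hq]
  | mul_X p i hp =>
    rw [map_mul, map_mul, hp, map_mul]
    refine congrArg (eval (M.map ((↑) : ℝ → ℂ) *ᵥ z) p * ·) ?_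
    simp [linSubst, Matrix.mulVec, dotProduct]

theorem polyFun_linSubst (M : Matrix (Fin (n + 1)) (Fin (n + 1)) ℝ)
    (P : MvPolynomial (Fin (n + 1)) ℂ) (x : Fin (n + 1) → ℝ) :
    polyFun (linSubst M P) x = polyFun P (M *ᵥ x) := by
  rw [polyFun, polyFun, eval_linSubst]
  exact congrArg (fun z => eval z P) (funext fun i => by simp [Matrix.mulVec, dotProduct])

theorem isHomogeneous_linSubst (M : Matrix (Fin (n + 1)) (Fin (n + 1)) ℝ) {m : ℕ}
    {P : MvPolynomial (Fin (n + 1)) ℂ} (hP : P.IsHomogeneous m) :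
    (linSubst M P).IsHomogeneous m := by
  have h := hP.aeval
    (fun i => ∑ j, C (M i j : ℂ) * X j : Fin (n + 1) → MvPolynomial (Fin (n + 1)) ℂ)
    (n := 1) fun i => IsHomogeneous.sum _ _ _ fun j _ => isHomogeneous_C_mul_X _ _
  rwa [one_mul] at h

theorem pderiv_linSubst (M : Matrix (Fin (n + 1)) (Fin (n + 1)) ℝ) (j : Fin (n + 1))
    (P : MvPolynomial (Fin (n + 1)) ℂ) :
    pderiv j (linSubst M P) = ∑ i, C (M i j : ℂ) * linSubst M (pderiv i P) := by
  induction P using MvPolynomial.induction_on with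
  | C a => simp [linSubst]
  | add p q hp hq => simp [hp, hq, mul_add, Finset.sum_add_distrib]
  | mul_X p i hp =>
    have hX : pderiv j (linSubst M (X i)) = C (M i j : ℂ) := by
      simp only [linSubst, aeval_X, map_sum, pderiv_C_mul, pderiv_X]
      rw [Finset.sum_eq_single j (fun l _ hl => by simp [hl]) (by simp)]
      simp
    rw [map_mul, pderiv_mul, hp, hX]
    simp only [pderiv_mul, map_add, map_mul, mul_add, Finset.sum_add_distrib, pderiv_X]
    rw [Finset.sum_mul]
    refine congrArg₂ (· + ·) ?_ ?_
    · exact Finset.sum_congr rfl fun l _ => by ring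
    · rw [Finset.sum_eq_single i (fun l _ hl => by simp [hl.symm]) (by simp)]
      simp
      ring

theorem laplacian_linSubst (k : SO n) (P : MvPolynomial (Fin (n + 1)) ℂ) :
    laplacian n (linSubst k.1 P) = linSubst k.1 (laplacian n P) := by
  have hk : ∀ i l, ∑ j, (C (k.1 i j : ℂ) * C (k.1 l j : ℂ) : MvPolynomial (Fin (n + 1)) ℂ) =
      if i = l then 1 else 0 := fun i l => by
    have h := congrFun (congrFun (SO.mul_transpose k) i) l
    simp only [Matrix.mul_apply, Matrix.transpose_apply, Matrix.one_apply] at h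
    have h2 := congrArg (fun r : ℝ => (C (r : ℂ) : MvPolynomial (Fin (n + 1)) ℂ)) h
    simp only [Complex.ofReal_sum, Complex.ofReal_mul, map_sum, map_mul] at h2
    rw [h2]
    split_ifs <;> simp
  simp only [laplacian_apply, pderiv_linSubst, map_sum, pderiv_C_mul, Finset.mul_sum]
  rw [Finset.sum_comm]
  refine Finset.sum_congr rfl fun i _ => ?_
  rw [Finset.sum_comm]
  simp only [← mul_assoc, ← Finset.sum_mul, hk]
  simp

theorem rotationRep_polyDensity (k : SO n) (P : MvPolynomial (Fin (n + 1)) ℂ) :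
    rotationRep n lam k (polyDensity n lam P) = polyDensity n lam (linSubst (k⁻¹ : SO n).1 P) := by
  have h : (fun y => polyFun P ((k⁻¹ : SO n).1 *ᵥ y)) = polyFun (linSubst (k⁻¹ : SO n).1 P) :=
    funext fun x => (polyFun_linSubst (k⁻¹ : SO n).1 P x).symm
  rw [polyDensity_eq_mkDensity, rotationRep_mkDensity, polyDensity_eq_mkDensity]
  simp only [h]

theorem linSubst_mem_harmonicHomogeneous (k : SO n) {m : ℕ} {P : MvPolynomial (Fin (n + 1)) ℂ}
    (hP : P ∈ harmonicHomogeneous n m) : linSubst k.1 P ∈ harmonicHomogeneous n m :=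
  ⟨by
    change laplacian n (linSubst k.1 P) = 0
    rw [laplacian_linSubst, show laplacian n P = 0 from hP.1, map_zero],
    isHomogeneous_linSubst k.1 hP.2⟩

/-- The `K`-submodule `H^{n+1,m}` of the space of densities. -/
def HSubrep (n : ℕ) (lam : ℂ) (m : ℕ) : Subrepresentation (rotationRep n lam) where
  toSubmodule := HSpace n lam m
  apply_mem_toSubmodule k := by
    rintro _ ⟨P, hP, rfl⟩
    rw [rotationRep_polyDensity]
    exact ⟨_, linSubst_mem_harmonicHomogeneous k⁻¹ hP, rfl⟩

instance finiteDimensional_harmonicHomogeneous (m : ℕ) :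
    FiniteDimensional ℂ (harmonicHomogeneous n m) := by
  have : FiniteDimensional ℂ (homogeneousSubmodule (Fin (n + 1)) ℂ m) :=
    Module.Finite.iff_fg.2 (homogeneousSubmodule_fg _ _ m)
  exact Submodule.finiteDimensional_of_le (inf_le_right : harmonicHomogeneous n m ≤ _)

instance finiteDimensional_HSpace (m : ℕ) : FiniteDimensional ℂ (HSpace n lam m) :=
  Module.Finite.map (harmonicHomogeneous n m) (polyDensity n lam)

theorem HSpace_le_kFinite (m : ℕ) :
    HSpace n lam m ≤ (kFinite (rotationRep n lam)).toSubmodule := by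
  intro φ hφ
  change FiniteDimensional ℂ (Submodule.span ℂ (Set.range fun k => rotationRep n lam k φ))
  refine Submodule.finiteDimensional_of_le (S₂ := HSpace n lam m) (Submodule.span_le.2 ?_)
  rintro _ ⟨k, rfl⟩
  exact (HSubrep n lam m).apply_mem_toSubmodule k hφ

end

section

/-! ### The Casimir operator and the independence of the spaces `H^{n+1,m}` -/

variable {n : ℕ} {lam : ℂ}

open MvPolynomial

theorem hasFDerivAt_polyFun (P : MvPolynomial (Fin (n + 1)) ℂ) (x : Fin (n + 1) → ℝ) :
    HasFDerivAt (polyFun P) (∑ i, (polyFun (pderiv i P) x) •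
      (Complex.ofRealCLM.comp (ContinuousLinearMap.proj (R := ℝ) (φ := fun _ => ℝ) i))) x := by
  induction P using MvPolynomial.induction_on with
  | C a =>
    have h : polyFun (n := n) (C a) = fun _ => a := by funext x; simp [polyFun]
    rw [h]
    refine (hasFDerivAt_const (𝕜 := ℝ) a x).congr_fderiv (ContinuousLinearMap.ext fun v => ?_)
    simp [polyFun]
  | add p q hp hq =>
    have h : polyFun (p + q) = fun x => polyFun p x + polyFun q x := by
      funext x; simp [polyFun]
    rw [h]
    refine (hp.add hq).congr_fderiv (ContinuousLinearMap.ext fun v => ?_)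
    simp [polyFun, add_mul, Finset.sum_add_distrib]
  | mul_X p i hp =>
    have h : polyFun (p * X i) = fun x => polyFun p x * (x i : ℂ) := by
      funext x; simp [polyFun]
    rw [h]
    have hX : HasFDerivAt (fun x : Fin (n + 1) → ℝ => (x i : ℂ))
      (Complex.ofRealCLM.comp (ContinuousLinearMap.proj (R := ℝ) (φ := fun _ => ℝ) i)) x :=
      (Complex.ofRealCLM.comp (ContinuousLinearMap.proj (R := ℝ) (φ := fun _ => ℝ) i)).hasFDerivAt
    refine (hp.mul hX).congr_fderiv (ContinuousLinearMap.ext fun v => ?_)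
    simp only [_root_.add_apply, _root_.smul_apply, _root_.sum_apply,
      ContinuousLinearMap.comp_apply, ContinuousLinearMap.proj_apply, Complex.ofRealCLM_apply,
      smul_eq_mul, pderiv_mul, Finset.mul_sum]
    have h2 : ∀ j, polyFun (pderiv j p * X i + p * pderiv j (X i)) x * (v j : ℂ) =
        (x i : ℂ) * (polyFun (pderiv j p) x * (v j : ℂ)) +
          if j = i then polyFun p x * (v j : ℂ) else 0 := fun j => by
      by_cases hj : j = i
      · subst hj; simp [polyFun]; ring
      · simp [polyFun, pderiv_X_of_ne (Ne.symm hj), hj]; ring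
    simp only [h2, Finset.sum_add_distrib, Finset.sum_ite_eq', Finset.mem_univ, if_true]
    ring

theorem pderiv_pderiv_comm (i j : Fin (n + 1)) (P : MvPolynomial (Fin (n + 1)) ℂ) :
    pderiv j (pderiv i P) = pderiv i (pderiv j P) := by
  induction P using MvPolynomial.induction_on with
  | C a => simp
  | add p q hp hq => simp [hp, hq]
  | mul_X p l hp =>
    have h : ∀ a b, pderiv a (pderiv b (X l : MvPolynomial (Fin (n + 1)) ℂ)) = 0 := fun a b => by
      by_cases hb : l = b
      · subst hb; simp
      · simp [pderiv_X_of_ne hb]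
    simp only [pderiv_mul, map_add, hp, h]
    ring

/-- The polynomial `-∑_i (B x)_i ∂P/∂x_i`, the derivative of `P(exp(-tB) x)` at `t = 0`. -/
def rotDeriv (B : Matrix (Fin (n + 1)) (Fin (n + 1)) ℝ) (P : MvPolynomial (Fin (n + 1)) ℂ) :
    MvPolynomial (Fin (n + 1)) ℂ :=
  -∑ i, (∑ j, C (B i j : ℂ) * X j) * pderiv i P

theorem lieAct_polyDensity (hn : 1 ≤ n) (B : LieK n) (P : MvPolynomial (Fin (n + 1)) ℂ) :
    lieAct hn lam (inclK B) (polyDensity n lam P) = polyDensity n lam (rotDeriv B.1 P) := by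
  rw [polyDensity_eq_mkDensity, lieAct_mkDensity, polyDensity_eq_mkDensity]
  refine mkDensity_congr hn _ _ fun x _ => ?_
  rw [lieFun_inclK, (hasFDerivAt_polyFun P x).fderiv]
  simp only [_root_.smul_apply, _root_.sum_apply,
      ContinuousLinearMap.comp_apply, ContinuousLinearMap.proj_apply, Complex.ofRealCLM_apply,
      smul_eq_mul, polyFun, rotDeriv, Matrix.mulVec, dotProduct, map_neg, map_sum,
      map_mul, eval_C, eval_X, Complex.ofReal_mul]
  congr 1
  exact Finset.sum_congr rfl fun i _ => mul_comm _ _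

/-- The element `E_{ij} - E_{ji}` of `o(n+1)`. -/
def rotGen (i j : Fin (n + 1)) : LieK n :=
  ⟨Matrix.single i j 1 - Matrix.single j i 1, by
    rw [LieAlgebra.Orthogonal.mem_so]
    simp [Matrix.transpose_sub, Matrix.transpose_single]⟩

theorem rotDeriv_rotGen (i j : Fin (n + 1)) (P : MvPolynomial (Fin (n + 1)) ℂ) :
    rotDeriv (rotGen i j).1 P = X i * pderiv j P - X j * pderiv i P := by
  have h : ∀ a, ∑ b, (C (((Matrix.single i j 1 - Matrix.single j i 1 :
      Matrix (Fin (n + 1)) (Fin (n + 1)) ℝ) a b : ℝ) : ℂ) * X b : MvPolynomial (Fin (n + 1)) ℂ) =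
      (if a = i then X j else 0) - if a = j then X i else 0 := fun a => by
    simp only [Matrix.sub_apply, Complex.ofReal_sub, map_sub, sub_mul, Finset.sum_sub_distrib]
    congr 1
    · rw [Finset.sum_eq_single j (fun b _ hb => by
        simp [hb.symm]) (by simp)]
      by_cases ha : a = i
      · subst ha; simp
      · simp [ha, Ne.symm ha]
    · rw [Finset.sum_eq_single i (fun b _ hb => by
        simp [hb.symm]) (by simp)]
      by_cases ha : a = j
      · subst ha; simp
      · simp [ha, Ne.symm ha]
  change -∑ a, (∑ b, C (((Matrix.single i j 1 - Matrix.single j i 1 :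
      Matrix (Fin (n + 1)) (Fin (n + 1)) ℝ) a b : ℝ) : ℂ) * X b) * pderiv a P = _
  simp only [h, sub_mul, ite_mul, zero_mul, Finset.sum_sub_distrib, Finset.sum_ite_eq',
    Finset.mem_univ, if_true]
  ring

/-- `∑_{i,j} (x_i ∂_j - x_j ∂_i)² = 2 (|x|² Δ - E² - (n - 1) E)`, where `E` is the Euler
operator. -/
theorem sum_rotDeriv_rotDeriv {m : ℕ} {P : MvPolynomial (Fin (n + 1)) ℂ}
    (hP : P ∈ harmonicHomogeneous n m) :
    ∑ i, ∑ j, rotDeriv (rotGen i j).1 (rotDeriv (rotGen i j).1 P) =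
      (-(2 * m * (m + n - 1)) : ℂ) • P := by
  have hE : ∑ i, X i * pderiv i P = (m : ℂ) • P := by
    rw [IsHomogeneous.sum_X_mul_pderiv hP.2, Nat.cast_smul_eq_nsmul]
  have hEE : ∑ i, ∑ j, X i * X j * pderiv i (pderiv j P) = ((m * (m - 1) : ℂ)) • P := by
    have h1 : ∑ i, X i * pderiv i (∑ j, X j * pderiv j P) = ∑ i, X i * pderiv i ((m : ℂ) • P) := by
      rw [hE]
    have h2 : ∀ i, X i * pderiv i (∑ j, X j * pderiv j P) =
        X i * pderiv i P + ∑ j, X i * X j * pderiv i (pderiv j P) := fun i => by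
      simp only [map_sum, pderiv_mul, pderiv_X, Finset.sum_add_distrib, mul_add]
      rw [Finset.sum_eq_single i (fun l _ hl => by simp [hl]) (by simp), Finset.mul_sum]
      simp [mul_assoc]
    rw [Finset.sum_congr rfl fun i _ => h2 i, Finset.sum_add_distrib] at h1
    simp only [hE, Derivation.map_smul, mul_smul_comm, ← Finset.smul_sum] at h1
    rw [eq_sub_of_add_eq' h1, smul_smul, ← sub_smul]
    congr 1
    ring
  have hΔ : ∑ i, pderiv i (pderiv i P) = 0 := by
    rw [← laplacian_apply]; exact hP.1
  have key : ∀ i j, rotDeriv (rotGen i j).1 (rotDeriv (rotGen i j).1 P) =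
      X i ^ 2 * pderiv j (pderiv j P) + X j ^ 2 * pderiv i (pderiv i P)
      - 2 * (X i * X j * pderiv i (pderiv j P)) - X i * pderiv i P - X j * pderiv j P
      + (if i = j then 2 * (X i * pderiv i P) else 0) := fun i j => by
    have hcomm := pderiv_pderiv_comm i j P
    by_cases hij : i = j
    · subst hij
      simp only [rotDeriv_rotGen, sub_self, map_zero, if_true]
      ring
    · simp only [rotDeriv_rotGen, map_sub, pderiv_mul, pderiv_X_self, pderiv_X_of_ne hij,
        pderiv_X_of_ne (Ne.symm hij), hcomm, if_neg hij]
      ring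
  have h1 : ∑ i, ∑ j, (X i ^ 2 * pderiv j (pderiv j P) : MvPolynomial (Fin (n + 1)) ℂ) = 0 := by
    simp only [← Finset.mul_sum, hΔ, mul_zero, Finset.sum_const_zero]
  have h2 : ∑ i, ∑ j, (X j ^ 2 * pderiv i (pderiv i P) : MvPolynomial (Fin (n + 1)) ℂ) = 0 := by
    rw [Finset.sum_comm, h1]
  have h3 : ∑ i, ∑ j, 2 * (X i * X j * pderiv i (pderiv j P)) =
      2 * ((m * (m - 1) : ℂ) • P) := by
    rw [← hEE]; simp only [Finset.mul_sum]
  have h4 : ∑ i, ∑ _j : Fin (n + 1), X i * pderiv i P = ((n + 1) * m : ℂ) • P := by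
    rw [Finset.sum_comm, Finset.sum_const, hE, Finset.card_univ, Fintype.card_fin,
      ← Nat.cast_smul_eq_nsmul ℂ, smul_smul]
    push_cast
    rfl
  have h5 : ∑ _i : Fin (n + 1), ∑ j, X j * pderiv j P = ((n + 1) * m : ℂ) • P := by
    rw [Finset.sum_comm, h4]
  have h6 : ∑ i, ∑ j, (if i = j then 2 * (X i * pderiv i P) else 0) = 2 * ((m : ℂ) • P) := by
    simp only [Finset.sum_ite_eq, Finset.mem_univ, if_true, ← Finset.mul_sum, hE]
  simp only [key, Finset.sum_add_distrib, Finset.sum_sub_distrib, h1, h2, h3, h4, h5, h6]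
  simp only [smul_eq_C_mul, map_add, map_mul, map_natCast, map_ofNat, map_one, map_sub, map_neg]
  ring

/-- The operator `∑_{i,j} L_{ij}²` on densities, a multiple of the Casimir operator of `o(n+1)`. -/
def casimir (hn : 1 ≤ n) (lam : ℂ) : Module.End ℂ (TensorDensity n lam) :=
  ∑ i, ∑ j, lieAct hn lam (inclK (rotGen i j)) * lieAct hn lam (inclK (rotGen i j))

theorem casimir_apply_of_mem_HSpace (hn : 1 ≤ n) {m : ℕ} {φ : TensorDensity n lam}
    (hφ : φ ∈ HSpace n lam m) : casimir hn lam φ = (-(2 * m * (m + n - 1)) : ℂ) • φ := by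
  obtain ⟨P, hP, rfl⟩ := hφ
  simp only [casimir, LinearMap.sum_apply, Module.End.mul_apply, lieAct_polyDensity, ← map_sum]
  rw [sum_rotDeriv_rotDeriv hP, map_smul]

/-- The spaces `H^{n+1,m}` are independent, as eigenspaces of the Casimir operator for distinct
eigenvalues. -/
theorem iSupIndep_HSpace (hn : 1 ≤ n) (lam : ℂ) : iSupIndep (HSpace n lam) := by
  have hinj : Function.Injective fun m : ℕ => (-(2 * m * (m + n - 1)) : ℂ) := by
    intro a b hab
    obtain ⟨n, rfl⟩ := Nat.exists_eq_add_of_le' hn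
    have h1 : (2 * a * (a + n) : ℂ) = 2 * b * (b + n) := by
      have := neg_injective hab
      push_cast at this
      simpa [add_sub_assoc] using this
    have h2 : 2 * a * (a + n) = 2 * b * (b + n) := by exact_mod_cast h1
    rcases lt_trichotomy a b with h | h | h
    · nlinarith
    · exact h
    · nlinarith
  refine ((casimir hn lam).eigenspaces_iSupIndep.comp hinj).mono fun m φ hφ => ?_
  exact Module.End.mem_eigenspace_iff.2 (casimir_apply_of_mem_HSpace hn hφ)

theorem homogeneousComponent_laplacian (k : ℕ) (P : MvPolynomial (Fin (n + 1)) ℂ) :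
    homogeneousComponent k (laplacian n P) = laplacian n (homogeneousComponent (k + 2) P) := by
  conv_lhs => rw [← sum_homogeneousComponent P, map_sum, map_sum]
  have h : ∀ i, homogeneousComponent k (laplacian n (homogeneousComponent i P)) =
      if i = k + 2 then laplacian n (homogeneousComponent (k + 2) P) else 0 := fun i => by
    have hi := homogeneousComponent_isHomogeneous i P
    by_cases h2 : i < 2
    · rw [laplacian_eq_zero_of_lt_two hi h2, map_zero, if_neg (by omega)]
    · obtain ⟨j, rfl⟩ := Nat.exists_eq_add_of_le' (not_lt.1 h2)
      rw [homogeneousComponent_of_mem (isHomogeneous_laplacian hi)]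
      by_cases hj : j = k
      · subst hj; simp
      · rw [if_neg (Ne.symm hj), if_neg (by omega)]
  simp only [h, Finset.sum_ite_eq', Finset.mem_range]
  split_ifs with h3
  · rfl
  · rw [homogeneousComponent_eq_zero _ _ (by omega), map_zero]

theorem homogeneousComponent_mem_harmonicHomogeneous {P : MvPolynomial (Fin (n + 1)) ℂ}
    (hP : P ∈ harmonicPoly n) (m : ℕ) :
    homogeneousComponent m P ∈ harmonicHomogeneous n m := by
  refine ⟨?_, homogeneousComponent_isHomogeneous m P⟩
  change laplacian n (homogeneousComponent m P) = 0
  by_cases hm : m < 2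
  · exact laplacian_eq_zero_of_lt_two (homogeneousComponent_isHomogeneous m P) hm
  · obtain ⟨j, rfl⟩ := Nat.exists_eq_add_of_le' (not_lt.1 hm)
    rw [← homogeneousComponent_laplacian, show laplacian n P = 0 from hP, map_zero]

/-- A harmonic polynomial is determined by its restriction to the sphere. -/
theorem injOn_polyDensity (hn : 1 ≤ n) (lam : ℂ) :
    Set.InjOn (polyDensity n lam) (harmonicPoly n) := by
  have key : ∀ P ∈ harmonicPoly n, polyDensity n lam P = 0 → P = 0 := by
    intro P hP h0
    rw [← sum_homogeneousComponent P, map_sum] at h0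
    rw [← sum_homogeneousComponent P]
    refine Finset.sum_eq_zero fun m hm =>
      eq_zero_of_polyDensity_eq_zero hn (lam := lam) (homogeneousComponent_isHomogeneous m P) ?_
    have hmem : ∀ m, polyDensity n lam (homogeneousComponent m P) ∈ HSpace n lam m := fun m =>
      ⟨_, homogeneousComponent_mem_harmonicHomogeneous hP m, rfl⟩
    refine Submodule.disjoint_def.1 (iSupIndep_HSpace hn lam m) _ (hmem m) ?_
    rw [← Finset.add_sum_erase _ _ hm] at h0
    rw [eq_neg_of_add_eq_zero_left h0]
    refine Submodule.neg_mem _ (Submodule.sum_mem _ fun j hj => ?_)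
    exact Submodule.mem_iSup_of_mem j
      (Submodule.mem_iSup_of_mem (Finset.ne_of_mem_erase hj) (hmem j))
  intro P hP Q hQ h
  refine sub_eq_zero.1 (key _ (Submodule.sub_mem _ hP hQ) ?_)
  rw [map_sub, h, sub_self]

end

section

/-! ### `K`-finite densities are polynomial -/

open MeasureTheory Filter Topology

variable {n : ℕ} {lam : ℂ}

/-- The closed unit ball. -/
def unitBall (n : ℕ) : Set (Fin (n + 1) → ℝ) := {y | y ⬝ᵥ y ≤ 1}

theorem continuous_dotProduct_self (n : ℕ) :
    Continuous fun y : Fin (n + 1) → ℝ => y ⬝ᵥ y :=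
  (contDiff_dotProduct_self (n + 1)).continuous

theorem isCompact_unitBall (n : ℕ) : IsCompact (unitBall n) := by
  refine Metric.isCompact_of_isClosed_isBounded
    (isClosed_le (continuous_dotProduct_self n) continuous_const) ?_
  refine (Metric.isBounded_closedBall (x := (0 : Fin (n + 1) → ℝ)) (r := 1)).subset fun y hy => ?_
  rw [mem_closedBall_zero_iff, pi_norm_le_iff_of_nonneg zero_le_one]
  intro i
  have h1 : y i * y i ≤ y ⬝ᵥ y :=
    Finset.single_le_sum (f := fun i => y i * y i) (fun i _ => mul_self_nonneg _)
      (Finset.mem_univ i)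
  have h2 : y ⬝ᵥ y ≤ 1 := hy
  rw [Real.norm_eq_abs, abs_le]
  constructor <;> nlinarith

theorem dotProduct_le_one {x y : Fin (n + 1) → ℝ} (hx : x ⬝ᵥ x = 1) (hy : y ∈ unitBall n) :
    -1 ≤ x ⬝ᵥ y ∧ x ⬝ᵥ y ≤ 1 ∧ (x ⬝ᵥ y = 1 → y = x) := by
  have hy' : y ⬝ᵥ y ≤ 1 := hy
  have h1 : (y - x) ⬝ᵥ (y - x) = y ⬝ᵥ y - 2 * (x ⬝ᵥ y) + x ⬝ᵥ x := by
    simp only [sub_dotProduct, dotProduct_sub, dotProduct_comm y x]; ring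
  have h2 : (y + x) ⬝ᵥ (y + x) = y ⬝ᵥ y + 2 * (x ⬝ᵥ y) + x ⬝ᵥ x := by
    simp only [add_dotProduct, dotProduct_add, dotProduct_comm y x]; ring
  have h3 := dotProduct_self_nonneg_real (y - x)
  have h4 := dotProduct_self_nonneg_real (y + x)
  refine ⟨by linarith, by linarith, fun h => ?_⟩
  have h5 : (y - x) ⬝ᵥ (y - x) = 0 := by linarith
  exact sub_eq_zero.1 (dotProduct_self_eq_zero.1 h5)

theorem mem_closure_interior_unitBall {x : Fin (n + 1) → ℝ} (hx : x ⬝ᵥ x = 1) :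
    x ∈ closure (interior (unitBall n)) := by
  have h1 : {y : Fin (n + 1) → ℝ | y ⬝ᵥ y < 1} ⊆ interior (unitBall n) :=
    interior_maximal (fun y (hy : y ⬝ᵥ y < 1) => hy.le)
      (isOpen_lt (continuous_dotProduct_self n) continuous_const)
  refine closure_mono h1 ?_
  have h2 : Tendsto (fun t : ℝ => t • x) (𝓝[<] 1) (𝓝 x) := by
    have : Tendsto (fun t : ℝ => t • x) (𝓝 1) (𝓝 ((1 : ℝ) • x)) :=
      (continuous_id.smul continuous_const).tendsto 1
    rw [one_smul] at this
    exact this.mono_left nhdsWithin_le_nhds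
  refine mem_closure_of_tendsto h2 ?_
  filter_upwards [Ioo_mem_nhdsLT (show (0 : ℝ) < 1 by norm_num)] with t ht
  simp only [smul_dotProduct, dotProduct_smul, hx, smul_eq_mul]
  nlinarith [ht.1, ht.2]

theorem SO.measurePreserving_mulVec (k : SO n) :
    MeasurePreserving (fun y : Fin (n + 1) → ℝ => k.1 *ᵥ y) volume volume := by
  have hdet : k.1.det = 1 := k.2.2
  refine ⟨(Continuous.matrix_mulVec continuous_const continuous_id).measurable, ?_⟩
  have h := Real.map_matrix_volume_pi_eq_smul_volume_pi (M := k.1) (by rw [hdet]; norm_num)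
  rw [hdet, inv_one, abs_one, ENNReal.ofReal_one, one_smul] at h
  exact h

/-- Rotation invariance of integrals over the ball. -/
theorem integral_unitBall_rotate {F : Type*} [NormedAddCommGroup F] [NormedSpace ℝ F] (k : SO n)
    (h : (Fin (n + 1) → ℝ) → F) :
    ∫ y in unitBall n, h (k.1 *ᵥ y) = ∫ y in unitBall n, h y := by
  have hemb : MeasurableEmbedding fun y : Fin (n + 1) → ℝ => k.1 *ᵥ y :=
    (Continuous.matrix_mulVec continuous_const continuous_id).measurableEmbedding
      (SO.mulVec_injective k)
  rw [← (SO.measurePreserving_mulVec k).setIntegral_preimage_emb hemb h (unitBall n)]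
  congr 2
  ext y
  simp [unitBall, SO.dot]

theorem integrableOn_unitBall {F : Type*} [NormedAddCommGroup F] {h : (Fin (n + 1) → ℝ) → F}
    (hh : Continuous h) : IntegrableOn h (unitBall n) :=
  hh.continuousOn.integrableOn_compact (isCompact_unitBall n)

/-- The kernel `(1 + x · y)^j`, which concentrates at `y = x` for large `j` when `x` is on the
sphere and `y` in the ball. -/
def peak (j : ℕ) (x y : Fin (n + 1) → ℝ) : ℝ := (1 + x ⬝ᵥ y) ^ j

theorem continuous_peak (j : ℕ) (x : Fin (n + 1) → ℝ) : Continuous (peak j x) :=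
  (continuous_const.add (Continuous.dotProduct continuous_const continuous_id)).pow j

theorem peak_rotate (j : ℕ) (k : SO n) (x y : Fin (n + 1) → ℝ) :
    peak j (k.1 *ᵥ x) (k.1 *ᵥ y) = peak j x y := by
  rw [peak, SO.dot, peak]

/-- Integrating against the kernel yields a polynomial. -/
theorem exists_polyFun_eq_integral_peak (j : ℕ) {h : (Fin (n + 1) → ℝ) → ℂ} (hh : Continuous h) :
    ∃ P : MvPolynomial (Fin (n + 1)) ℂ, ∀ x,
      ∫ y in unitBall n, peak j x y • h y = polyFun P x := by
  induction j generalizing h with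
  | zero => exact ⟨MvPolynomial.C (∫ y in unitBall n, h y), fun x => by simp [peak, polyFun]⟩
  | succ j ih =>
    have hc : ∀ i, Continuous fun y : Fin (n + 1) → ℝ => (y i : ℂ) * h y := fun i =>
      (Complex.continuous_ofReal.comp (continuous_apply i)).mul hh
    obtain ⟨P, hP⟩ := ih hh
    choose Q hQ using fun i => ih (hc i)
    refine ⟨P + ∑ i, MvPolynomial.X i * Q i, fun x => ?_⟩
    have h1 : ∀ y, peak (j + 1) x y • h y =
        peak j x y • h y + ∑ i, (x i : ℂ) * (peak j x y • ((y i : ℂ) * h y)) := fun y => by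
      simp only [peak, pow_succ, dotProduct, Complex.real_smul]
      push_cast
      rw [mul_add, mul_one, add_mul, Finset.mul_sum, Finset.sum_mul]
      congr 1
      exact Finset.sum_congr rfl fun i _ => by ring
    have hi : ∀ {h : (Fin (n + 1) → ℝ) → ℂ}, Continuous h →
        IntegrableOn (fun y => peak j x y • h y) (unitBall n) := fun hh =>
      integrableOn_unitBall ((continuous_peak j x).smul hh)
    simp only [h1]
    rw [integral_add (hi hh) (integrable_finsetSum _ fun i _ => (hi (hc i)).const_mul _),
      integral_finsetSum _ fun i _ => (hi (hc i)).const_mul _]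
    simp only [integral_const_mul, hQ, hP]
    simp [polyFun]

/-- The normalized integrals against the kernels form an approximate identity. -/
theorem tendsto_integral_peak {h : (Fin (n + 1) → ℝ) → ℂ} (hh : Continuous h)
    {x : Fin (n + 1) → ℝ} (hx : x ⬝ᵥ x = 1) :
    Tendsto (fun j => (∫ y in unitBall n, peak j x y)⁻¹ • ∫ y in unitBall n, peak j x y • h y)
      atTop (𝓝 (h x)) := by
  refine tendsto_setIntegral_pow_smul_of_unique_maximum_of_isCompact_of_continuousOn
    (isCompact_unitBall n) (c := fun y => 1 + x ⬝ᵥ y)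
    (continuous_const.add
      (Continuous.dotProduct continuous_const continuous_id)).continuousOn (fun y hy hne => ?_)
    (fun y hy => ?_) ?_ (mem_closure_interior_unitBall hx) hh.continuousOn
  · obtain ⟨_, h2, h3⟩ := dotProduct_le_one hx hy
    rw [hx]
    have := lt_of_le_of_ne h2 fun h => hne (h3 h)
    linarith
  · linarith [(dotProduct_le_one hx hy).1]
  · rw [hx]; norm_num

/-- The linear form `φ ↦ ∫ (1 + y_0)^j φ(y) dy` on densities, seen as functions. -/
def peakForm (hn : 1 ≤ n) (lam : ℂ) (j : ℕ) : Module.Dual ℂ (TensorDensity n lam) where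
  toFun φ := ∫ y in unitBall n, peak j (Pi.single 0 1) y • radialExt φ y
  map_add' φ ψ := by
    have hi : ∀ φ : TensorDensity n lam,
        IntegrableOn (fun y => peak j (Pi.single 0 1) y • radialExt φ y) (unitBall n) := fun φ =>
      integrableOn_unitBall ((continuous_peak j _).smul (contDiff_radialExt hn φ).continuous)
    rw [← integral_add (hi φ) (hi ψ)]
    simp only [map_add, Pi.add_apply, smul_add]
  map_smul' c φ := by
    rw [RingHom.id_apply, ← integral_smul]
    simp only [map_smul, Pi.smul_apply, smul_comm c]

theorem peakForm_rotationRep (hn : 1 ≤ n) (j : ℕ) (k : SO n) (φ : TensorDensity n lam) :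
    peakForm hn lam j (rotationRep n lam k⁻¹ φ) =
      ∫ y in unitBall n, peak j (k.1 *ᵥ Pi.single 0 1) y • radialExt φ y := by
  rw [← integral_unitBall_rotate k]
  simp only [peak_rotate]
  change ∫ y in unitBall n, peak j (Pi.single 0 1) y • radialExt (rotationRep n lam k⁻¹ φ) y = _
  simp only [radialExt_rotationRep, inv_inv]

theorem integral_peak_rotate (j : ℕ) (k : SO n) (x : Fin (n + 1) → ℝ) :
    ∫ y in unitBall n, peak j (k.1 *ᵥ x) y = ∫ y in unitBall n, peak j x y := by
  rw [← integral_unitBall_rotate k]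
  simp only [peak_rotate]

/-- The map that sends a linear form `l` to the coefficient `k ↦ l (π k⁻¹ v)`. -/
def coefficient {V : Type*} [AddCommGroup V] [Module ℂ V] (π : Representation ℂ (SO n) V) (v : V) :
    Module.Dual ℂ V →ₗ[ℂ] (SO n → ℂ) :=
  LinearMap.pi fun k => LinearMap.applyₗ (π k⁻¹ v)

theorem finiteDimensional_range_coefficient {V : Type*} [AddCommGroup V] [Module ℂ V]
    (π : Representation ℂ (SO n) V) {v : V} (hv : v ∈ (kFinite π).toSubmodule) :
    FiniteDimensional ℂ (LinearMap.range (coefficient π v)) := by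
  set W := Submodule.span ℂ (Set.range fun k => π k v) with hW
  have hfin : FiniteDimensional ℂ W := hv
  have hmem : ∀ k, π k v ∈ W := fun k => Submodule.subset_span ⟨k, rfl⟩
  let c : Module.Dual ℂ W →ₗ[ℂ] (SO n → ℂ) :=
    LinearMap.pi fun k => LinearMap.applyₗ (⟨π k⁻¹ v, hmem k⁻¹⟩ : W)
  refine Submodule.finiteDimensional_of_le (S₂ := LinearMap.range c) ?_
  rintro _ ⟨l, rfl⟩
  exact ⟨l.comp W.subtype, rfl⟩

/-- A `K`-finite density is polynomial. Its convolutions with the kernels `(1 + x · y)^j` are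
polynomial, they converge to it, and, seen as functions on `K`, they lie in the space of
coefficients of its orbit; as this space has finite dimension, its subspace of polynomial functions
is closed. -/
theorem exists_polyDensity_eq_of_mem_kFinite (hn : 1 ≤ n) {φ : TensorDensity n lam}
    (hφ : φ ∈ (kFinite (rotationRep n lam)).toSubmodule) :
    ∃ P, polyDensity n lam P = φ := by
  set coeff := coefficient (rotationRep n lam) φ
  let res : MvPolynomial (Fin (n + 1)) ℂ →ₗ[ℂ] (SO n → ℂ) :=
    LinearMap.pi fun k => (MvPolynomial.aeval
      (fun i => (((k.1 *ᵥ Pi.single 0 1 : Fin (n + 1) → ℝ) i : ℝ) : ℂ))).toLinearMap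
  have hres : ∀ P k, res P k = polyFun P (k.1 *ᵥ Pi.single 0 1) := fun P k => by
    simp [res, polyFun, MvPolynomial.aeval_eq_eval]
  have hfin : FiniteDimensional ℂ (LinearMap.range coeff ⊓ LinearMap.range res :
      Submodule ℂ (SO n → ℂ)) :=
    have := finiteDimensional_range_coefficient _ hφ
    Submodule.finiteDimensional_of_le (S₂ := LinearMap.range coeff) inf_le_left
  have hclosed : IsClosed ((LinearMap.range coeff ⊓ LinearMap.range res : Submodule ℂ (SO n → ℂ)) :
      Set (SO n → ℂ)) := Submodule.closed_of_finiteDimensional _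
  have he0 : (Pi.single 0 1 : Fin (n + 1) → ℝ) ⬝ᵥ Pi.single 0 1 = 1 := by simp
  have hcont := (contDiff_radialExt hn φ).continuous
  have hlim : (fun k : SO n => radialExt φ (k.1 *ᵥ Pi.single 0 1)) ∈
      LinearMap.range coeff ⊓ LinearMap.range res := by
    refine hclosed.mem_of_tendsto (tendsto_pi_nhds.2 fun k =>
      tendsto_integral_peak hcont (by rw [SO.dot, he0])) (Eventually.of_forall fun j => ?_)
    have hsm : (fun k : SO n => (∫ y in unitBall n, peak j (k.1 *ᵥ Pi.single 0 1) y)⁻¹ •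
        ∫ y in unitBall n, peak j (k.1 *ᵥ Pi.single 0 1) y • radialExt φ y) =
        (((∫ y in unitBall n, peak (n := n) j (Pi.single 0 1) y)⁻¹ : ℝ) : ℂ) • fun k : SO n =>
          ∫ y in unitBall n, peak j (k.1 *ᵥ Pi.single 0 1) y • radialExt φ y := by
      funext k
      rw [integral_peak_rotate]
      simp only [Pi.smul_apply, Complex.real_smul, smul_eq_mul]
    rw [hsm]
    refine Submodule.smul_mem _ _ ⟨⟨peakForm hn lam j, funext fun k => ?_⟩, ?_⟩
    · exact peakForm_rotationRep hn j k φ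
    · obtain ⟨P, hP⟩ := exists_polyFun_eq_integral_peak j hcont
      exact ⟨P, funext fun k => by rw [hres, hP]⟩
  obtain ⟨P, hP⟩ := hlim.2
  refine ⟨P, ?_⟩
  rw [← mkDensity_radialExt hn φ, polyDensity_eq_mkDensity]
  refine mkDensity_congr hn _ _ fun x hx => ?_
  obtain ⟨k, rfl⟩ := SO.exists_mulVec_e0 hn hx
  rw [← hres, hP]

theorem HSpace_le_map_harmonicPoly (m : ℕ) :
    HSpace n lam m ≤ (harmonicPoly n).map (polyDensity n lam) :=
  Submodule.map_mono inf_le_left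

theorem kFinite_eq_iSup_HSpace (hn : 1 ≤ n) (lam : ℂ) :
    (kFinite (rotationRep n lam)).toSubmodule = ⨆ m, HSpace n lam m := by
  refine le_antisymm (fun φ hφ => ?_) (iSup_le HSpace_le_kFinite)
  obtain ⟨P, rfl⟩ := exists_polyDensity_eq_of_mem_kFinite hn hφ
  exact polyDensity_mem_iSup hn P

theorem kFinite_eq_map_harmonicPoly (hn : 1 ≤ n) (lam : ℂ) :
    (kFinite (rotationRep n lam)).toSubmodule = (harmonicPoly n).map (polyDensity n lam) := by
  rw [kFinite_eq_iSup_HSpace hn]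
  refine le_antisymm (iSup_le HSpace_le_map_harmonicPoly) ?_
  rintro _ ⟨P, -, rfl⟩
  exact polyDensity_mem_iSup hn P

end

section

/-! ### Powers of isotropic linear forms -/

variable {n : ℕ} {lam : ℂ}

open MvPolynomial

/-- The linear form `x ↦ ξ · x`. -/
def linForm (ξ : Fin (n + 1) → ℂ) : MvPolynomial (Fin (n + 1)) ℂ := ∑ i, C (ξ i) * X i

theorem eval_linForm (ξ z : Fin (n + 1) → ℂ) : eval z (linForm ξ) = ξ ⬝ᵥ z := by
  simp [linForm, dotProduct]

theorem linForm_smul (c : ℂ) (ξ : Fin (n + 1) → ℂ) : linForm (c • ξ) = c • linForm ξ := by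
  simp [linForm, Finset.smul_sum, smul_eq_C_mul, mul_assoc]

theorem linForm_add (ξ η : Fin (n + 1) → ℂ) : linForm (ξ + η) = linForm ξ + linForm η := by
  simp [linForm, Finset.sum_add_distrib, add_mul]

theorem linForm_zero : linForm (0 : Fin (n + 1) → ℂ) = 0 := by simp [linForm]

theorem isHomogeneous_linForm (ξ : Fin (n + 1) → ℂ) : (linForm ξ).IsHomogeneous 1 :=
  IsHomogeneous.sum _ _ _ fun _ _ => isHomogeneous_C_mul_X _ _

theorem isHomogeneous_linForm_pow (ξ : Fin (n + 1) → ℂ) (m : ℕ) :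
    (linForm ξ ^ m).IsHomogeneous m := by
  simpa using (isHomogeneous_linForm ξ).pow m

theorem pderiv_linForm (i : Fin (n + 1)) (ξ : Fin (n + 1) → ℂ) :
    pderiv i (linForm ξ) = C (ξ i) := by
  simp only [linForm, map_sum, pderiv_C_mul, pderiv_X]
  rw [Finset.sum_eq_single i (fun l _ hl => by simp [hl]) (by simp)]
  simp

theorem linForm_pow_mem_harmonicHomogeneous {ξ : Fin (n + 1) → ℂ} (hξ : ξ ⬝ᵥ ξ = 0) (m : ℕ) :
    linForm ξ ^ m ∈ harmonicHomogeneous n m := by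
  refine ⟨?_, isHomogeneous_linForm_pow ξ m⟩
  change laplacian n (linForm ξ ^ m) = 0
  have h1 : ∀ i, pderiv i (pderiv i (linForm ξ ^ m)) =
      ((m : MvPolynomial (Fin (n + 1)) ℂ) * ((m - 1 : ℕ) : MvPolynomial (Fin (n + 1)) ℂ) *
        linForm ξ ^ (m - 1 - 1)) * C (ξ i * ξ i) := fun i => by
    rw [pderiv_pow, pderiv_linForm, mul_assoc, ← C_eq_coe_nat, pderiv_C_mul, pderiv_mul, pderiv_pow,
      pderiv_linForm, pderiv_C, C_mul, C_eq_coe_nat]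
    ring
  simp only [laplacian_apply, h1, ← Finset.mul_sum, ← map_sum]
  rw [show ∑ i, ξ i * ξ i = 0 from hξ, map_zero, mul_zero]

theorem linSubst_linForm (M : Matrix (Fin (n + 1)) (Fin (n + 1)) ℝ) (ξ : Fin (n + 1) → ℂ) :
    linSubst M (linForm ξ) = linForm ((M.map ((↑) : ℝ → ℂ))ᵀ *ᵥ ξ) := by
  simp only [linForm, map_sum, map_mul, linSubst, aeval_X, Matrix.mulVec, dotProduct,
    Matrix.transpose_apply, Matrix.map_apply, Finset.mul_sum, Finset.sum_mul]
  rw [Finset.sum_comm]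
  refine Finset.sum_congr rfl fun j _ => Finset.sum_congr rfl fun i _ => ?_
  rw [← algebraMap_eq, AlgHom.commutes]
  ring

theorem rotDeriv_mul (B : Matrix (Fin (n + 1)) (Fin (n + 1)) ℝ)
    (P Q : MvPolynomial (Fin (n + 1)) ℂ) :
    rotDeriv B (P * Q) = rotDeriv B P * Q + P * rotDeriv B Q := by
  simp only [rotDeriv, pderiv_mul, neg_mul, mul_neg, Finset.sum_mul, Finset.mul_sum, ← neg_add,
    ← Finset.sum_add_distrib]
  refine congrArg Neg.neg ?_
  exact Finset.sum_congr rfl fun i _ => Finset.sum_congr rfl fun j _ => by ring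

theorem rotDeriv_pow (B : Matrix (Fin (n + 1)) (Fin (n + 1)) ℝ)
    (P : MvPolynomial (Fin (n + 1)) ℂ) (m : ℕ) :
    rotDeriv B (P ^ m) = m * P ^ (m - 1) * rotDeriv B P := by
  simp only [rotDeriv, pderiv_pow, mul_neg, Finset.mul_sum]
  refine congrArg Neg.neg ?_
  exact Finset.sum_congr rfl fun i _ => by ring

theorem rotDeriv_linForm (B : LieK n) (ξ : Fin (n + 1) → ℂ) :
    rotDeriv B.1 (linForm ξ) = linForm (B.1.map ((↑) : ℝ → ℂ) *ᵥ ξ) := by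
  have hB : ∀ i j, B.1 i j = -B.1 j i := fun i j => by
    have h := (LieAlgebra.Orthogonal.mem_so _ _ _).1 B.2
    exact congrFun (congrFun h j) i
  simp only [rotDeriv, pderiv_linForm]
  simp only [linForm, Matrix.mulVec, dotProduct, Matrix.map_apply, Finset.sum_mul, map_sum]
  rw [Finset.sum_comm, ← Finset.sum_neg_distrib]
  refine Finset.sum_congr rfl fun j _ => ?_
  rw [← Finset.sum_neg_distrib]
  refine Finset.sum_congr rfl fun i _ => ?_
  rw [hB j i]
  simp only [Complex.ofReal_neg, map_mul, map_neg]
  ring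

/-! ### Harmonic polynomials on the isotropic cone -/

/-- Division with remainder by `|x|²`, with respect to the variable `x_0`. -/
theorem exists_eq_normSqPoly_mul_add (P : MvPolynomial (Fin (n + 1)) ℂ) :
    ∃ (q : MvPolynomial (Fin (n + 1)) ℂ) (A B : MvPolynomial (Fin n) ℂ),
      P = normSqPoly n * q + rename Fin.succ A + X 0 * rename Fin.succ B := by
  induction P using MvPolynomial.induction_on with
  | C a => exact ⟨0, C a, 0, by simp⟩
  | add p q hp hq =>
    obtain ⟨q₁, A₁, B₁, h₁⟩ := hp
    obtain ⟨q₂, A₂, B₂, h₂⟩ := hq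
    refine ⟨q₁ + q₂, A₁ + A₂, B₁ + B₂, ?_⟩
    rw [h₁, h₂, map_add, map_add]
    ring
  | mul_X p i hp =>
    obtain ⟨q, A, B, h⟩ := hp
    refine Fin.cases ?_ (fun j => ?_) i
    · refine ⟨X 0 * q + rename Fin.succ B, -(∑ j, X j ^ 2) * B, A, ?_⟩
      have hr : normSqPoly n = X 0 ^ 2 + rename Fin.succ (∑ j : Fin n, X j ^ 2) := by
        rw [normSqPoly, Fin.sum_univ_succ]
        simp
      rw [h, map_mul, map_neg, hr]
      ring
    · refine ⟨X j.succ * q, X j * A, X j * B, ?_⟩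
      rw [h, map_mul, map_mul, rename_X]
      ring

/-- A polynomial that vanishes on the isotropic cone is a multiple of `|x|²`: its remainder
`A(x) + x_0 B(x)` vanishes for both square roots `x_0` of `-(x · x)`. -/
theorem exists_eq_normSqPoly_mul (hn : 1 ≤ n) {P : MvPolynomial (Fin (n + 1)) ℂ}
    (hP : ∀ z : Fin (n + 1) → ℂ, z ⬝ᵥ z = 0 → eval z P = 0) :
    ∃ q, P = normSqPoly n * q := by
  obtain ⟨q, A, B, h⟩ := exists_eq_normSqPoly_mul_add P
  have hev : ∀ (t : ℂ) (x : Fin n → ℂ), t ^ 2 = -(x ⬝ᵥ x) → eval x A + t * eval x B = 0 := by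
    intro t x ht
    have hz : (Fin.cons t x : Fin (n + 1) → ℂ) ⬝ᵥ Fin.cons t x = 0 := by
      simp only [dotProduct, Fin.sum_univ_succ, Fin.cons_zero, Fin.cons_succ] at ht ⊢
      rw [← sq, ht, neg_add_cancel]
    have hr : eval (Fin.cons t x : Fin (n + 1) → ℂ) (normSqPoly n) = 0 := by
      rw [← hz]; simp [normSqPoly, dotProduct, sq]
    have hc : (Fin.cons t x : Fin (n + 1) → ℂ) ∘ Fin.succ = x := by
      funext i; simp
    have := hP _ hz
    rw [h] at this
    simpa [hr, eval_rename, hc] using this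
  have hroot : ∀ x : Fin n → ℂ, ∃ t : ℂ, t ^ 2 = -(x ⬝ᵥ x) := fun x =>
    IsAlgClosed.exists_pow_nat_eq _ two_pos
  have hA : A = 0 := MvPolynomial.funext fun x => by
    obtain ⟨t, ht⟩ := hroot x
    have h1 := hev t x ht
    have h2 := hev (-t) x (by rw [neg_sq, ht])
    rw [map_zero]
    linear_combination (h1 + h2) / 2
  have hB : (∑ j : Fin n, X j ^ 2) * B = 0 := MvPolynomial.funext fun x => by
    obtain ⟨t, ht⟩ := hroot x
    have h1 := hev t x ht
    rw [hA, map_zero, zero_add] at h1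
    have h2 : eval x (∑ j : Fin n, X j ^ 2) = -t ^ 2 := by
      rw [ht]; simp [dotProduct, sq]
    rw [map_mul, h2, map_zero]
    linear_combination -t * h1
  have hne : (∑ j : Fin n, X j ^ 2 : MvPolynomial (Fin n) ℂ) ≠ 0 := fun h0 => by
    have h1 := congrArg (eval (Pi.single (⟨0, hn⟩ : Fin n) (1 : ℂ))) h0
    simp [Pi.single_apply] at h1
  refine ⟨q, ?_⟩
  rw [h, hA, (mul_eq_zero.1 hB).resolve_left hne]
  simp

/-- A harmonic homogeneous polynomial is determined by its values on the isotropic cone: if it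
vanishes there, then it is a multiple of `|x|²`, hence has the same restriction to the sphere as a
polynomial of lower degree. -/
theorem eq_zero_of_eval_isotropic (hn : 1 ≤ n) {m : ℕ} {P : MvPolynomial (Fin (n + 1)) ℂ}
    (hP : P ∈ harmonicHomogeneous n m)
    (h : ∀ z : Fin (n + 1) → ℂ, z ⬝ᵥ z = 0 → eval z P = 0) : P = 0 := by
  obtain ⟨q, rfl⟩ := exists_eq_normSqPoly_mul hn h
  by_cases hq : q = 0
  · rw [hq, mul_zero]
  have hr0 : normSqPoly n ≠ 0 := fun h0 => by
    have h1 := congrArg (eval (Pi.single (0 : Fin (n + 1)) (1 : ℂ))) h0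
    simp [normSqPoly, Pi.single_apply] at h1
  have hdeg : 2 + q.totalDegree = m := by
    rw [← isHomogeneous_normSqPoly.totalDegree hr0, ← totalDegree_mul_of_isDomain hr0 hq]
    exact IsHomogeneous.totalDegree hP.2 (mul_ne_zero hr0 hq)
  refine eq_zero_of_polyDensity_eq_zero hn (lam := 0) hP.2 ?_
  refine Submodule.disjoint_def.1 (iSupIndep_HSpace hn 0 m) _ ⟨_, hP, rfl⟩ ?_
  rw [polyDensity_normSqPoly_mul hn, ← sum_homogeneousComponent q, map_sum]
  refine Submodule.sum_mem _ fun k hk => ?_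
  have hk' : k < m := by
    have := Finset.mem_range.1 hk
    omega
  have hle : ⨆ l : Fin (k + 1), HSpace n 0 l ≤ ⨆ (j : ℕ) (_ : j ≠ m), HSpace n 0 j :=
    iSup_le fun l =>
      le_iSup₂_of_le (f := fun (j : ℕ) (_ : j ≠ m) => HSpace n 0 j) (l : ℕ) (by omega) le_rfl
  exact hle (polyDensity_mem_iSup_of_isHomogeneous hn (homogeneousComponent_isHomogeneous k q))

end

section

/-! ### Weights of the rotations of the first coordinate plane -/

variable {n : ℕ} {lam : ℂ}

open MvPolynomial

/-- The vector `e_0 + c e_1`, which is isotropic for `c = ± i`. -/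
def isoVec (hn : 1 ≤ n) (c : ℂ) : Fin (n + 1) → ℂ :=
  Pi.single 0 1 + Pi.single ⟨1, by omega⟩ c

theorem isoVec_zero (hn : 1 ≤ n) (c : ℂ) : isoVec hn c 0 = 1 := by
  simp [isoVec, Fin.ext_iff]

theorem isoVec_one (hn : 1 ≤ n) (c : ℂ) : isoVec hn c ⟨1, by omega⟩ = c := by
  simp [isoVec, Fin.ext_iff]

theorem isoVec_dotProduct (hn : 1 ≤ n) (c d : ℂ) : isoVec hn c ⬝ᵥ isoVec hn d = 1 + c * d := by
  rw [isoVec, add_dotProduct, single_dotProduct, single_dotProduct, isoVec_zero, isoVec_one,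
    one_mul]

theorem eval_linForm_isoVec_pow (hn : 1 ≤ n) (c d : ℂ) (m : ℕ) :
    eval (isoVec hn d) (linForm (isoVec hn c) ^ m) = (1 + c * d) ^ m := by
  rw [map_pow, eval_linForm, isoVec_dotProduct]

/-- The index of the first coordinate plane. -/
def firstPlane (hn : 1 ≤ n) : Fin ((n + 1) / 2) := ⟨0, by omega⟩

theorem planeGen_mulVec (r : Fin ((n + 1) / 2)) (ξ : Fin (n + 1) → ℂ) :
    (planeGen r).1.map ((↑) : ℝ → ℂ) *ᵥ ξ =
      Pi.single ⟨2 * r + 1, by omega⟩ (ξ ⟨2 * r, by omega⟩) -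
        Pi.single ⟨2 * r, by omega⟩ (ξ ⟨2 * r + 1, by omega⟩) := by
  have h : (planeGen r).1.map ((↑) : ℝ → ℂ) =
      Matrix.single (⟨2 * r + 1, by omega⟩ : Fin (n + 1)) (⟨2 * r, by omega⟩ : Fin (n + 1))
        (1 : ℂ) -
      Matrix.single (⟨2 * r, by omega⟩ : Fin (n + 1)) (⟨2 * r + 1, by omega⟩ : Fin (n + 1)) 1 := by
    ext i j
    simp only [planeGen, Matrix.map_apply, Matrix.sub_apply, Complex.ofReal_sub,
      Matrix.single_apply]
    split_ifs <;> simp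
  rw [h, Matrix.sub_mulVec, Matrix.single_mulVec, Matrix.single_mulVec, one_mul, one_mul]
  rfl

theorem planeGen_first_mulVec (hn : 1 ≤ n) (ξ : Fin (n + 1) → ℂ) :
    (planeGen (firstPlane hn)).1.map ((↑) : ℝ → ℂ) *ᵥ ξ =
      Pi.single ⟨1, by omega⟩ (ξ 0) - Pi.single 0 (ξ ⟨1, by omega⟩) :=
  planeGen_mulVec (firstPlane hn) ξ

theorem planeGen_first_mulVec_isoVec (hn : 1 ≤ n) {c : ℂ} (hc : c ^ 2 = -1) :
    (planeGen (firstPlane hn)).1.map ((↑) : ℝ → ℂ) *ᵥ isoVec hn c = (-c) • isoVec hn c := by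
  rw [planeGen_first_mulVec, isoVec_zero, isoVec_one, isoVec, smul_add, ← Pi.single_smul,
    ← Pi.single_smul, smul_eq_mul, smul_eq_mul, mul_one, show -c * c = 1 by linear_combination -hc,
    Pi.single_neg]
  abel

theorem rotDeriv_add (B : Matrix (Fin (n + 1)) (Fin (n + 1)) ℝ)
    (P Q : MvPolynomial (Fin (n + 1)) ℂ) : rotDeriv B (P + Q) = rotDeriv B P + rotDeriv B Q := by
  simp only [rotDeriv, map_add, mul_add, Finset.sum_add_distrib, neg_add]

theorem rotDeriv_smul (B : Matrix (Fin (n + 1)) (Fin (n + 1)) ℝ) (c : ℂ)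
    (P : MvPolynomial (Fin (n + 1)) ℂ) : rotDeriv B (c • P) = c • rotDeriv B P := by
  simp only [rotDeriv, Derivation.map_smul, mul_smul_comm, ← Finset.smul_sum, smul_neg]

theorem isHomogeneous_rotDeriv (B : Matrix (Fin (n + 1)) (Fin (n + 1)) ℝ) {m : ℕ}
    {P : MvPolynomial (Fin (n + 1)) ℂ} (hP : P.IsHomogeneous m) :
    (rotDeriv B P).IsHomogeneous m := by
  rcases Nat.eq_zero_or_pos m with rfl | hm
  · rw [← totalDegree_zero_iff_isHomogeneous, totalDegree_eq_zero_iff_eq_C] at hP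
    rw [hP]
    simp only [rotDeriv, pderiv_C, mul_zero, Finset.sum_const_zero, neg_zero]
    exact isHomogeneous_zero _ _ _
  · refine (IsHomogeneous.sum _ _ _ fun i _ => ?_).neg
    have h := (IsHomogeneous.sum Finset.univ (fun j => C (B i j : ℂ) * X j) 1
      fun j _ => isHomogeneous_C_mul_X _ _).mul (hP.pderiv (i := i))
    rwa [show 1 + (m - 1) = m by omega] at h

/-- The action of `H_1 = i (E_{21} - E_{12})` on polynomials. -/
def cartanAct (hn : 1 ≤ n) : Module.End ℂ (MvPolynomial (Fin (n + 1)) ℂ) where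
  toFun P := Complex.I • rotDeriv (planeGen (firstPlane hn)).1 P
  map_add' P Q := by rw [rotDeriv_add, smul_add]
  map_smul' c P := by rw [rotDeriv_smul, smul_comm, RingHom.id_apply]

theorem cartanAct_apply (hn : 1 ≤ n) (P : MvPolynomial (Fin (n + 1)) ℂ) :
    cartanAct hn P = Complex.I • rotDeriv (planeGen (firstPlane hn)).1 P := rfl

/-- The homogeneous polynomials of degree `m` of weight `j`. -/
def weightSpace (hn : 1 ≤ n) (j : ℤ) (m : ℕ) : Submodule ℂ (MvPolynomial (Fin (n + 1)) ℂ) :=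
  (cartanAct hn).eigenspace (j : ℂ) ⊓ homogeneousSubmodule (Fin (n + 1)) ℂ m

theorem mul_mem_weightSpace (hn : 1 ≤ n) {i j : ℤ} {l m : ℕ}
    {P Q : MvPolynomial (Fin (n + 1)) ℂ} (hP : P ∈ weightSpace hn i l)
    (hQ : Q ∈ weightSpace hn j m) : P * Q ∈ weightSpace hn (i + j) (l + m) := by
  have h1 := Module.End.mem_eigenspace_iff.1 hP.1
  have h2 := Module.End.mem_eigenspace_iff.1 hQ.1
  refine ⟨Module.End.mem_eigenspace_iff.2 ?_, hP.2.mul hQ.2⟩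
  rw [cartanAct_apply] at h1 h2 ⊢
  rw [rotDeriv_mul, smul_add, ← smul_mul_assoc, ← mul_smul_comm, h1, h2, smul_mul_assoc,
    mul_smul_comm, ← add_smul, Int.cast_add]

theorem linForm_mem_weightSpace (hn : 1 ≤ n) {j : ℤ} {ξ : Fin (n + 1) → ℂ}
    (h : Complex.I • ((planeGen (firstPlane hn)).1.map ((↑) : ℝ → ℂ) *ᵥ ξ) = (j : ℂ) • ξ) :
    linForm ξ ∈ weightSpace hn j 1 := by
  refine ⟨Module.End.mem_eigenspace_iff.2 ?_, isHomogeneous_linForm ξ⟩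
  rw [cartanAct_apply, rotDeriv_linForm, ← linForm_smul, h, linForm_smul]

theorem linForm_isoVec_mem_weightSpace (hn : 1 ≤ n) {s : ℤ} (hs : s ^ 2 = 1) :
    linForm (isoVec hn (s * Complex.I)) ∈ weightSpace hn s 1 := by
  have hs' : (s : ℂ) ^ 2 = 1 := by exact_mod_cast hs
  have hc : ((s : ℂ) * Complex.I) ^ 2 = -1 := by rw [mul_pow, hs', Complex.I_sq]; ring
  refine linForm_mem_weightSpace hn ?_
  rw [planeGen_first_mulVec_isoVec hn hc, smul_smul]
  congr 1
  linear_combination (-(s : ℂ)) * Complex.I_sq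

theorem linForm_single_mem_weightSpace (hn : 1 ≤ n) {i : Fin (n + 1)} (h0 : i ≠ 0)
    (h1 : i ≠ ⟨1, by omega⟩) : linForm (Pi.single i 1) ∈ weightSpace hn 0 1 := by
  refine linForm_mem_weightSpace hn ?_
  rw [planeGen_first_mulVec, Pi.single_eq_of_ne h0.symm, Pi.single_eq_of_ne h1.symm]
  simp

theorem linForm_single (i : Fin (n + 1)) : linForm (Pi.single i 1) = X i := by
  rw [linForm, Finset.sum_eq_single i (fun j _ hj => by simp [Pi.single_eq_of_ne hj]) (by simp)]
  simp

/-- The sum of the line spanned by `(x_0 + i x_1)^m` and of the spaces of polynomials of degree `m`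
and weight `j`, `-m ≤ j < m`. -/
def lowerWeights (hn : 1 ≤ n) (m : ℕ) : Submodule ℂ (MvPolynomial (Fin (n + 1)) ℂ) :=
  Submodule.span ℂ {linForm (isoVec hn Complex.I) ^ m} ⊔
    ⨆ j ∈ Finset.Ico (-m : ℤ) m, weightSpace hn j m

theorem weightSpace_le_lowerWeights (hn : 1 ≤ n) {j : ℤ} {m : ℕ} (h1 : -(m : ℤ) ≤ j) (h2 : j < m) :
    weightSpace hn j m ≤ lowerWeights hn m :=
  le_sup_of_le_right (le_iSup₂_of_le (f := fun (j : ℤ) (_ : j ∈ Finset.Ico (-m : ℤ) m) =>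
    weightSpace hn j m) j (Finset.mem_Ico.2 ⟨h1, h2⟩) le_rfl)

theorem linForm_isoVec_I_mem_weightSpace (hn : 1 ≤ n) :
    linForm (isoVec hn Complex.I) ∈ weightSpace hn 1 1 := by
  simpa using linForm_isoVec_mem_weightSpace hn (s := 1) (by norm_num)

theorem linForm_isoVec_neg_I_mem_weightSpace (hn : 1 ≤ n) :
    linForm (isoVec hn (-Complex.I)) ∈ weightSpace hn (-1) 1 := by
  simpa using linForm_isoVec_mem_weightSpace hn (s := -1) (by norm_num)

theorem linForm_isoVec_pow_mem_weightSpace (hn : 1 ≤ n) (m : ℕ) :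
    linForm (isoVec hn Complex.I) ^ m ∈ weightSpace hn m m := by
  induction m with
  | zero =>
    refine ⟨Module.End.mem_eigenspace_iff.2 ?_, isHomogeneous_linForm_pow _ 0⟩
    simp [cartanAct_apply, rotDeriv]
  | succ m ih =>
    rw [pow_succ]
    simpa using mul_mem_weightSpace hn ih (linForm_isoVec_I_mem_weightSpace hn)

theorem mul_mem_lowerWeights (hn : 1 ≤ n) {m : ℕ} {a : ℤ} (ha : a = -1 ∨ a = 0)
    {L P : MvPolynomial (Fin (n + 1)) ℂ} (hL : L ∈ weightSpace hn a 1)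
    (hP : P ∈ lowerWeights hn m) :
    L * P ∈ lowerWeights hn (m + 1) := by
  have h : lowerWeights hn m ≤ (lowerWeights hn (m + 1)).comap (LinearMap.mulLeft ℂ L) := by
    rw [lowerWeights]
    refine sup_le (Submodule.span_le.2 (Set.singleton_subset_iff.2 ?_))
      (iSup₂_le fun j hj Q hQ => ?_)
    · have h1 := mul_mem_weightSpace hn hL (linForm_isoVec_pow_mem_weightSpace hn m)
      rw [add_comm 1 m] at h1
      exact weightSpace_le_lowerWeights hn (by push_cast; omega) (by push_cast; omega) h1
    · have h1 := mul_mem_weightSpace hn hL hQ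
      rw [add_comm 1 m] at h1
      rw [Finset.mem_Ico] at hj
      exact weightSpace_le_lowerWeights hn (by push_cast; omega) (by push_cast; omega) h1
  exact h hP

theorem linForm_isoVec_mul_mem_lowerWeights (hn : 1 ≤ n) {m : ℕ}
    {P : MvPolynomial (Fin (n + 1)) ℂ} (hP : P ∈ lowerWeights hn m) :
    linForm (isoVec hn Complex.I) * P ∈ lowerWeights hn (m + 1) := by
  have h : lowerWeights hn m ≤ (lowerWeights hn (m + 1)).comap
      (LinearMap.mulLeft ℂ (linForm (isoVec hn Complex.I))) := by
    rw [lowerWeights]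
    refine sup_le (Submodule.span_le.2 (Set.singleton_subset_iff.2 ?_))
      (iSup₂_le fun j hj Q hQ => ?_)
    · refine le_sup_left (a := Submodule.span ℂ {linForm (isoVec hn Complex.I) ^ (m + 1)})
        (Submodule.mem_span_singleton.2 ⟨1, ?_⟩)
      rw [one_smul, LinearMap.mulLeft_apply, pow_succ']
    · have h1 := mul_mem_weightSpace hn (linForm_isoVec_I_mem_weightSpace hn) hQ
      rw [add_comm 1 m] at h1
      rw [Finset.mem_Ico] at hj
      exact weightSpace_le_lowerWeights hn (by push_cast; omega) (by push_cast; omega) h1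
  exact h hP

/-- Polynomials are sums of weight vectors, and the only ones of degree `m` and weight `m` are the
multiples of `(x_0 + i x_1)^m`. -/
theorem mem_lowerWeights (hn : 1 ≤ n) {m : ℕ} {P : MvPolynomial (Fin (n + 1)) ℂ}
    (hP : P.IsHomogeneous m) : P ∈ lowerWeights hn m := by
  induction m generalizing P with
  | zero =>
    rw [← totalDegree_zero_iff_isHomogeneous, totalDegree_eq_zero_iff_eq_C] at hP
    refine le_sup_left (a := Submodule.span ℂ {linForm (isoVec hn Complex.I) ^ 0})
      (Submodule.mem_span_singleton.2 ⟨coeff 0 P, ?_⟩)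
    rw [pow_zero, smul_eq_C_mul, mul_one, ← hP]
  | succ m ih =>
    have hX : ∀ i, ∀ Q ∈ lowerWeights hn m, X i * Q ∈ lowerWeights hn (m + 1) := by
      intro i Q hQ
      have hz := linForm_isoVec_mul_mem_lowerWeights hn hQ
      have hzb := mul_mem_lowerWeights hn (Or.inl rfl) (linForm_isoVec_neg_I_mem_weightSpace hn) hQ
      have hform : ∀ c, linForm (isoVec hn c) = X 0 + c • X (⟨1, by omega⟩ : Fin (n + 1)) := by
        intro c
        rw [isoVec, linForm_add, linForm_single, ← linForm_single ⟨1, by omega⟩, ← linForm_smul,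
          ← Pi.single_smul, smul_eq_mul, mul_one]
      rw [hform] at hz hzb
      by_cases h0 : i = 0
      · subst h0
        have := Submodule.smul_mem _ (1 / 2 : ℂ) (Submodule.add_mem _ hz hzb)
        rw [← add_mul, neg_smul, add_add_add_comm, add_neg_cancel, add_zero, ← two_smul ℂ (X 0),
          smul_mul_assoc, smul_smul] at this
        simpa using this
      by_cases h1 : i = ⟨1, by omega⟩
      · subst h1
        have := Submodule.smul_mem _ (1 / (2 * Complex.I) : ℂ) (Submodule.sub_mem _ hz hzb)
        rw [← sub_mul, add_sub_add_left_eq_sub, ← sub_smul, sub_neg_eq_add, ← two_mul,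
          smul_mul_assoc, smul_smul, one_div_mul_cancel (by simp), one_smul] at this
        exact this
      · rw [← linForm_single]
        exact mul_mem_lowerWeights hn (Or.inr rfl) (linForm_single_mem_weightSpace hn h0 h1) hQ
    have hE := hP.sum_X_mul_pderiv
    have h1 : ∑ i, X i * pderiv i P ∈ lowerWeights hn (m + 1) :=
      Submodule.sum_mem _ fun i _ => hX i _ (ih (by simpa using hP.pderiv (i := i)))
    rw [hE, ← Nat.cast_smul_eq_nsmul ℂ] at h1
    have h2 := Submodule.smul_mem _ (((m + 1 : ℕ) : ℂ)⁻¹) h1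
    rwa [smul_smul, inv_mul_cancel₀ (Nat.cast_ne_zero.2 (by omega)), one_smul] at h2

/-- A weight vector of degree `m` and weight `j ≠ m` vanishes at `e_0 - i e_1`: this vector spans a
line stable under `H_1`, so that Euler's formula computes the action of `H_1` there. -/
theorem eval_isoVec_eq_zero_of_mem_weightSpace (hn : 1 ≤ n) {j : ℤ} {m : ℕ} (hj : j ≠ m)
    {P : MvPolynomial (Fin (n + 1)) ℂ} (hP : P ∈ weightSpace hn j m) :
    eval (isoVec hn (-Complex.I)) P = 0 := by
  set a := isoVec hn (-Complex.I) with ha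
  have h1 := congrArg (eval a) (Module.End.mem_eigenspace_iff.1 hP.1)
  have hBa := planeGen_first_mulVec_isoVec hn (c := -Complex.I) (by rw [neg_sq, Complex.I_sq])
  have h2 : eval a (cartanAct hn P) = ∑ i, a i * eval a (pderiv i P) := by
    have hi : ∀ i, ∑ j, ((planeGen (firstPlane hn)).1 i j : ℂ) * a j =
        Complex.I * a i := fun i => by
      have := congrFun hBa i
      rw [neg_neg] at this
      exact this
    simp only [cartanAct_apply, rotDeriv, smul_eval, map_neg, map_sum, map_mul, eval_C, eval_X, hi]
    rw [mul_neg, Finset.mul_sum, ← Finset.sum_neg_distrib]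
    refine Finset.sum_congr rfl fun i _ => ?_
    linear_combination (-(a i * eval a (pderiv i P))) * Complex.I_sq
  have h3 := congrArg (eval a) (IsHomogeneous.sum_X_mul_pderiv hP.2)
  simp only [map_sum, map_mul, eval_X] at h3
  rw [h2, h3, map_nsmul, smul_eval, nsmul_eq_mul] at h1
  have hne : ((m : ℂ) - j) ≠ 0 := by
    rw [sub_ne_zero]
    exact_mod_cast hj.symm
  exact (mul_eq_zero.1
    (show ((m : ℂ) - j) * eval a P = 0 by linear_combination h1)).resolve_left hne

/-- If the sum of an eigenvector and of eigenvectors for other eigenvalues lies in an invariant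
subspace, then so does the eigenvector. -/
theorem mem_of_add_mem_of_eigenvector {V : Type*} [AddCommGroup V] [Module ℂ V]
    (f : Module.End ℂ V) {W : Submodule ℂ V} (hW : ∀ w ∈ W, f w ∈ W) {s : Finset ℤ} {μ : ℂ}
    (hμ : ∀ j ∈ s, (j : ℂ) ≠ μ) {v x : V} (hv : f v = μ • v)
    (hx : x ∈ ⨆ j ∈ s, f.eigenspace (j : ℂ)) (h : v + x ∈ W) : v ∈ W := by
  induction s using Finset.induction_on generalizing v x with
  | empty =>
    simp only [Finset.notMem_empty, iSup_false, iSup_bot, Submodule.mem_bot] at hx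
    rwa [hx, add_zero] at h
  | insert j s hjs ih =>
    rw [Finset.iSup_insert] at hx
    obtain ⟨x₀, hx₀, x₁, hx₁, rfl⟩ := Submodule.mem_sup.1 hx
    have hx₀' := Module.End.mem_eigenspace_iff.1 hx₀
    have hst : ⨆ i ∈ s, f.eigenspace (i : ℂ) ≤
        (⨆ i ∈ s, f.eigenspace (i : ℂ)).comap (f - (j : ℂ) • (1 : Module.End ℂ V)) := by
      refine iSup₂_le fun i hi y hy => ?_
      have hy' := Module.End.mem_eigenspace_iff.1 hy
      rw [Submodule.mem_comap, LinearMap.sub_apply, LinearMap.smul_apply, Module.End.one_apply, hy',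
        ← sub_smul]
      have hle : f.eigenspace (i : ℂ) ≤ ⨆ i ∈ s, f.eigenspace (i : ℂ) :=
        le_iSup₂_of_le (f := fun (i : ℤ) (_ : i ∈ s) => f.eigenspace (i : ℂ)) i hi le_rfl
      exact Submodule.smul_mem _ _ (hle hy)
    have hne : μ - j ≠ 0 := sub_ne_zero.2 (hμ j (Finset.mem_insert_self _ _)).symm
    have h1 : (μ - j) • v + (f x₁ - (j : ℂ) • x₁) ∈ W := by
      have := Submodule.sub_mem _ (hW _ h) (Submodule.smul_mem _ (j : ℂ) h)
      convert this using 1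
      rw [map_add, map_add, hv, hx₀']
      module
    have h2 := ih (fun i hi => hμ i (Finset.mem_insert_of_mem hi))
      (v := (μ - j) • v) (by rw [map_smul, hv, smul_comm]) (hst hx₁) h1
    have h3 := Submodule.smul_mem _ ((μ - j)⁻¹) h2
    rwa [smul_smul, inv_mul_cancel₀ hne, one_smul] at h3

/-- An invariant space of homogeneous polynomials that do not all vanish at `e_0 - i e_1` contains
the highest weight vector. -/
theorem linForm_pow_mem_of_eval_ne_zero (hn : 1 ≤ n) {m : ℕ}
    {W : Submodule ℂ (MvPolynomial (Fin (n + 1)) ℂ)} (hW : ∀ P ∈ W, cartanAct hn P ∈ W)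
    {P : MvPolynomial (Fin (n + 1)) ℂ} (hPW : P ∈ W) (hP : P.IsHomogeneous m)
    (h0 : eval (isoVec hn (-Complex.I)) P ≠ 0) : linForm (isoVec hn Complex.I) ^ m ∈ W := by
  obtain ⟨p, hp, x, hx, rfl⟩ := Submodule.mem_sup.1 (mem_lowerWeights hn hP)
  obtain ⟨c, rfl⟩ := Submodule.mem_span_singleton.1 hp
  have hx0 : eval (isoVec hn (-Complex.I)) x = 0 := by
    have hle : ⨆ j ∈ Finset.Ico (-m : ℤ) m, weightSpace hn j m ≤
        LinearMap.ker (aeval (R := ℂ) (isoVec hn (-Complex.I))).toLinearMap := by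
      refine iSup₂_le fun j hj Q hQ => ?_
      have := eval_isoVec_eq_zero_of_mem_weightSpace hn (Finset.mem_Ico.1 hj).2.ne hQ
      simpa [aeval_eq_eval] using this
    simpa [aeval_eq_eval] using hle hx
  have hc : c ≠ 0 := by
    rintro rfl
    rw [zero_smul, zero_add] at h0
    exact h0 hx0
  have hle : ⨆ j ∈ Finset.Ico (-m : ℤ) m, weightSpace hn j m ≤
      ⨆ j ∈ Finset.Ico (-m : ℤ) m, (cartanAct hn).eigenspace (j : ℂ) :=
    iSup₂_mono fun j _ => inf_le_left
  have hv := Module.End.mem_eigenspace_iff.1 (linForm_isoVec_pow_mem_weightSpace hn m).1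
  have h1 := mem_of_add_mem_of_eigenvector (cartanAct hn) hW (μ := ((m : ℤ) : ℂ))
    (fun j hj => by exact_mod_cast (Finset.mem_Ico.1 hj).2.ne)
    (v := c • linForm (isoVec hn Complex.I) ^ m) (by rw [map_smul, hv, smul_comm]) (hle hx) hPW
  have h2 := Submodule.smul_mem _ c⁻¹ h1
  rwa [smul_smul, inv_mul_cancel₀ hc, one_smul] at h2

end

section

/-! ### Irreducibility of the spaces of harmonic polynomials -/

variable {n : ℕ} {lam : ℂ}

open MvPolynomial MeasureTheory

theorem SO.map_mulVec_isoVec (hn : 1 ≤ n) (k : SO n) (c : ℂ) (i : Fin (n + 1)) :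
    (k.1.map ((↑) : ℝ → ℂ) *ᵥ isoVec hn c) i =
      ((k.1 *ᵥ Pi.single 0 1) i : ℂ) + c * ((k.1 *ᵥ Pi.single ⟨1, by omega⟩ 1) i : ℂ) := by
  rw [isoVec, Matrix.mulVec_add, Pi.add_apply, Matrix.mulVec_single, Matrix.mulVec_single,
    Matrix.mulVec_single, Matrix.mulVec_single]
  simp [Matrix.col, mul_comm]

theorem SO.exists_mulVec_pair (hn : 2 ≤ n) {u v : Fin (n + 1) → ℝ} (hu : u ⬝ᵥ u = 1)
    (hv : v ⬝ᵥ v = 1) (huv : u ⬝ᵥ v = 0) :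
    ∃ k : SO n, k.1 *ᵥ Pi.single 0 1 = u ∧ k.1 *ᵥ Pi.single ⟨1, by omega⟩ 1 = v := by
  have hne : (⟨1, by omega⟩ : Fin (n + 1)) ≠ 0 := by simp [Fin.ext_iff]
  obtain ⟨k, hk⟩ := SO.exists_mulVec_single (fun i => if i = 0 then u else v)
    {0, ⟨1, by omega⟩} (⟨2, by omega⟩ : Fin (n + 1)) (by simp [Fin.ext_iff]) (by
      rintro i (rfl | rfl) j (rfl | rfl)
      · simp [hu]
      · simp [hne, hne.symm, huv]
      · simp [hne, dotProduct_comm v u, huv]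
      · simp [hne, hv])
  refine ⟨k, ?_, ?_⟩
  · simpa using hk 0 (by simp)
  · simpa [hne] using hk ⟨1, by omega⟩ (by simp)

/-- The isotropic cone is the set of real multiples of the orbit of `e_0 - i e_1`. -/
theorem exists_eq_smul_mulVec_isoVec (hn : 2 ≤ n) {b : Fin (n + 1) → ℂ} (hb : b ⬝ᵥ b = 0) :
    ∃ (r : ℝ) (k : SO n),
      b = (r : ℂ) • (k.1.map ((↑) : ℝ → ℂ) *ᵥ isoVec (by omega : 1 ≤ n) (-Complex.I)) := by
  set u : Fin (n + 1) → ℝ := fun i => (b i).re with hu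
  set v : Fin (n + 1) → ℝ := fun i => (b i).im with hv
  have hre : u ⬝ᵥ u = v ⬝ᵥ v := by
    have := congrArg Complex.re hb
    simp only [dotProduct, Complex.re_sum, Complex.mul_re, Finset.sum_sub_distrib,
      Complex.zero_re] at this
    exact sub_eq_zero.1 this
  have him : u ⬝ᵥ v = 0 := by
    have := congrArg Complex.im hb
    simp only [dotProduct, Complex.im_sum, Complex.mul_im, Finset.sum_add_distrib,
      Complex.zero_im] at this
    have h2 : ∑ i, (b i).im * (b i).re = ∑ i, (b i).re * (b i).im :=
      Finset.sum_congr rfl fun i _ => mul_comm _ _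
    simp only [dotProduct, hu, hv]
    linarith
  have hbuv : ∀ i, b i = u i + v i * Complex.I := fun i => (Complex.re_add_im (b i)).symm
  by_cases h0 : u ⬝ᵥ u = 0
  · refine ⟨0, 1, funext fun i => ?_⟩
    have hu0 : u = 0 := dotProduct_self_eq_zero.1 h0
    have hv0 : v = 0 := dotProduct_self_eq_zero.1 (hre ▸ h0)
    rw [hbuv, hu0, hv0]
    simp
  · have hpos : 0 < u ⬝ᵥ u := lt_of_le_of_ne (dotProduct_self_nonneg_real u) (Ne.symm h0)
    set r := √(u ⬝ᵥ u) with hr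
    have hr0 : r ≠ 0 := (Real.sqrt_pos.2 hpos).ne'
    have hrr : r * r = u ⬝ᵥ u := Real.mul_self_sqrt hpos.le
    obtain ⟨k, hk0, hk1⟩ := SO.exists_mulVec_pair hn (u := r⁻¹ • u) (v := -(r⁻¹ • v))
      (by rw [smul_dotProduct, dotProduct_smul, ← hrr, smul_eq_mul, smul_eq_mul]; field_simp)
      (by rw [neg_dotProduct, dotProduct_neg, neg_neg, smul_dotProduct, dotProduct_smul, ← hre,
            ← hrr, smul_eq_mul, smul_eq_mul]; field_simp)
      (by rw [dotProduct_neg, smul_dotProduct, dotProduct_smul, him]; simp)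
    refine ⟨r, k, funext fun i => ?_⟩
    have hr0' : (r : ℂ) ≠ 0 := Complex.ofReal_ne_zero.2 hr0
    rw [Pi.smul_apply, SO.map_mulVec_isoVec, hk0, hk1, hbuv]
    simp only [Pi.smul_apply, Pi.neg_apply, smul_eq_mul, Complex.ofReal_neg, Complex.ofReal_mul,
      Complex.ofReal_inv]
    field_simp

/-- As the isotropic cone is the cone over one orbit, some rotation of a nonzero harmonic polynomial
does not vanish at `e_0 - i e_1`. -/
theorem exists_eval_linSubst_ne_zero (hn : 2 ≤ n) {m : ℕ} {P : MvPolynomial (Fin (n + 1)) ℂ}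
    (hP : P ∈ harmonicHomogeneous n m) (h0 : P ≠ 0) :
    ∃ k : SO n, eval (isoVec (by omega : 1 ≤ n) (-Complex.I)) (linSubst k.1 P) ≠ 0 := by
  by_contra! h
  refine h0 (eq_zero_of_eval_isotropic (by omega) hP fun b hb => ?_)
  obtain ⟨r, k, rfl⟩ := exists_eq_smul_mulVec_isoVec hn hb
  rw [eval_smul_of_isHomogeneous hP.2, ← eval_linSubst, h k, mul_zero]

/-- A `K`-stable space of harmonic homogeneous polynomials is stable under the Lie algebra of
`K`. -/
theorem rotDeriv_mem (hn : 1 ≤ n) {m : ℕ} {W : Submodule ℂ (MvPolynomial (Fin (n + 1)) ℂ)}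
    (hW : W ≤ harmonicHomogeneous n m) (hK : ∀ (k : SO n), ∀ P ∈ W, linSubst k.1 P ∈ W)
    (B : LieK n) {P : MvPolynomial (Fin (n + 1)) ℂ} (hP : P ∈ W) : rotDeriv B.1 P ∈ W := by
  let S : Subrepresentation (rotationRep n 0) :=
    { toSubmodule := W.map (polyDensity n 0)
      apply_mem_toSubmodule := by
        rintro k _ ⟨P, hP, rfl⟩
        rw [rotationRep_polyDensity]
        exact ⟨_, hK k⁻¹ P hP, rfl⟩ }
  have hS : S.toSubmodule ≤ (kFinite (rotationRep n 0)).toSubmodule :=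
    (Submodule.map_mono hW).trans (HSpace_le_kFinite m)
  have h := lieAct_inclK_mem hn S hS B (φ := polyDensity n 0 P) ⟨P, hP, rfl⟩
  rw [lieAct_polyDensity] at h
  obtain ⟨Q, hQ, hQP⟩ := h
  have h0 : Q - rotDeriv B.1 P = 0 := eq_zero_of_polyDensity_eq_zero hn (lam := 0)
    ((hW hQ).2.sub (isHomogeneous_rotDeriv B.1 (hW hP).2)) (by rw [map_sub, hQP, sub_self])
  rw [← sub_eq_zero.1 h0]
  exact hQ

/-- Every nonzero `K`-stable subspace of `H^{n+1,m}` contains the highest weight vector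
`(x_0 + i x_1)^m`. -/
theorem linForm_pow_mem_of_invariant (hn : 2 ≤ n) {m : ℕ}
    {W : Submodule ℂ (MvPolynomial (Fin (n + 1)) ℂ)} (hW : W ≤ harmonicHomogeneous n m)
    (hK : ∀ (k : SO n), ∀ P ∈ W, linSubst k.1 P ∈ W) (h0 : W ≠ ⊥) :
    linForm (isoVec (by omega : 1 ≤ n) Complex.I) ^ m ∈ W := by
  obtain ⟨P, hP, hP0⟩ := Submodule.exists_mem_ne_zero_of_ne_bot h0
  obtain ⟨k, hk⟩ := exists_eval_linSubst_ne_zero hn (hW hP) hP0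
  exact linForm_pow_mem_of_eval_ne_zero (by omega)
    (fun Q hQ => Submodule.smul_mem _ _ (rotDeriv_mem (by omega) hW hK _ hQ)) (hK k P hP)
    (hW (hK k P hP)).2 hk

/-- The rotation that fixes `e_0` and reverses `e_1`, which exists for `n ≥ 2`, exchanges
`(x_0 + i x_1)^m` and `(x_0 - i x_1)^m`. -/
theorem linForm_neg_pow_mem_of_invariant (hn : 2 ≤ n) {m : ℕ}
    {W : Submodule ℂ (MvPolynomial (Fin (n + 1)) ℂ)} (hW : W ≤ harmonicHomogeneous n m)
    (hK : ∀ (k : SO n), ∀ P ∈ W, linSubst k.1 P ∈ W) (h0 : W ≠ ⊥) :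
    linForm (isoVec (by omega : 1 ≤ n) (-Complex.I)) ^ m ∈ W := by
  have h := linForm_pow_mem_of_invariant hn hW hK h0
  obtain ⟨k, hk0, hk1⟩ := SO.exists_mulVec_pair hn (u := Pi.single 0 1)
    (v := -Pi.single (⟨1, by omega⟩ : Fin (n + 1)) 1) (by simp) (by simp) (by simp)
  have h2 := hK k⁻¹ _ h
  have h3 : (((k⁻¹ : SO n).1.map ((↑) : ℝ → ℂ))ᵀ *ᵥ isoVec (by omega : 1 ≤ n) Complex.I) =
      isoVec (by omega : 1 ≤ n) (-Complex.I) := by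
    have h4 : ((k⁻¹ : SO n).1.map ((↑) : ℝ → ℂ))ᵀ = k.1.map ((↑) : ℝ → ℂ) := rfl
    rw [h4]
    funext i
    rw [SO.map_mulVec_isoVec, hk0, hk1]
    simp only [isoVec, Pi.add_apply, Pi.neg_apply, Pi.single_apply]
    split_ifs <;> simp
  rwa [map_pow, linSubst_linForm, h3] at h2

/-- The integral of a polynomial over the unit ball. -/
def ballIntegral (n : ℕ) : MvPolynomial (Fin (n + 1)) ℂ →ₗ[ℂ] ℂ where
  toFun P := ∫ y in unitBall n, polyFun P y
  map_add' P Q := by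
    rw [← integral_add (integrableOn_unitBall (contDiff_polyFun P).continuous)
      (integrableOn_unitBall (contDiff_polyFun Q).continuous)]
    simp only [polyFun, map_add]
  map_smul' c P := by
    rw [RingHom.id_apply, ← integral_smul]
    simp only [polyFun, smul_eval, smul_eq_mul]

theorem ballIntegral_apply (P : MvPolynomial (Fin (n + 1)) ℂ) :
    ballIntegral n P = ∫ y in unitBall n, polyFun P y := rfl

theorem ballIntegral_linSubst (k : SO n) (P : MvPolynomial (Fin (n + 1)) ℂ) :
    ballIntegral n (linSubst k.1 P) = ballIntegral n P := by
  simp only [ballIntegral_apply, polyFun_linSubst]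
  exact integral_unitBall_rotate k (polyFun P)

/-- The integrand is `(x_0² + x_1²)^m`. -/
theorem ballIntegral_ne_zero (hn : 1 ≤ n) (m : ℕ) :
    ballIntegral n (linForm (isoVec hn Complex.I) ^ m * linForm (isoVec hn (-Complex.I)) ^ m) ≠
      0 := by
  set g : (Fin (n + 1) → ℝ) → ℝ := fun y => (y 0 ^ 2 + y ⟨1, by omega⟩ ^ 2) ^ m with hg
  have h1 : ∀ y, polyFun (linForm (isoVec hn Complex.I) ^ m *
      linForm (isoVec hn (-Complex.I)) ^ m) y = (g y : ℂ) := fun y => by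
    have h2 : ∀ c, eval (fun i => (y i : ℂ)) (linForm (isoVec hn c)) =
        y 0 + c * y ⟨1, by omega⟩ := fun c => by
      rw [eval_linForm, isoVec, add_dotProduct, single_dotProduct, single_dotProduct, one_mul]
    rw [polyFun, map_mul, map_pow, map_pow, h2, h2, ← mul_pow, hg]
    push_cast
    congr 1
    linear_combination (-(y ⟨1, by omega⟩ : ℂ) ^ 2) * Complex.I_sq
  have hgc : Continuous g := by fun_prop
  have hg0 : ∀ y, 0 ≤ g y := fun y => by positivity
  rw [ballIntegral_apply]
  simp only [h1]
  rw [integral_complex_ofReal, Complex.ofReal_ne_zero]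
  refine ne_of_gt ((setIntegral_pos_iff_support_of_nonneg_ae (Filter.Eventually.of_forall hg0)
    (integrableOn_unitBall hgc)).2 ?_)
  have hopen : IsOpen ({y : Fin (n + 1) → ℝ | y ⬝ᵥ y < 1} ∩ {y | y 0 ≠ 0}) :=
    (isOpen_lt (continuous_dotProduct_self n) continuous_const).inter
      (isOpen_ne_fun (continuous_apply 0) continuous_const)
  refine (hopen.measure_pos volume ⟨Pi.single 0 (1 / 2), ?_, ?_⟩).trans_le (measure_mono ?_)
  · simp; norm_num
  · simp
  · rintro y ⟨hy1, hy0⟩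
    have hy1' : y ⬝ᵥ y < 1 := hy1
    have hy0' : y 0 ≠ 0 := hy0
    have hpos : 0 < g y := by
      have : 0 < y 0 ^ 2 := by positivity
      positivity
    exact ⟨hpos.ne', hy1'.le⟩

/-- A nonzero `K`-stable subspace of `H^{n+1,m}` is the whole space: otherwise it has a nonzero
`K`-stable orthogonal complement for the invariant bilinear form `∫ P Q`; both contain the vectors
`(x_0 ± i x_1)^m`, which are not orthogonal. -/
theorem eq_harmonicHomogeneous_of_invariant (hn : 2 ≤ n) {m : ℕ}
    {W : Submodule ℂ (MvPolynomial (Fin (n + 1)) ℂ)} (hW : W ≤ harmonicHomogeneous n m)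
    (hK : ∀ (k : SO n), ∀ P ∈ W, linSubst k.1 P ∈ W) (h0 : W ≠ ⊥) :
    W = harmonicHomogeneous n m := by
  by_contra hne
  have hWfin : FiniteDimensional ℂ W := Submodule.finiteDimensional_of_le hW
  let T : harmonicHomogeneous n m →ₗ[ℂ] Module.Dual ℂ W :=
    (((LinearMap.mul ℂ (MvPolynomial (Fin (n + 1)) ℂ)).compr₂ (ballIntegral n)).compl₂
      W.subtype).comp (harmonicHomogeneous n m).subtype
  have hT : ∀ Q P, T Q P = ballIntegral n (Q.1 * P.1) := fun _ _ => rfl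
  have hlt : Module.finrank ℂ (Module.Dual ℂ W) < Module.finrank ℂ (harmonicHomogeneous n m) := by
    rw [Subspace.dual_finrank_eq]
    exact Submodule.finrank_lt_finrank_of_lt (lt_of_le_of_ne hW hne)
  have hker := LinearMap.ker_ne_bot_of_finrank_lt (f := T) hlt
  have hperp : ∀ Q ∈ (LinearMap.ker T).map (harmonicHomogeneous n m).subtype, ∀ P ∈ W,
      ballIntegral n (Q * P) = 0 := by
    rintro _ ⟨Q, hQ, rfl⟩ P hP
    have := LinearMap.congr_fun (LinearMap.mem_ker.1 hQ) ⟨P, hP⟩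
    rwa [hT] at this
  have h1 := linForm_pow_mem_of_invariant hn
    (W := (LinearMap.ker T).map (harmonicHomogeneous n m).subtype)
    (Submodule.map_subtype_le _ _) (by
      rintro k _ ⟨Q, hQ, rfl⟩
      refine ⟨⟨_, linSubst_mem_harmonicHomogeneous k Q.2⟩, LinearMap.mem_ker.2
        (LinearMap.ext fun P => ?_), rfl⟩
      rw [hT, LinearMap.zero_apply, ← ballIntegral_linSubst k⁻¹, map_mul]
      have h2 : linSubst (k⁻¹ : SO n).1 (linSubst k.1 Q.1) = Q.1 := by
        refine eq_of_sub_eq_zero (eq_zero_of_polyFun_eq_zero fun x => ?_)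
        rw [polyFun, map_sub, ← polyFun, ← polyFun, polyFun_linSubst, polyFun_linSubst,
          SO.mulVec_inv_mulVec, sub_self]
      rw [h2]
      exact hperp _ ⟨Q, hQ, rfl⟩ _ (hK k⁻¹ P.1 P.2))
    (fun h => hker (Submodule.map_injective_of_injective (Submodule.injective_subtype _)
      (h.trans (Submodule.map_bot _).symm)))
  exact ballIntegral_ne_zero (by omega) m
    (hperp _ h1 _ (linForm_neg_pow_mem_of_invariant hn hW hK h0))

end

section

/-! ### Highest weights -/

variable {n : ℕ} {lam : ℂ}

open MvPolynomial

theorem isIrreducible_toRepresentation {G V : Type*} [Group G] [AddCommGroup V] [Module ℂ V]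
    {π : Representation ℂ G V} (S : Subrepresentation π) (h0 : S.toSubmodule ≠ ⊥)
    (h : ∀ U : Subrepresentation π, U.toSubmodule ≤ S.toSubmodule → U.toSubmodule ≠ ⊥ →
      U.toSubmodule = S.toSubmodule) : S.toRepresentation.IsIrreducible := by
  have hinj := Submodule.map_injective_of_injective (Submodule.injective_subtype S.toSubmodule)
  have : Nontrivial (Subrepresentation S.toRepresentation) := by
    refine ⟨⟨⊥, ⊤, fun he => h0 ?_⟩⟩
    have h1 : (⊥ : Submodule ℂ S.toSubmodule) = ⊤ := congrArg Subrepresentation.toSubmodule he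
    have h2 := congrArg (Submodule.map S.toSubmodule.subtype) h1
    rw [Submodule.map_bot, Submodule.map_top, Submodule.range_subtype] at h2
    exact h2.symm
  refine { eq_bot_or_eq_top := fun U => ?_ }
  let U' : Subrepresentation π :=
    { toSubmodule := U.toSubmodule.map S.toSubmodule.subtype
      apply_mem_toSubmodule := by
        rintro g _ ⟨v, hv, rfl⟩
        exact ⟨_, U.apply_mem_toSubmodule g hv, rfl⟩ }
  by_cases hU : U.toSubmodule = ⊥
  · exact Or.inl (Subrepresentation.toSubmodule_injective hU)
  · refine Or.inr (Subrepresentation.toSubmodule_injective (hinj ?_))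
    have h1 := h U' (Submodule.map_subtype_le _ _) fun h2 =>
      hU (hinj (h2.trans (Submodule.map_bot _).symm))
    refine h1.trans ?_
    change S.toSubmodule = Submodule.map S.toSubmodule.subtype ⊤
    rw [Submodule.map_top, Submodule.range_subtype]

theorem linForm_isoVec_pow_ne_zero (hn : 1 ≤ n) {s : ℤ} (hs : s ^ 2 = 1) (m : ℕ) :
    linForm (isoVec hn (s * Complex.I)) ^ m ≠ 0 := by
  intro h
  have h1 := congrArg (eval (isoVec hn (-(s * Complex.I)))) h
  have hs' : (s : ℂ) ^ 2 = 1 := by exact_mod_cast hs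
  rw [eval_linForm_isoVec_pow, map_zero,
    show (1 : ℂ) + s * Complex.I * -(s * Complex.I) = 2 by
      linear_combination hs' - (s : ℂ) ^ 2 * Complex.I_sq] at h1
  exact pow_ne_zero m two_ne_zero h1

theorem isoVec_isotropic (hn : 1 ≤ n) {s : ℤ} (hs : s ^ 2 = 1) :
    isoVec hn (s * Complex.I) ⬝ᵥ isoVec hn (s * Complex.I) = 0 := by
  have hs' : (s : ℂ) ^ 2 = 1 := by exact_mod_cast hs
  rw [isoVec_dotProduct]
  linear_combination (s : ℂ) ^ 2 * Complex.I_sq - hs'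

theorem cartan_mulVec (r : Fin ((n + 1) / 2)) (ξ : Fin (n + 1) → ℂ) :
    cartan r *ᵥ ξ = Complex.I • ((planeGen r).1.map ((↑) : ℝ → ℂ) *ᵥ ξ) := by
  have h0 : ((0 : LieK n) : Matrix (Fin (n + 1)) (Fin (n + 1)) ℝ).map Complex.ofReal = 0 := by
    ext i j; simp
  rw [cartan, complexElt, h0, zero_add, Matrix.smul_mulVec]

/-- The vectors `e_0 ± i e_1` have weight `± ε_1`. -/
theorem cartan_mulVec_isoVec (hn : 1 ≤ n) {s : ℤ} (hs : s ^ 2 = 1) (r : Fin ((n + 1) / 2)) :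
    cartan r *ᵥ isoVec hn (s * Complex.I) =
      ((if (r : ℕ) = 0 then s else 0 : ℤ) : ℂ) • isoVec hn (s * Complex.I) := by
  have hs' : (s : ℂ) ^ 2 = 1 := by exact_mod_cast hs
  rw [cartan_mulVec]
  split_ifs with hr
  · obtain rfl : r = firstPlane hn := Fin.ext hr
    rw [planeGen_first_mulVec_isoVec hn (by rw [mul_pow, hs', Complex.I_sq, one_mul]), smul_smul]
    congr 1
    linear_combination (-(s : ℂ)) * Complex.I_sq
  · have h0 : ∀ i : Fin (n + 1), 2 ≤ (i : ℕ) → isoVec hn (s * Complex.I) i = 0 := fun i hi => by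
      simp only [isoVec, Pi.add_apply]
      rw [Pi.single_eq_of_ne (by rw [Ne, Fin.ext_iff, Fin.val_zero]; omega),
        Pi.single_eq_of_ne (by rw [Ne, Fin.ext_iff]; simp only; omega), add_zero]
    rw [planeGen_mulVec, h0 _ (by simp only; omega), h0 _ (by simp only; omega)]
    simp

theorem smul_rotDeriv_linForm_pow {ξ : Fin (n + 1) → ℂ} {r : Fin ((n + 1) / 2)} {w : ℂ}
    (h : cartan r *ᵥ ξ = w • ξ) (m : ℕ) :
    Complex.I • rotDeriv (planeGen r).1 (linForm ξ ^ m) = (m * w) • linForm ξ ^ m := by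
  rw [rotDeriv_pow, rotDeriv_linForm, ← mul_smul_comm, ← linForm_smul, ← cartan_mulVec, h,
    linForm_smul]
  rcases m with _ | m
  · simp
  · rw [mul_smul_comm, mul_assoc, Nat.add_sub_cancel, ← pow_succ, ← nsmul_eq_mul,
      ← Nat.cast_smul_eq_nsmul ℂ, smul_smul, mul_comm w]

theorem rotDeriv_add_smul_rotDeriv_linForm_pow {ξ : Fin (n + 1) → ℂ} {B D : LieK n}
    (h : complexElt B D *ᵥ ξ = 0) (m : ℕ) :
    rotDeriv B.1 (linForm ξ ^ m) + Complex.I • rotDeriv D.1 (linForm ξ ^ m) = 0 := by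
  rw [rotDeriv_pow, rotDeriv_pow, rotDeriv_linForm, rotDeriv_linForm, ← mul_smul_comm, ← mul_add,
    ← linForm_smul, ← linForm_add, ← Matrix.smul_mulVec, ← Matrix.add_mulVec]
  rw [complexElt] at h
  rw [h, linForm_zero, mul_zero]

/-- The weights of the standard representation are `0` and the `± ε_r`: there are no vectors of
other weights. -/
theorem eq_zero_of_cartan_mulVec {η : Fin (n + 1) → ℂ} {w : Fin ((n + 1) / 2) → ℤ}
    (h : ∀ r, cartan r *ᵥ η = (w r : ℂ) • η) {r : Fin ((n + 1) / 2)}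
    (hw : w r = 2 ∨ w r ≠ 0 ∧ ∃ s, s ≠ r ∧ w s ≠ 0) : η = 0 := by
  have hout : ∀ r, w r ≠ 0 → ∀ l : Fin (n + 1), (l : ℕ) ≠ 2 * r → (l : ℕ) ≠ 2 * r + 1 →
      η l = 0 := fun r hr l h1 h2 => by
    have h3 := congrFun (h r) l
    rw [cartan_mulVec, planeGen_mulVec, Pi.smul_apply, Pi.smul_apply, Pi.sub_apply,
      Pi.single_eq_of_ne (by rw [Ne, Fin.ext_iff]; exact h2),
      Pi.single_eq_of_ne (by rw [Ne, Fin.ext_iff]; exact h1), sub_zero, smul_zero,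
      smul_eq_mul] at h3
    exact (mul_eq_zero.1 h3.symm).resolve_left (by exact_mod_cast hr)
  rcases hw with hr | ⟨hr, s, hsr, hs⟩
  · have h1 := congrFun (h r) ⟨2 * r, by omega⟩
    have h2 := congrFun (h r) ⟨2 * r + 1, by omega⟩
    rw [cartan_mulVec, planeGen_mulVec, hr] at h1 h2
    simp only [Pi.smul_apply, Pi.sub_apply, smul_eq_mul, Pi.single_eq_same] at h1 h2
    rw [Pi.single_eq_of_ne (by simp [Fin.ext_iff])] at h1 h2
    push_cast at h1 h2
    have h3 : η ⟨2 * r, by omega⟩ = 0 := by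
      linear_combination (Complex.I / 3) * h2 - (2 / 3) * h1 -
        (η ⟨2 * r, by omega⟩ / 3) * Complex.I_sq
    have h4 : η ⟨2 * r + 1, by omega⟩ = 0 := by
      rw [h3] at h2
      linear_combination (-1 / 2) * h2
    funext l
    by_cases hl1 : (l : ℕ) = 2 * r
    · rw [show l = ⟨2 * r, by omega⟩ from Fin.ext hl1, h3]; rfl
    by_cases hl2 : (l : ℕ) = 2 * r + 1
    · rw [show l = ⟨2 * r + 1, by omega⟩ from Fin.ext hl2, h4]; rfl
    exact hout r (by rw [hr]; norm_num) l hl1 hl2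
  · have hne : (s : ℕ) ≠ r := fun h => hsr (Fin.ext h)
    funext l
    by_cases hl : (l : ℕ) = 2 * r ∨ (l : ℕ) = 2 * r + 1
    · exact hout s hs l (by omega) (by omega)
    · exact hout r hr l (fun h => hl (Or.inl h)) (fun h => hl (Or.inr h))

/-- For a positive root `α`, the vector has weight `ε_1 + α`, which is not a weight of the standard
representation. -/
theorem complexElt_mulVec_isoVec_eq_zero (hn : 1 ≤ n) {α : Fin ((n + 1) / 2) → ℤ}
    (hα : IsPositiveRoot n α) {B D : LieK n}
    (h : ∀ r, cartan r * complexElt B D - complexElt B D * cartan r = (α r : ℂ) • complexElt B D) :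
    complexElt B D *ᵥ isoVec hn Complex.I = 0 := by
  have hξ : ∀ r, cartan r *ᵥ isoVec hn Complex.I =
      ((if (r : ℕ) = 0 then 1 else 0 : ℤ) : ℂ) • isoVec hn Complex.I := fun r => by
    simpa using cartan_mulVec_isoVec hn (s := 1) (by norm_num) r
  have hw : ∀ r, cartan r *ᵥ (complexElt B D *ᵥ isoVec hn Complex.I) =
      (((if (r : ℕ) = 0 then 1 else 0) + α r : ℤ) : ℂ) •
        (complexElt B D *ᵥ isoVec hn Complex.I) := fun r => by
    rw [Matrix.mulVec_mulVec, eq_add_of_sub_eq (h r), Matrix.add_mulVec, Matrix.smul_mulVec,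
      ← Matrix.mulVec_mulVec, hξ, Matrix.mulVec_smul, Int.cast_add, add_smul]
    exact add_comm _ _
  -- the first nonzero coefficient of a positive root is `1`
  obtain ⟨r, hr1, hr2⟩ : ∃ r, α r = 1 ∧ ∀ l, l < r → α l = 0 := by
    rcases hα with ⟨r, s, hrs, rfl | rfl⟩ | ⟨-, r, rfl⟩
    · refine ⟨r, ?_, fun l hl => ?_⟩
      · simp [hrs.ne]
      · simp [hl.ne, (hl.trans hrs).ne]
    · refine ⟨r, ?_, fun l hl => ?_⟩
      · simp [hrs.ne]
      · simp [hl.ne, (hl.trans hrs).ne]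
    · exact ⟨r, by simp, fun l hl => by simp [hl.ne]⟩
  refine eq_zero_of_cartan_mulVec hw (r := firstPlane hn) ?_
  have hf : ((firstPlane hn : Fin ((n + 1) / 2)) : ℕ) = 0 := rfl
  by_cases hr0 : (r : ℕ) = 0
  · left
    obtain rfl : r = firstPlane hn := Fin.ext hr0
    simp [hf, hr1]
  · right
    refine ⟨?_, r, fun he => hr0 (by rw [he, hf]), ?_⟩
    · rw [hr2 _ (Fin.lt_def.2 (by rw [hf]; omega))]; simp [hf]
    · simp [hr0, hr1]

/-- A simple `K`-submodule that contains the density of `(x_0 + s i x_1)^m` has highest weight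
`s m ε_1`, if this vector is annihilated by the positive root vectors. -/
theorem isSubmoduleOfTypeD_of_mem (hn : 1 ≤ n) (S : Subrepresentation (rotationRep n lam)) {m : ℕ}
    {s : ℤ} (hs : s ^ 2 = 1) (hS : S.toSubmodule ≤ HSpace n lam m)
    (hirr : IsSimpleOrder (Subrepresentation S.toRepresentation))
    (hmem : polyDensity n lam (linForm (isoVec hn (s * Complex.I)) ^ m) ∈ S.toSubmodule)
    (hroot : ∀ α, IsPositiveRoot n α → ∀ B D : LieK n,
      (∀ r, cartan r * complexElt B D - complexElt B D * cartan r = (α r : ℂ) • complexElt B D) →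
      complexElt B D *ᵥ isoVec hn (s * Complex.I) = 0) :
    IsSubmoduleOfTypeD (rotationRep n lam) S.toSubmodule (lastParam n (s * m)) := by
  have hK : S.toSubmodule ≤ (kFinite (rotationRep n lam)).toSubmodule :=
    hS.trans (HSpace_le_kFinite m)
  refine ⟨S, rfl, ⟨Submodule.finiteDimensional_of_le hS, hasContinuousCoefficients_of_le hn S hK,
    hirr, lieKAct hn S hK, isDifferential_lieKAct hn S hK, ⟨_, hmem⟩, fun h0 => ?_, fun r => ?_,
    fun α hα B D h => ?_⟩⟩
  · have h1 : polyDensity n lam (linForm (isoVec hn (s * Complex.I)) ^ m) = 0 :=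
      congrArg Subtype.val h0
    exact linForm_isoVec_pow_ne_zero hn hs m
      (eq_zero_of_polyDensity_eq_zero hn (isHomogeneous_linForm_pow _ m) h1)
  · refine Subtype.ext ?_
    change Complex.I • lieAct hn lam (inclK (planeGen r)) (polyDensity n lam
      (linForm (isoVec hn (s * Complex.I)) ^ m)) = ((lastParam n (s * m) (Fin.rev r) : ℤ) : ℂ) •
      polyDensity n lam (linForm (isoVec hn (s * Complex.I)) ^ m)
    rw [lieAct_polyDensity, ← map_smul, ← map_smul,
      smul_rotDeriv_linForm_pow (cartan_mulVec_isoVec hn hs r)]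
    have hr : ((Fin.rev r : Fin ((n + 1) / 2)) : ℕ) + 1 = (n + 1) / 2 ↔ (r : ℕ) = 0 := by
      rw [Fin.val_rev]; omega
    have hμ : ((m : ℂ) * ((if (r : ℕ) = 0 then s else 0 : ℤ) : ℂ)) =
        ((lastParam n (s * m) (Fin.rev r) : ℤ) : ℂ) := by
      simp only [lastParam, hr]
      split_ifs
      · push_cast; ring
      · simp
    rw [hμ]
  · refine Subtype.ext ?_
    change lieAct hn lam (inclK B) (polyDensity n lam (linForm (isoVec hn (s * Complex.I)) ^ m)) +
      Complex.I • lieAct hn lam (inclK D) (polyDensity n lam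
        (linForm (isoVec hn (s * Complex.I)) ^ m)) = 0
    rw [lieAct_polyDensity, lieAct_polyDensity, ← map_smul, ← map_add,
      rotDeriv_add_smul_rotDeriv_linForm_pow (hroot α hα B D h), map_zero]

theorem isIrreducible_HSubrep (hn : 2 ≤ n) (lam : ℂ) (m : ℕ) :
    IsSimpleOrder (Subrepresentation (HSubrep n lam m).toRepresentation) := by
  have hn1 : 1 ≤ n := by omega
  refine isIrreducible_toRepresentation (HSubrep n lam m) (fun h0 => ?_) fun U hU hU0 => ?_
  · have hI : isoVec hn1 Complex.I ⬝ᵥ isoVec hn1 Complex.I = 0 := by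
      simpa using isoVec_isotropic hn1 (s := 1) (by norm_num)
    have h1 : polyDensity n lam (linForm (isoVec hn1 Complex.I) ^ m) ∈
        (HSubrep n lam m).toSubmodule := ⟨_, linForm_pow_mem_harmonicHomogeneous hI m, rfl⟩
    rw [h0, Submodule.mem_bot] at h1
    have h2 := linForm_isoVec_pow_ne_zero hn1 (s := 1) (by norm_num) m
    rw [Int.cast_one, one_mul] at h2
    exact h2 (eq_zero_of_polyDensity_eq_zero hn1 (isHomogeneous_linForm_pow _ m) h1)
  · have hW := eq_harmonicHomogeneous_of_invariant hn (m := m)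
      (W := harmonicHomogeneous n m ⊓ U.toSubmodule.comap (polyDensity n lam)) inf_le_left
      (fun k P hP => ⟨linSubst_mem_harmonicHomogeneous k hP.1, by
        have h1 := U.apply_mem_toSubmodule k⁻¹ hP.2
        rw [rotationRep_polyDensity, inv_inv] at h1
        exact h1⟩)
      (fun h0 => hU0 ((Submodule.eq_bot_iff _).2 fun φ hφ => by
        obtain ⟨P, hP, rfl⟩ := hU hφ
        have h1 : P ∈ harmonicHomogeneous n m ⊓ U.toSubmodule.comap (polyDensity n lam) :=
          ⟨hP, hφ⟩
        rw [h0, Submodule.mem_bot] at h1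
        rw [h1, map_zero]))
    refine le_antisymm hU ?_
    rintro _ ⟨P, hP, rfl⟩
    exact (inf_eq_left.1 hW) hP

theorem isSubmoduleOfTypeD_HSpace (hn : 2 ≤ n) (lam : ℂ) (m : ℕ) :
    IsSubmoduleOfTypeD (rotationRep n lam) (HSpace n lam m) (lastParam n m) := by
  have hn1 : 1 ≤ n := by omega
  have hI := isoVec_isotropic hn1 (s := 1) (by norm_num)
  have h := isSubmoduleOfTypeD_of_mem hn1 (HSubrep n lam m) (s := 1) (by norm_num) le_rfl
    (isIrreducible_HSubrep hn lam m) ⟨_, linForm_pow_mem_harmonicHomogeneous hI m, rfl⟩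
    (fun α hα B D h => by
      rw [Int.cast_one, one_mul]
      exact complexElt_mulVec_isoVec_eq_zero hn1 hα h)
  rwa [one_mul] at h

/-! ### The circle -/

theorem linForm_isoVec_one (s : ℤ) : linForm (isoVec le_rfl (s * Complex.I)) =
    X 0 + C (s * Complex.I) * X (Fin.last 1) := by
  rw [isoVec, linForm_add, linForm_single, ← smul_eq_C_mul, ← linForm_single (Fin.last 1),
    ← linForm_smul, ← Pi.single_smul, smul_eq_mul, mul_one]
  rfl

theorem HLine_eq_span (lam : ℂ) (s : ℤ) (m : ℕ) : HLine 1 lam s m =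
    Submodule.span ℂ {polyDensity 1 lam (linForm (isoVec le_rfl (s * Complex.I)) ^ m)} := by
  rw [HLine, linForm_isoVec_one]

theorem HLine_le_HSpace (lam : ℂ) {s : ℤ} (hs : s ^ 2 = 1) (m : ℕ) :
    HLine 1 lam s m ≤ HSpace 1 lam m := by
  rw [HLine_eq_span, Submodule.span_le, Set.singleton_subset_iff]
  exact ⟨_, linForm_pow_mem_harmonicHomogeneous (isoVec_isotropic le_rfl hs) m, rfl⟩

/-- The vectors `e_0 ± i e_1` are common eigenvectors of the rotations of the plane. -/
theorem exists_mulVec_isoVec_eq_smul (k : SO 1) {s : ℤ} (hs : s ^ 2 = 1) :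
    ∃ c : ℂ, k.1.map ((↑) : ℝ → ℂ) *ᵥ isoVec le_rfl (s * Complex.I) =
      c • isoVec le_rfl (s * Complex.I) := by
  have hs' : (s : ℂ) ^ 2 = 1 := by exact_mod_cast hs
  have hT : k.1ᵀ = k.1.adjugate := by
    have hdet : k.1.det = 1 := k.2.2
    have h1 : k.1 * k.1.adjugate = 1 := by rw [Matrix.mul_adjugate, hdet, one_smul]
    rw [← Matrix.mul_one k.1ᵀ, ← h1, ← Matrix.mul_assoc, SO.transpose_mul, Matrix.one_mul]
  rw [Matrix.adjugate_fin_two] at hT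
  have h00 : k.1 0 0 = k.1 1 1 := congrFun (congrFun hT 0) 0
  have h10 : k.1 1 0 = -k.1 0 1 := congrFun (congrFun hT 0) 1
  have hv0 : isoVec le_rfl (s * Complex.I) (0 : Fin 2) = 1 := isoVec_zero le_rfl _
  have hv1 : isoVec le_rfl (s * Complex.I) (1 : Fin 2) = s * Complex.I := isoVec_one le_rfl _
  refine ⟨k.1 0 0 + k.1 0 1 * (s * Complex.I), funext fun i => ?_⟩
  rw [Pi.smul_apply, smul_eq_mul, Matrix.mulVec, dotProduct, Fin.sum_univ_two, hv0, hv1]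
  fin_cases i
  · simp only [Fin.zero_eta, Matrix.map_apply, hv0]
    ring
  · simp only [Fin.mk_one, Matrix.map_apply, hv1, h00, h10, Complex.ofReal_neg]
    linear_combination (-(k.1 0 1 : ℂ) * s ^ 2) * Complex.I_sq + (k.1 0 1 : ℂ) * hs'

/-- The line `H_{sm}` as a `K`-submodule. -/
def HLineSubrep (lam : ℂ) {s : ℤ} (hs : s ^ 2 = 1) (m : ℕ) :
    Subrepresentation (rotationRep 1 lam) where
  toSubmodule := HLine 1 lam s m
  apply_mem_toSubmodule k φ hφ := by
    rw [HLine_eq_span] at hφ ⊢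
    obtain ⟨a, rfl⟩ := Submodule.mem_span_singleton.1 hφ
    obtain ⟨c, hc⟩ := exists_mulVec_isoVec_eq_smul k hs
    have hT : ((k⁻¹ : SO 1).1.map ((↑) : ℝ → ℂ))ᵀ = k.1.map ((↑) : ℝ → ℂ) := rfl
    have h1 : linSubst (k⁻¹ : SO 1).1 (linForm (isoVec le_rfl (s * Complex.I)) ^ m) =
        c ^ m • linForm (isoVec le_rfl (s * Complex.I)) ^ m := by
      rw [map_pow, linSubst_linForm, hT, hc, linForm_smul, smul_pow]
    rw [map_smul, rotationRep_polyDensity, h1, map_smul]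
    exact Submodule.smul_mem _ _ (Submodule.smul_mem _ _ (Submodule.mem_span_singleton_self _))

theorem not_isPositiveRoot_one (α : Fin ((1 + 1) / 2) → ℤ) : ¬ IsPositiveRoot 1 α := by
  rintro (⟨r, s, hrs, -⟩ | ⟨h, -⟩)
  · have := r.2
    have := s.2
    have := Fin.lt_def.1 hrs
    omega
  · exact absurd h (by decide)

/-- On the circle there are no roots, and the weight of a line determines its type. -/
theorem isSubmoduleOfTypeD_HLine (lam : ℂ) {s : ℤ} (hs : s ^ 2 = 1) (m : ℕ) :
    IsSubmoduleOfTypeD (rotationRep 1 lam) (HLine 1 lam s m) (lastParam 1 (s * m)) := by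
  have hmem : polyDensity 1 lam (linForm (isoVec le_rfl (s * Complex.I)) ^ m) ∈
      HLine 1 lam s m := by
    rw [HLine_eq_span]
    exact Submodule.mem_span_singleton_self _
  refine isSubmoduleOfTypeD_of_mem le_rfl (HLineSubrep lam hs m) hs (HLine_le_HSpace lam hs m)
    (isIrreducible_toRepresentation _ (fun h0 => ?_) fun U hU hU0 => le_antisymm hU ?_) hmem
    fun α hα => absurd hα (not_isPositiveRoot_one α)
  · have h1 : polyDensity 1 lam (linForm (isoVec le_rfl (s * Complex.I)) ^ m) ∈
        (HLineSubrep lam hs m).toSubmodule := hmem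
    rw [h0, Submodule.mem_bot] at h1
    exact linForm_isoVec_pow_ne_zero le_rfl hs m
      (eq_zero_of_polyDensity_eq_zero le_rfl (isHomogeneous_linForm_pow _ m) h1)
  · obtain ⟨φ, hφ, hφ0⟩ := Submodule.exists_mem_ne_zero_of_ne_bot hU0
    have hφ' : φ ∈ HLine 1 lam s m := hU hφ
    rw [HLine_eq_span] at hφ'
    obtain ⟨a, rfl⟩ := Submodule.mem_span_singleton.1 hφ'
    have ha : a ≠ 0 := fun h => hφ0 (by rw [h, zero_smul])
    change HLine 1 lam s m ≤ U.toSubmodule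
    rw [HLine_eq_span, Submodule.span_le, Set.singleton_subset_iff]
    have := Submodule.smul_mem _ a⁻¹ hφ
    rwa [smul_smul, inv_mul_cancel₀ ha, one_smul] at this

/-- On the circle, a harmonic polynomial of degree `m` is determined by its values on the two
isotropic lines. -/
theorem HLine_sup_HLine (lam : ℂ) {m : ℕ} (hm : 1 ≤ m) :
    HLine 1 lam 1 m ⊔ HLine 1 lam (-1) m = HSpace 1 lam m := by
  refine le_antisymm (sup_le (HLine_le_HSpace lam (by norm_num) m)
    (HLine_le_HSpace lam (by norm_num) m)) ?_
  rintro _ ⟨P, hP, rfl⟩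
  set u := isoVec (le_refl 1) (((1 : ℤ) : ℂ) * Complex.I) with hu
  set v := isoVec (le_refl 1) (((-1 : ℤ) : ℂ) * Complex.I) with hv
  have huu : u ⬝ᵥ u = 0 := isoVec_isotropic le_rfl (by norm_num)
  have hvv : v ⬝ᵥ v = 0 := isoVec_isotropic le_rfl (by norm_num)
  have huv : u ⬝ᵥ v = 2 := by
    rw [hu, hv, isoVec_dotProduct]
    push_cast
    linear_combination -Complex.I_sq
  have h2 : (2 : ℂ) ^ m ≠ 0 := pow_ne_zero m two_ne_zero
  have hQ : P - ((eval v P / 2 ^ m) • linForm u ^ m + (eval u P / 2 ^ m) • linForm v ^ m) ∈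
      harmonicHomogeneous 1 m :=
    Submodule.sub_mem _ hP (Submodule.add_mem _
      (Submodule.smul_mem _ _ (linForm_pow_mem_harmonicHomogeneous huu m))
      (Submodule.smul_mem _ _ (linForm_pow_mem_harmonicHomogeneous hvv m)))
  have h0 := eq_zero_of_eval_isotropic le_rfl hQ fun z hz => by
    have hu0 : eval u (P - ((eval v P / 2 ^ m) • linForm u ^ m +
        (eval u P / 2 ^ m) • linForm v ^ m)) = 0 := by
      rw [map_sub, map_add, smul_eval, smul_eval, map_pow, map_pow, eval_linForm, eval_linForm, huu,
        dotProduct_comm v u, huv, zero_pow (by omega)]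
      field_simp
      ring
    have hv0 : eval v (P - ((eval v P / 2 ^ m) • linForm u ^ m +
        (eval u P / 2 ^ m) • linForm v ^ m)) = 0 := by
      rw [map_sub, map_add, smul_eval, smul_eval, map_pow, map_pow, eval_linForm, eval_linForm, hvv,
        huv, zero_pow (by omega)]
      field_simp
      ring
    have hz' : (z 1 - z 0 * Complex.I) * (z 1 + z 0 * Complex.I) = 0 := by
      rw [dotProduct, Fin.sum_univ_two] at hz
      linear_combination hz - z 0 ^ 2 * Complex.I_sq
    have hvec : ∀ c : ℂ, z 1 = z 0 * c → z = z 0 • isoVec (le_refl 1) c := fun c hc => by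
      have e0 : isoVec (le_refl 1) c (0 : Fin 2) = 1 := isoVec_zero le_rfl _
      have e1 : isoVec (le_refl 1) c (1 : Fin 2) = c := isoVec_one le_rfl _
      funext i
      fin_cases i
      · simp [e0]
      · simp [e1, hc]
    rcases mul_eq_zero.1 hz' with h | h
    · rw [hvec (((1 : ℤ) : ℂ) * Complex.I) (by push_cast; linear_combination h), ← hu,
        eval_smul_of_isHomogeneous hQ.2, hu0, mul_zero]
    · rw [hvec (((-1 : ℤ) : ℂ) * Complex.I) (by push_cast; linear_combination h), ← hv,
        eval_smul_of_isHomogeneous hQ.2, hv0, mul_zero]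
  rw [sub_eq_zero.1 h0, map_add, map_smul, map_smul, HLine_eq_span, HLine_eq_span]
  exact Submodule.add_mem_sup
    (Submodule.smul_mem _ _ (Submodule.mem_span_singleton_self _))
    (Submodule.smul_mem _ _ (Submodule.mem_span_singleton_self _))

theorem disjoint_HLine (lam : ℂ) {m : ℕ} (hm : 1 ≤ m) :
    Disjoint (HLine 1 lam 1 m) (HLine 1 lam (-1) m) := by
  rw [Submodule.disjoint_def, HLine_eq_span, HLine_eq_span]
  intro φ h1 h2
  obtain ⟨a, rfl⟩ := Submodule.mem_span_singleton.1 h1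
  obtain ⟨b, hb⟩ := Submodule.mem_span_singleton.1 h2
  rw [← map_smul, ← map_smul, ← sub_eq_zero, ← map_sub] at hb
  have h0 := eq_zero_of_polyDensity_eq_zero le_rfl
    ((homogeneousSubmodule (Fin (1 + 1)) ℂ m).sub_mem
      (Submodule.smul_mem _ b (isHomogeneous_linForm_pow _ m))
      (Submodule.smul_mem _ a (isHomogeneous_linForm_pow _ m))) hb
  have h3 := congrArg (eval (isoVec (le_refl 1) (((-1 : ℤ) : ℂ) * Complex.I))) h0
  rw [map_sub, smul_eval, smul_eval, eval_linForm_isoVec_pow, eval_linForm_isoVec_pow, map_zero,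
    show (1 : ℂ) + ((-1 : ℤ) : ℂ) * Complex.I * (((-1 : ℤ) : ℂ) * Complex.I) = 0 by
      push_cast; linear_combination Complex.I_sq,
    show (1 : ℂ) + ((1 : ℤ) : ℂ) * Complex.I * (((-1 : ℤ) : ℂ) * Complex.I) = 2 by
      push_cast; linear_combination -Complex.I_sq, zero_pow (by omega), mul_zero, zero_sub,
    neg_eq_zero] at h3
  rw [(mul_eq_zero.1 h3).resolve_right (pow_ne_zero m two_ne_zero), zero_smul]

theorem HSpace_zero_eq_HLine (lam : ℂ) : HSpace 1 lam 0 = HLine 1 lam 1 0 := by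
  refine le_antisymm ?_ (HLine_le_HSpace lam (by norm_num) 0)
  rintro _ ⟨P, hP, rfl⟩
  have h : P.IsHomogeneous 0 := hP.2
  rw [← totalDegree_zero_iff_isHomogeneous, totalDegree_eq_zero_iff_eq_C] at h
  rw [HLine_eq_span]
  refine Submodule.mem_span_singleton.2 ⟨coeff 0 P, ?_⟩
  rw [← map_smul, pow_zero, smul_eq_C_mul, mul_one, ← h]

end

end ConformalSphere

end

open ConformalSphere in
theorem mainTheorem4 (n : ℕ) (hn : 1 ≤ n) (lam : ℂ) :
    -- the action of `𝔤 = o(n+1,1)` on `F_λ(S^n)` by Lie derivatives of degree `λ`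
    ∃ ρ : LieGRep n (TensorDensity n lam),
      (∀ (A : LieG n) (φ : TensorDensity n lam),
        IsLieDerivative lam (confField A) φ (ρ A φ)) ∧
      -- the `K`-finite vectors are stable under `𝔤` and form a `(𝔤, K)`-module
      (∃ ρ' : LieGRep n (kFinite (rotationRep n lam)).toSubmodule,
        (∀ (A : LieG n) (φ : (kFinite (rotationRep n lam)).toSubmodule),
          ((ρ' A φ : (kFinite (rotationRep n lam)).toSubmodule) : TensorDensity n lam) =
            ρ A φ) ∧
        IsGKModule ρ' (kFinite (rotationRep n lam)).toRepresentation) ∧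
      -- they are the harmonic polynomials restricted to the sphere
      (kFinite (rotationRep n lam)).toSubmodule = (harmonicPoly n).map (polyDensity n lam) ∧
      Set.InjOn (polyDensity n lam) (harmonicPoly n) ∧
      (∀ (k : SO n) (P : MvPolynomial (Fin (n + 1)) ℂ),
        (rotationRep n lam k (polyDensity n lam P)).1 =
          volumeMul lam fun x =>
            polyFun P (((k⁻¹ : SO n) : Matrix (Fin (n + 1)) (Fin (n + 1)) ℝ).mulVec x)) ∧
      -- they are the direct sum of the `H^{n+1,m}`
      iSupIndep (HSpace n lam) ∧
      (kFinite (rotationRep n lam)).toSubmodule = ⨆ m, HSpace n lam m ∧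
      -- the `K`-types
      (2 ≤ n → ∀ m : ℕ,
        IsSubmoduleOfTypeD (rotationRep n lam) (HSpace n lam m) (lastParam n m)) ∧
      (n = 1 →
        IsSubmoduleOfTypeD (rotationRep n lam) (HSpace n lam 0) (lastParam n 0) ∧
        ∀ m : ℕ, 1 ≤ m →
          HLine n lam 1 m ⊔ HLine n lam (-1) m = HSpace n lam m ∧
          Disjoint (HLine n lam 1 m) (HLine n lam (-1) m) ∧
          IsSubmoduleOfTypeD (rotationRep n lam) (HLine n lam 1 m) (lastParam n m) ∧
          IsSubmoduleOfTypeD (rotationRep n lam) (HLine n lam (-1) m) (lastParam n (-m))) := by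
  refine ⟨lieRep hn lam, fun A φ => isLieDerivative_lieAct hn A φ,
    ⟨lieRepKFinite hn lam, fun _ _ => rfl, isGKModule_lieRepKFinite hn lam⟩,
    kFinite_eq_map_harmonicPoly hn lam, injOn_polyDensity hn lam,
    fun k P => funext fun x => funext fun v => volumeMul_rotate k⁻¹ (polyFun P) x v,
    iSupIndep_HSpace hn lam,
    kFinite_eq_iSup_HSpace hn lam, fun hn2 m => isSubmoduleOfTypeD_HSpace hn2 lam m, ?_⟩
  rintro rfl
  refine ⟨?_, fun m hm => ⟨HLine_sup_HLine lam hm, disjoint_HLine lam hm, ?_, ?_⟩⟩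
  · rw [HSpace_zero_eq_HLine]
    exact isSubmoduleOfTypeD_HLine lam (s := 1) (by norm_num) 0
  · have h := isSubmoduleOfTypeD_HLine lam (s := 1) (by norm_num) m
    rwa [one_mul] at h
  · have h := isSubmoduleOfTypeD_HLine lam (s := -1) (by norm_num) m
    rwa [neg_one_mul] at h
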